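/- **Setting.** Let $(\Omega,\mathcal F,(\mathcal F_t)_{t\ge 0},\mathbb Q)$ be a filtered probability space carrying two $(\mathcal F_t)$-Brownian motions $W$ and $Z$ with correlation $\rho\in(-1,1)$. Let $H\in(0,\tfrac12)$, $\nu>0$, $H_\pm:=H\pm\tfrac12$ and $$C_H:=\sqrt{\frac{2H\,\Gamma(2-H_+)}{\Gamma(H_+)\,\Gamma(2-2H)}} .$$ Let the initial forward variance curve $\xi_0=(\xi_0(t))_{t\ge 0}$ be strictly positive, possibly random, $\mathcal F_0$-measurable (jointly measurable in $t$ and $\omega$), with $\mathbb E\int_0^t\xi_0(s)\,\mathrm ds<\infty$ for every $t\geq 0$. In the rough Bergomi model, $$\mathcal V_t=\int_0^t(t-u)^{H_-}\,\mathrm dZ_u\quad\text{(jointly measurable version)},\qquad V_t=\xi_0(t)\,\mathcal E(2\nu C_H\mathcal V_t),\qquad \mathrm dX_t=-\tfrac12V_t\,\mathrm dt+\sqrt{V_t}\,\mathrm dW_t,\quad X_0=0,$$ where $\mathcal E(2\nu C_H\mathcal V_t):=\exp\big(2\nu C_H\mathcal V_t-\tfrac12(2\nu C_H)^2\int_0^t(t-u)^{2H_-}\,\mathrm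 du\big)$ and the stochastic integrals are Itô integrals ($L^2$-limits of integrals of simple predictable processes). Denote by $\langle X,X\rangle_t$ the quadratic variation of $X$ on $[0,t]$, that is, the limit in probability of sums of squared increments along every sequence of partitions of $[0,t]$ with mesh tending to $0$. For $T\ge 0$ and $\Delta>0$, the VIX at time $T$ and the price of the VIX future with maturity $T$ are $$\mathrm{VIX}_T:=\sqrt{\mathbb E\Big(\frac1\Delta\int_T^{T+\Delta}\mathrm d\langle X,X\rangle_s\,\Big|\,\mathcal F_T\Big)},\qquad \mathfrak V_T:=\mathbb E(\mathrm{VIX}_T\,|\,\mathcal F_0).$$ **Theorem.** For every $T\ge0$ and $\Delta>0$ these quantities are well defined (the quadratic variation exists on every $[0,t]$; $\frac1\Delta\int_T^{T+\Delta}\mathrm d\langle X,X\rangle_s$ and $\mathrm{VIX}_T$ are integrable; $\xi_0$ is almost surely integrable on $[T,T+\Delta]$) and, almost surely, $$\frac1\Delta\int_T^{T+\Delta}\sqrt{\xi_0(t)}\,\exp\Big(\frac{\nu^2C_H^2}{4H}\big[(t-T)^{2H}-t^{2H}\big]\Big)\mathrm dt\;\le\;\mathfrak V_T\;\le\;\Big\{\frac1\Delta\int_T^{T+\Delta}\xi_0(s)\,\mathrm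 ds\Big\}^{1/2}.$$ -/

import Mathlib

open MeasureTheory ProbabilityTheory Filter Topology
open scoped NNReal ENNReal

noncomputable section

namespace VIXFutures

variable {Ω : Type*} {m : MeasurableSpace Ω}

/-- `B` is a standard Brownian motion relative to the filtration `𝓕`: a Brownian motion, adapted
to `𝓕`, whose increments after time `s` are independent of `𝓕 s`. -/
structure IsBrownianMotion (𝓕 : Filtration ℝ≥0 m) (Q : Measure Ω) (B : ℝ≥0 → Ω → ℝ) : Prop where
  isBrownian : IsBrownianReal B Q
  adapted : StronglyAdapted 𝓕 B
  indep : ∀ s t : ℝ≥0, s ≤ t →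
    Indep (MeasurableSpace.comap (fun ω => B t ω - B s ω) inferInstance) (𝓕 s) Q

/-- The data of a bounded simple predictable process `∑_{i < n} c_i 1_{(t_i, t_{i+1}]}`, where
`t_0 ≤ t_1 ≤ ⋯` and each `c_i` is bounded and `𝓕 (t_i)`-measurable. -/
structure SimpleProcess (𝓕 : Filtration ℝ≥0 m) where
  n : ℕ
  time : ℕ → ℝ≥0
  mono : Monotone time
  coeff : ℕ → Ω → ℝ
  meas : ∀ i, StronglyMeasurable[𝓕 (time i)] (coeff i)
  bdd : ∀ i, ∃ C : ℝ, ∀ ω, |coeff i ω| ≤ C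

/-- The simple process as a function of time and scenario. -/
def SimpleProcess.toFun {𝓕 : Filtration ℝ≥0 m} (φ : SimpleProcess 𝓕) (u : ℝ) (ω : Ω) : ℝ :=
  ∑ i ∈ Finset.range φ.n,
    (Set.Ioc (φ.time i : ℝ) (φ.time (i + 1) : ℝ)).indicator (fun _ => φ.coeff i ω) u

/-- The elementary stochastic integral of a simple process against `B` over `(0, t]`. -/
def SimpleProcess.integral {𝓕 : Filtration ℝ≥0 m} (φ : SimpleProcess 𝓕) (B : ℝ≥0 → Ω → ℝ)
    (t : ℝ≥0) (ω : Ω) : ℝ :=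
  ∑ i ∈ Finset.range φ.n,
    φ.coeff i ω * (B (min (φ.time (i + 1)) t) ω - B (min (φ.time i) t) ω)

/-- `I` is (a version of) the Itô integral `∫_0^t φ_u dB_u`: there are simple predictable processes
converging to `φ` in `L²((0, t] × Ω, du ⊗ Q)` whose elementary integrals over `(0, t]` converge
to `I` in `L²(Q)`. -/
def IsItoIntegral (𝓕 : Filtration ℝ≥0 m) (Q : Measure Ω) (B : ℝ≥0 → Ω → ℝ)
    (φ : ℝ → Ω → ℝ) (t : ℝ≥0) (I : Ω → ℝ) : Prop :=
  MemLp I 2 Q ∧ ∃ φs : ℕ → SimpleProcess 𝓕,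
    Tendsto (fun k => eLpNorm (fun p : ℝ × Ω => (φs k).toFun p.1 p.2 - φ p.1 p.2) 2
      ((volume.restrict (Set.Ioc (0 : ℝ) t)).prod Q)) atTop (𝓝 0) ∧
    Tendsto (fun k => eLpNorm (fun ω => (φs k).integral B t ω - I ω) 2 Q) atTop (𝓝 0)

/-- `L` is (a version of) the quadratic variation `⟨X, X⟩_t`: for every sequence of partitions
`0 = π_{k,0} ≤ ⋯ ≤ π_{k,N k} = t` with mesh tending to zero, the sums of squared increments of `X`
converge to `L` in probability. -/
def HasQuadVar (Q : Measure Ω) (X : ℝ≥0 → Ω → ℝ) (t : ℝ≥0) (L : Ω → ℝ) : Prop :=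
  ∀ (N : ℕ → ℕ) (π : ℕ → ℕ → ℝ≥0),
    (∀ k, Monotone (π k)) → (∀ k, π k 0 = 0) → (∀ k, π k (N k) = t) →
    (∀ ε : ℝ, 0 < ε → ∀ᶠ k in atTop, ∀ i < N k, (π k (i + 1) : ℝ) - π k i < ε) →
    TendstoInMeasure Q
      (fun k ω => ∑ i ∈ Finset.range (N k), (X (π k (i + 1)) ω - X (π k i) ω) ^ 2) atTop L

open Classical in
/-- The quadratic variation `⟨X, X⟩_t` (unique up to null sets; `0` if it does not exist). -/
def quadVar (Q : Measure Ω) (X : ℝ≥0 → Ω → ℝ) (t : ℝ≥0) : Ω → ℝ :=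
  if h : ∃ L : Ω → ℝ, HasQuadVar Q X t L then h.choose else 0

/-- The constant `C_H = √(2 H Γ(2 - H₊) / (Γ(H₊) Γ(2 - 2H)))` with `H₊ = H + 1/2`. -/
def constC (H : ℝ) : ℝ :=
  Real.sqrt (2 * H * Real.Gamma (2 - (H + 1 / 2)) /
    (Real.Gamma (H + 1 / 2) * Real.Gamma (2 - 2 * H)))

/-- The Volterra kernel `u ↦ (t - u)^{H₋}` with `H₋ = H - 1/2`, used for `0 < u < t`. -/
def kernel (H t u : ℝ) : ℝ := (t - u) ^ (H - 1 / 2)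

/-- The instantaneous variance `V_t = ξ₀(t) ℰ(2 ν C_H 𝒱_t)`. Here `𝒱_t` is the value at time `t` of
the Gaussian martingale `s ↦ ∫_0^s (t - u)^{H₋} dZ_u`, and the stochastic exponential of a multiple
`c` of that martingale is `exp (c 𝒱_t - (c² / 2) ∫_0^t (t - u)^{2 H₋} du)`. -/
def instVar (H ν : ℝ) (ξ₀ 𝒱 : ℝ → Ω → ℝ) (t : ℝ) (ω : Ω) : ℝ :=
  ξ₀ t ω * Real.exp (2 * ν * constC H * 𝒱 t ω
    - (2 * ν * constC H) ^ 2 / 2 * ∫ u in (0 : ℝ)..t, kernel H t u ^ 2)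

/-- The rough Bergomi model on `(Ω, 𝓕, Q)`. Only times `t ≥ 0` matter in `ξ₀` and `𝒱`. -/
structure IsRoughBergomi (𝓕 : Filtration ℝ≥0 m) (Q : Measure Ω) (H ν ρ : ℝ)
    (ξ₀ : ℝ → Ω → ℝ) (W Z : ℝ≥0 → Ω → ℝ) (𝒱 : ℝ → Ω → ℝ) (X : ℝ≥0 → Ω → ℝ) : Prop where
  hurst : 0 < H ∧ H < 1 / 2
  nu_pos : 0 < ν
  rho_mem : -1 < ρ ∧ ρ < 1
  /-- The initial forward variance curve is positive, ... -/
  curve_pos : ∀ t ω, 0 ≤ t → 0 < ξ₀ t ω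
  /-- ... `𝓕 0`-measurable (jointly with time), ... -/
  curve_meas : @Measurable (ℝ × Ω) ℝ (MeasurableSpace.prod inferInstance (𝓕 0)) inferInstance
    (Function.uncurry ξ₀)
  /-- ... and integrable over `(0, t] × Ω` for every `t`. -/
  curve_int : ∀ t : ℝ, 0 ≤ t →
    Integrable (Function.uncurry ξ₀) ((volume.restrict (Set.Ioc (0 : ℝ) t)).prod Q)
  brownian_W : IsBrownianMotion 𝓕 Q W
  brownian_Z : IsBrownianMotion 𝓕 Q Z
  /-- The two Brownian motions have correlation `ρ`. -/
  correlation : ∀ s t : ℝ≥0, s ≤ t →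
    Q[fun ω => (W t ω - W s ω) * (Z t ω - Z s ω) | 𝓕 s] =ᵐ[Q] fun _ => ρ * ((t : ℝ) - s)
  /-- `𝒱` is a jointly measurable version of the Volterra process `𝒱_t = ∫_0^t (t - u)^{H₋} dZ_u`. -/
  volterra_meas : Measurable (Function.uncurry 𝒱)
  volterra : ∀ t : ℝ≥0, IsItoIntegral 𝓕 Q Z (fun u _ => kernel H t u) t (𝒱 t)
  /-- The log-price: `X_t = -(1/2) ∫_0^t V_u du + ∫_0^t √V_u dW_u` almost surely. -/
  log_price : ∀ t : ℝ≥0, ∃ M : Ω → ℝ,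
    IsItoIntegral 𝓕 Q W (fun u ω => Real.sqrt (instVar H ν ξ₀ 𝒱 u ω)) t M ∧
    X t =ᵐ[Q] fun ω => -(1 / 2) * (∫ u in (0 : ℝ)..t, instVar H ν ξ₀ 𝒱 u ω) + M ω

/-- The average realised variance `(1/Δ) ∫_T^{T+Δ} d⟨X, X⟩_s`. -/
def realizedVar (Q : Measure Ω) (X : ℝ≥0 → Ω → ℝ) (T Δ : ℝ≥0) (ω : Ω) : ℝ :=
  1 / (Δ : ℝ) * (quadVar Q X (T + Δ) ω - quadVar Q X T ω)

/-- `VIX_T`, the square root of `𝔼[(1/Δ) ∫_T^{T+Δ} d⟨X, X⟩_s | 𝓕_T]`. -/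
def vix (𝓕 : Filtration ℝ≥0 m) (Q : Measure Ω) (X : ℝ≥0 → Ω → ℝ) (T Δ : ℝ≥0) (ω : Ω) : ℝ :=
  Real.sqrt ((Q[realizedVar Q X T Δ | 𝓕 T]) ω)

/-- The price at time `0` of the VIX future with maturity `T`: `𝔼[VIX_T | 𝓕_0]`. -/
def vixFuture (𝓕 : Filtration ℝ≥0 m) (Q : Measure Ω) (X : ℝ≥0 → Ω → ℝ) (T Δ : ℝ≥0) : Ω → ℝ :=
  Q[vix 𝓕 Q X T Δ | 𝓕 0]

end VIXFutures

end

namespace VIXFutures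

/-! ### Gaussian moments and independence of Brownian increments. -/

section Increments

variable {Ω : Type*} {m : MeasurableSpace Ω} {Q : Measure Ω} {𝓕 : Filtration ℝ≥0 m}
  {B : ℝ≥0 → Ω → ℝ}

/-! The quadratic variation of the log-price is the integrated variance, so the squared VIX is the
time average over (T, T + Δ] of the forward variances Y_t = E(V_t | 𝓕_T). The two bounds are
Jensen's inequality for the concave square root: averaging over scenarios given 𝓕_0, with E(Y_t |
𝓕_0) = ξ₀(t), gives the upper one; averaging over t gives VIX_T ≥ (1/Δ) ∫ √Y_t dt, and the lower one
follows once E(√Y_t | 𝓕_0) is computed.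

The quadratic variation is built directly from the L² definition of the Itô integral. For a simple
integrand, squared increments minus their compensators are martingale differences of second moment
O((t - s)²), so their sum over a partition is small in L² with the mesh. The Itô isometry carries
this over to general integrands with an error that does not depend on the partition
(`exists_mesh_integral_abs_quadVar_le`). An absolutely continuous drift contributes nothing
(`hasQuadVar_of_ito`).

The forward variance is explicit because the kernel is deterministic: 𝒱_t = A + (𝒱_t - A), where A =
E(𝒱_t | 𝓕_T) is centred Gaussian given 𝓕_0 with variance v₁ = ∫_0^T (t - u)^(2H - 1) du, and the
remainder is centred Gaussian given 𝓕_T (`IsItoIntegral.exists_gaussian_decomposition`). With c =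
2νC_H this yields Y_t = ξ₀(t) exp(cA - c²v₁/2), and E(√Y_t | 𝓕_0) = √ξ₀(t) exp(-c²v₁/8), which is
the integrand of the lower bound (`IsRoughBergomi.exists_forwardVar`).

Conditional expectations are mostly expressed by integrating against nonnegative measurable weights
with values in [0, ∞]. Both Jensen steps then reduce to 2z ≤ z²/h + h integrated with weight 1/h,
and no version of Y_t jointly measurable in time is needed (`setLIntegral_lintegral_le_of_sqrt`,
`setLIntegral_le_of_sq`). -/

lemma IsBrownianMotion.stronglyMeasurable (hB : IsBrownianMotion 𝓕 Q B) (t : ℝ≥0) :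
    StronglyMeasurable (B t) := (hB.adapted t).mono (𝓕.le t)

lemma IsBrownianMotion.stronglyMeasurable_le (hB : IsBrownianMotion 𝓕 Q B) {s t : ℝ≥0}
    (hst : s ≤ t) : StronglyMeasurable[𝓕 t] (B s) := (hB.adapted s).mono (𝓕.mono hst)

lemma IsBrownianMotion.hasLaw_incr (hB : IsBrownianMotion 𝓕 Q B) {s t : ℝ≥0} (hst : s ≤ t) :
    HasLaw (fun ω => B t ω - B s ω) (gaussianReal 0 (t - s)) Q := by
  have h := hB.isBrownian.toIsPreBrownianReal.hasLaw_sub t s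
  have e : nndist t.1 s.1 = t - s := by
    ext
    rw [NNReal.coe_sub hst, coe_nndist, Real.dist_eq, abs_of_nonneg]
    · rfl
    · exact sub_nonneg.2 (NNReal.coe_le_coe.2 hst)
  rw [e] at h
  exact h

lemma IsBrownianMotion.memLp_incr (hB : IsBrownianMotion 𝓕 Q B) {s t : ℝ≥0} (hst : s ≤ t)
    (p : ℝ≥0) : MemLp (fun ω => B t ω - B s ω) p Q := by
  have h := hB.hasLaw_incr hst
  have h2 : MemLp id p (Q.map (fun ω => B t ω - B s ω)) := by
    rw [h.map_eq]; exact memLp_id_gaussianReal p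
  exact (memLp_map_measure_iff (by fun_prop) h.aemeasurable).1 h2

lemma IsBrownianMotion.memLp_incr' (hB : IsBrownianMotion 𝓕 Q B) (s t : ℝ≥0)
    {p : ℝ≥0∞} (hp : p ≠ ∞) : MemLp (fun ω => B t ω - B s ω) p Q := by
  lift p to ℝ≥0 using hp
  rcases le_total s t with h | h
  · exact hB.memLp_incr h p
  · refine (hB.memLp_incr h p).neg.congr_norm ?_ ?_
    · exact ((hB.stronglyMeasurable t).sub (hB.stronglyMeasurable s)).aestronglyMeasurable
    · exact Eventually.of_forall fun ω => by simp

lemma IsBrownianMotion.integral_incr (hB : IsBrownianMotion 𝓕 Q B) {s t : ℝ≥0} (hst : s ≤ t) :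
    ∫ ω, (B t ω - B s ω) ∂Q = 0 := by
  rw [(hB.hasLaw_incr hst).integral_eq, integral_id_gaussianReal]

lemma IsBrownianMotion.integral_incr_sq (hB : IsBrownianMotion 𝓕 Q B) {s t : ℝ≥0}
    (hst : s ≤ t) : ∫ ω, (B t ω - B s ω) ^ 2 ∂Q = (t : ℝ) - s := by
  have h := hB.hasLaw_incr hst
  have h1 := h.variance_eq
  rw [variance_id_gaussianReal, variance_of_integral_eq_zero h.aemeasurable
    (hB.integral_incr hst)] at h1
  rw [h1, NNReal.coe_sub hst]

/-- Brownian scaling reduces to the standard Gaussian. Its fourth moment stays an unevaluated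
constant, since only the factor (t - s)² matters below. -/
lemma IsBrownianMotion.integral_incr_pow_four (hB : IsBrownianMotion 𝓕 Q B) {s t : ℝ≥0}
    (hst : s ≤ t) : ∫ ω, (B t ω - B s ω) ^ 4 ∂Q =
      (∫ x, x ^ 4 ∂(gaussianReal 0 1)) * ((t : ℝ) - s) ^ 2 := by
  have h := hB.hasLaw_incr hst
  have h1 := h.integral_comp (f := fun x : ℝ => x ^ 4)
    (by fun_prop)
  have e : gaussianReal 0 (t - s) =
      Measure.map (fun x => Real.sqrt ((t : ℝ) - s) * x) (gaussianReal 0 1) := by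
    rw [gaussianReal_map_const_mul]
    congr 1
    · simp
    · ext
      have : (0 : ℝ) ≤ (t : ℝ) - s := sub_nonneg.2 (NNReal.coe_le_coe.2 hst)
      simp [NNReal.coe_sub hst, Real.sq_sqrt this]
  simp only [Function.comp_def] at h1
  rw [h1, e, integral_map (by fun_prop) (by fun_prop), ← integral_mul_const]
  congr 1
  ext x
  have : (0 : ℝ) ≤ (t : ℝ) - s := sub_nonneg.2 (NNReal.coe_le_coe.2 hst)
  rw [mul_pow, show (4 : ℕ) = 2 * 2 from rfl, pow_mul (Real.sqrt _), Real.sq_sqrt this]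
  ring

lemma IsBrownianMotion.indepFun (hB : IsBrownianMotion 𝓕 Q B) {s t : ℝ≥0} (hst : s ≤ t)
    {E : Type*} [MeasurableSpace E] {Y : Ω → E} (hY : Measurable[𝓕 s] Y) :
    IndepFun Y (fun ω => B t ω - B s ω) Q := by
  rw [IndepFun_iff_Indep]
  exact (indep_of_indep_of_le_right (hB.indep s t hst) hY.comap_le).symm

lemma IsBrownianMotion.integral_mul_incr (hB : IsBrownianMotion 𝓕 Q B) {s t : ℝ≥0}
    (hst : s ≤ t) {Y : Ω → ℝ} (hY : StronglyMeasurable[𝓕 s] Y) :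
    ∫ ω, Y ω * (B t ω - B s ω) ∂Q = 0 := by
  have h := (hB.indepFun hst hY.measurable).integral_mul_eq_mul_integral
    (hY.mono (𝓕.le s)).aestronglyMeasurable (hB.memLp_incr hst 1).1
  rw [hB.integral_incr hst, mul_zero] at h
  exact h

lemma IsBrownianMotion.integral_mul_incr_sq (hB : IsBrownianMotion 𝓕 Q B) {s t : ℝ≥0}
    (hst : s ≤ t) {Y : Ω → ℝ} (hY : StronglyMeasurable[𝓕 s] Y) :
    ∫ ω, Y ω * (B t ω - B s ω) ^ 2 ∂Q = (∫ ω, Y ω ∂Q) * ((t : ℝ) - s) := by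
  have h := ((hB.indepFun hst hY.measurable).comp measurable_id
    (measurable_id.pow_const 2)).integral_mul_eq_mul_integral
    (hY.mono (𝓕.le s)).aestronglyMeasurable
    (by exact (hB.memLp_incr hst 1).1.pow 2)
  simp only [Function.comp_def, id, Pi.mul_apply, hB.integral_incr_sq hst] at h
  exact h

lemma memLp_bdd_mul {p : ℝ≥0∞} {f g : Ω → ℝ} (hg : MemLp g p Q) (hf : StronglyMeasurable f)
    (hfb : ∃ C : ℝ, ∀ ω, |f ω| ≤ C) : MemLp (fun ω => f ω * g ω) p Q := by
  obtain ⟨C, hC⟩ := hfb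
  refine hg.of_le_mul (c := C) (hf.aestronglyMeasurable.mul hg.1) (Eventually.of_forall fun ω => ?_)
  rw [norm_mul]
  exact mul_le_mul_of_nonneg_right (hC ω) (norm_nonneg _)

end Increments

/-! ### The Itô isometry for simple processes. -/

section Isometry

variable {Ω : Type*} {m : MeasurableSpace Ω} {Q : Measure Ω} {𝓕 : Filtration ℝ≥0 m}
  {B : ℝ≥0 → Ω → ℝ}

/-- The projection of `b` onto the interval `[s, t]`. -/
def clamp (s t b : ℝ≥0) : ℝ≥0 := max s (min b t)

lemma clamp_mono (s t : ℝ≥0) : Monotone (clamp s t) := fun _ _ h =>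
  max_le_max le_rfl (min_le_min h le_rfl)

lemma le_clamp (s t b : ℝ≥0) : s ≤ clamp s t b := le_max_left _ _

/-- Rewrites increments of integrals stopped at s and t through points of [s, t], so that every
block starts at or after s and events of 𝓕 s can be absorbed into its coefficient. -/
lemma sub_min_eq_sub_clamp {s t : ℝ≥0} (hst : s ≤ t) (f : ℝ≥0 → ℝ) (b : ℝ≥0) :
    f (min b t) - f (min b s) = f (clamp s t b) - f s := by
  unfold clamp
  rcases le_total b s with h | h
  · rw [min_eq_left h, min_eq_left (h.trans hst), max_eq_left h]; simp
  · rw [min_eq_right h, max_eq_right (le_min h hst)]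

lemma Ioc_inter_Ioc_eq_clamp {s t : ℝ≥0} (hst : s ≤ t) (a b : ℝ≥0) :
    Set.Ioc (a : ℝ) b ∩ Set.Ioc (s : ℝ) t = Set.Ioc (clamp s t a : ℝ) (clamp s t b) := by
  have hst' : (s : ℝ) ≤ t := NNReal.coe_le_coe.2 hst
  ext x
  simp only [clamp, NNReal.coe_max, NNReal.coe_min, Set.mem_inter_iff, Set.mem_Ioc, max_lt_iff,
    min_lt_iff, le_max_iff, le_min_iff]
  constructor
  · rintro ⟨⟨h1, h2⟩, h3, h4⟩
    exact ⟨⟨h3, Or.inl h1⟩, Or.inr ⟨h2, h4⟩⟩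
  · rintro ⟨⟨h1, h2⟩, h3⟩
    rcases h3 with h3 | h3
    · linarith
    · refine ⟨⟨?_, h3.1⟩, h1, h3.2⟩
      rcases h2 with h2 | h2
      · exact h2
      · linarith [h3.2]

lemma IsBrownianMotion.integrable_mul_incr_mul_incr [IsProbabilityMeasure Q]
    (hB : IsBrownianMotion 𝓕 Q B)
    {Y : Ω → ℝ} (hY : StronglyMeasurable Y) (hYb : ∃ C : ℝ, ∀ ω, |Y ω| ≤ C) (a b a' b' : ℝ≥0) :
    Integrable (fun ω => Y ω * ((B b ω - B a ω) * (B b' ω - B a' ω))) Q := by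
  obtain ⟨C, hC⟩ := hYb
  have := (hB.memLp_incr' a b (p := 2) (by simp)).integrable_mul
    (hB.memLp_incr' a' b' (p := 2) (by simp))
  exact this.bdd_mul hY.aestronglyMeasurable (Eventually.of_forall hC)

lemma exists_bdd_mul {c d : Ω → ℝ} (hc : ∃ C : ℝ, ∀ ω, |c ω| ≤ C)
    (hd : ∃ C : ℝ, ∀ ω, |d ω| ≤ C) : ∃ C : ℝ, ∀ ω, |c ω * d ω| ≤ C := by
  obtain ⟨C, hC⟩ := hc
  obtain ⟨D, hD⟩ := hd
  refine ⟨C * D, fun ω => ?_⟩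
  rw [abs_mul]
  exact mul_le_mul (hC ω) (hD ω) (abs_nonneg _) ((abs_nonneg _).trans (hC ω))

/-- Only the common part of the two intervals contributes: in every other product of increments the
later one is independent of all remaining factors and has mean zero. -/
lemma IsBrownianMotion.integral_block_mul_block_of_le [IsProbabilityMeasure Q]
    (hB : IsBrownianMotion 𝓕 Q B)
    {a b a' b' : ℝ≥0} (hab' : a' ≤ b') (haa' : a ≤ a') {c d : Ω → ℝ}
    (hc : StronglyMeasurable[𝓕 a] c) (hd : StronglyMeasurable[𝓕 a'] d)
    (hcb : ∃ C : ℝ, ∀ ω, |c ω| ≤ C) (hdb : ∃ C : ℝ, ∀ ω, |d ω| ≤ C) :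
    ∫ ω, (c ω * (B b ω - B a ω)) * (d ω * (B b' ω - B a' ω)) ∂Q =
      (∫ ω, c ω * d ω ∂Q) * volume.real (Set.Ioc (a : ℝ) b ∩ Set.Ioc (a' : ℝ) b') := by
  have hcd : StronglyMeasurable[𝓕 a'] fun ω => c ω * d ω := (hc.mono (𝓕.mono haa')).mul hd
  rcases le_or_gt b a' with h | h
  · have e : Set.Ioc (a : ℝ) b ∩ Set.Ioc (a' : ℝ) b' = ∅ := by
      rw [Set.Ioc_inter_Ioc, Set.Ioc_eq_empty]
      rw [not_lt]
      exact (min_le_left _ _).trans ((NNReal.coe_le_coe.2 h).trans (le_max_right _ _))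
    rw [e, measureReal_empty, mul_zero, ← hB.integral_mul_incr hab'
      (hcd.mul ((hB.stronglyMeasurable_le h).sub (hB.stronglyMeasurable_le haa')))]
    congr 1; ext ω; simp only [Pi.mul_apply, Pi.sub_apply]; ring
  -- The overlap is (a', e]. Both increments are cut at a' and e, which leaves three cross terms of
  -- mean zero and one square.
  · set e := min b b' with he
    have hae : a' ≤ e := le_min h.le hab'
    have heb : e ≤ b := min_le_left _ _
    have heb' : e ≤ b' := min_le_right _ _
    have hcdm : StronglyMeasurable fun ω => c ω * d ω := hcd.mono (𝓕.le _)
    have hcdb := exists_bdd_mul hcb hdb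
    have hint := hB.integrable_mul_incr_mul_incr hcdm hcdb
    have i1 : ∫ ω, c ω * d ω * ((B a' ω - B a ω) * (B b' ω - B a' ω)) ∂Q = 0 := by
      rw [← hB.integral_mul_incr hab'
        (hcd.mul ((hB.stronglyMeasurable_le le_rfl).sub (hB.stronglyMeasurable_le haa')))]
      congr 1; ext ω; simp only [Pi.mul_apply, Pi.sub_apply]; ring
    have hde : StronglyMeasurable[𝓕 e] fun ω => c ω * d ω * (B e ω - B a' ω) :=
      (hcd.mono (𝓕.mono hae)).mul
        ((hB.stronglyMeasurable_le le_rfl).sub (hB.stronglyMeasurable_le hae))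
    have i2 : ∫ ω, c ω * d ω * ((B e ω - B a' ω) * (B b' ω - B e ω)) ∂Q = 0 := by
      rw [← hB.integral_mul_incr heb' hde]
      congr 1; ext ω; ring
    have i3 : ∫ ω, c ω * d ω * ((B e ω - B a' ω) * (B b ω - B e ω)) ∂Q = 0 := by
      rw [← hB.integral_mul_incr heb hde]
      congr 1; ext ω; ring
    have i4 : ∫ ω, c ω * d ω * ((B e ω - B a' ω) * (B e ω - B a' ω)) ∂Q =
        (∫ ω, c ω * d ω ∂Q) * ((e : ℝ) - a') := by
      rw [← hB.integral_mul_incr_sq hae hcd]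
      congr 1; ext ω; ring
    -- One of the two intervals ends at e, so the product of the parts beyond e vanishes.
    have hz : ∀ ω, (B b ω - B e ω) * (B b' ω - B e ω) = 0 := by
      intro ω
      rcases le_total b b' with hb | hb
      · rw [he, min_eq_left hb]; simp
      · rw [he, min_eq_right hb]; simp
    have ev : volume.real (Set.Ioc (a : ℝ) b ∩ Set.Ioc (a' : ℝ) b') = (e : ℝ) - a' := by
      rw [Set.Ioc_inter_Ioc, max_eq_right (NNReal.coe_le_coe.2 haa'), ← NNReal.coe_min,
        Real.volume_real_Ioc_of_le (NNReal.coe_le_coe.2 hae)]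
    have key : ∀ ω, (c ω * (B b ω - B a ω)) * (d ω * (B b' ω - B a' ω)) =
        c ω * d ω * ((B a' ω - B a ω) * (B b' ω - B a' ω))
        + c ω * d ω * ((B e ω - B a' ω) * (B b' ω - B e ω))
        + c ω * d ω * ((B e ω - B a' ω) * (B b ω - B e ω))
        + c ω * d ω * ((B e ω - B a' ω) * (B e ω - B a' ω)) := by
      intro ω
      linear_combination (c ω * d ω) * hz ω
    simp_rw [key]
    rw [integral_add (by exact ((hint _ _ _ _).add (hint _ _ _ _)).add (hint _ _ _ _))
      (hint _ _ _ _), integral_add (by exact (hint _ _ _ _).add (hint _ _ _ _)) (hint _ _ _ _),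
      integral_add (hint _ _ _ _) (hint _ _ _ _), i1, i2, i3, i4, ev]
    ring

lemma IsBrownianMotion.integral_block_mul_block [IsProbabilityMeasure Q]
    (hB : IsBrownianMotion 𝓕 Q B)
    {a b a' b' : ℝ≥0} (hab : a ≤ b) (hab' : a' ≤ b') {c d : Ω → ℝ}
    (hc : StronglyMeasurable[𝓕 a] c) (hd : StronglyMeasurable[𝓕 a'] d)
    (hcb : ∃ C : ℝ, ∀ ω, |c ω| ≤ C) (hdb : ∃ C : ℝ, ∀ ω, |d ω| ≤ C) :
    ∫ ω, (c ω * (B b ω - B a ω)) * (d ω * (B b' ω - B a' ω)) ∂Q =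
      (∫ ω, c ω * d ω ∂Q) * volume.real (Set.Ioc (a : ℝ) b ∩ Set.Ioc (a' : ℝ) b') := by
  rcases le_total a a' with h | h
  · exact hB.integral_block_mul_block_of_le hab' h hc hd hcb hdb
  · rw [Set.inter_comm]
    simp_rw [mul_comm (c _) (d _)]
    rw [← hB.integral_block_mul_block_of_le hab h hd hc hdb hcb]
    congr 1; ext ω; ring

lemma SimpleProcess.integral_sub_integral (φ : SimpleProcess 𝓕) (B : ℝ≥0 → Ω → ℝ) {s t : ℝ≥0}
    (hst : s ≤ t) (ω : Ω) :
    φ.integral B t ω - φ.integral B s ω = ∑ i ∈ Finset.range φ.n,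
      φ.coeff i ω * (B (clamp s t (φ.time (i + 1))) ω - B (clamp s t (φ.time i)) ω) := by
  unfold SimpleProcess.integral
  rw [← Finset.sum_sub_distrib]
  refine Finset.sum_congr rfl fun i _ => ?_
  have h1 := sub_min_eq_sub_clamp hst (fun u => B u ω) (φ.time (i + 1))
  have h2 := sub_min_eq_sub_clamp hst (fun u => B u ω) (φ.time i)
  linear_combination φ.coeff i ω * h1 - φ.coeff i ω * h2

/-- The coefficient of a block, cut off if the block starts after `t`, so that it is measurable
at the left end of the block clamped to `[s, t]`. -/
lemma SimpleProcess.exists_clamp_coeff (φ : SimpleProcess 𝓕) (i : ℕ) {s : ℝ≥0} (t : ℝ≥0) {A : Set Ω}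
    (hA : MeasurableSet[𝓕 s] A) :
    ∃ c : Ω → ℝ, StronglyMeasurable[𝓕 (clamp s t (φ.time i))] c ∧
      (∃ C : ℝ, ∀ ω, |c ω| ≤ C) ∧ (c = A.indicator (φ.coeff i) ∨
        (c = 0 ∧ clamp s t (φ.time (i + 1)) = clamp s t (φ.time i))) := by
  rcases le_total (φ.time i) t with h | h
  · refine ⟨A.indicator (φ.coeff i), ?_, ?_, Or.inl rfl⟩
    · refine ((φ.meas i).mono (𝓕.mono ?_)).indicator (𝓕.mono (le_clamp _ _ _) _ hA)
      unfold clamp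
      rw [min_eq_left h]; exact le_max_right _ _
    · obtain ⟨C, hC⟩ := φ.bdd i
      refine ⟨C, fun ω => ?_⟩
      by_cases hω : ω ∈ A
      · simpa [hω] using hC ω
      · simpa [hω] using (abs_nonneg _).trans (hC ω)
  · refine ⟨0, stronglyMeasurable_zero, ⟨0, by simp⟩, Or.inr ⟨rfl, ?_⟩⟩
    unfold clamp
    rw [min_eq_right h, min_eq_right (h.trans (φ.mono (Nat.le_succ i)))]

lemma SimpleProcess.measurable_coeff (φ : SimpleProcess 𝓕) (i : ℕ) :
    StronglyMeasurable (φ.coeff i) := (φ.meas i).mono (𝓕.le _)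

lemma setIntegral_simple_block [IsProbabilityMeasure Q]
    (hB : IsBrownianMotion 𝓕 Q B) (φ ψ : SimpleProcess 𝓕) (i j : ℕ)
    {s t : ℝ≥0} (hst : s ≤ t) {A : Set Ω} (hA : MeasurableSet[𝓕 s] A) :
    ∫ ω in A, (φ.coeff i ω * (B (clamp s t (φ.time (i + 1))) ω - B (clamp s t (φ.time i)) ω))
        * (ψ.coeff j ω * (B (clamp s t (ψ.time (j + 1))) ω - B (clamp s t (ψ.time j)) ω)) ∂Q =
      (∫ ω in A, φ.coeff i ω * ψ.coeff j ω ∂Q) * volume.real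
        (Set.Ioc (φ.time i : ℝ) (φ.time (i + 1)) ∩ Set.Ioc (ψ.time j : ℝ) (ψ.time (j + 1)) ∩
          Set.Ioc (s : ℝ) t) := by
  have hA' : MeasurableSet A := 𝓕.le _ _ hA
  rw [Set.inter_inter_distrib_right, Ioc_inter_Ioc_eq_clamp hst, Ioc_inter_Ioc_eq_clamp hst]
  obtain ⟨c, hc, hcb, hcA⟩ := φ.exists_clamp_coeff i t hA
  obtain ⟨d, hd, hdb, hdA⟩ := ψ.exists_clamp_coeff j t hA
  -- In the second alternative the clamped block is a single point, and both sides are zero.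
  rcases hcA with rfl | ⟨-, h⟩
  swap
  · simp [h]
  rcases hdA with rfl | ⟨-, h⟩
  swap
  · simp [h]
  have := hB.integral_block_mul_block (clamp_mono s t (φ.mono (Nat.le_succ i)))
    (clamp_mono s t (ψ.mono (Nat.le_succ j))) hc hd hcb hdb
  rw [← integral_indicator hA', ← integral_indicator hA']
  convert this using 3 with ω
  · by_cases h : ω ∈ A <;> simp [h]
  · ext ω
    by_cases h : ω ∈ A <;> simp [h]

lemma SimpleProcess.integral_toFun_mul_toFun (φ ψ : SimpleProcess 𝓕) (s t : ℝ≥0) (ω : Ω) :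
    ∫ u in Set.Ioc (s : ℝ) t, φ.toFun u ω * ψ.toFun u ω =
      ∑ i ∈ Finset.range φ.n, ∑ j ∈ Finset.range ψ.n, φ.coeff i ω * ψ.coeff j ω *
        volume.real (Set.Ioc (φ.time i : ℝ) (φ.time (i + 1)) ∩
          Set.Ioc (ψ.time j : ℝ) (ψ.time (j + 1)) ∩ Set.Ioc (s : ℝ) t) := by
  have key : ∀ u, φ.toFun u ω * ψ.toFun u ω =
      ∑ i ∈ Finset.range φ.n, ∑ j ∈ Finset.range ψ.n,
        (Set.Ioc (φ.time i : ℝ) (φ.time (i + 1)) ∩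
          Set.Ioc (ψ.time j : ℝ) (ψ.time (j + 1))).indicator
          (fun _ => φ.coeff i ω * ψ.coeff j ω) u := by
    intro u
    unfold SimpleProcess.toFun
    rw [Finset.sum_mul_sum]
    refine Finset.sum_congr rfl fun i _ => Finset.sum_congr rfl fun j _ => ?_
    rw [Set.inter_indicator_mul]
  simp_rw [key]
  have hint : ∀ i j, Integrable ((Set.Ioc (φ.time i : ℝ) (φ.time (i + 1)) ∩
          Set.Ioc (ψ.time j : ℝ) (ψ.time (j + 1))).indicator
          (fun _ => φ.coeff i ω * ψ.coeff j ω)) (volume.restrict (Set.Ioc (s : ℝ) t)) :=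
    fun i j => (integrable_const _).indicator (measurableSet_Ioc.inter measurableSet_Ioc)
  rw [integral_finsetSum _ fun i _ => integrable_finsetSum _ fun j _ => hint i j]
  refine Finset.sum_congr rfl fun i _ => ?_
  rw [integral_finsetSum _ fun j _ => hint i j]
  refine Finset.sum_congr rfl fun j _ => ?_
  rw [integral_indicator (measurableSet_Ioc.inter measurableSet_Ioc), integral_const,
    smul_eq_mul, mul_comm, measureReal_restrict_apply_univ,
    measureReal_restrict_apply (measurableSet_Ioc.inter measurableSet_Ioc)]

lemma SimpleProcess.memLp_integral_sub [IsProbabilityMeasure Q] (hB : IsBrownianMotion 𝓕 Q B)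
    (φ : SimpleProcess 𝓕) {s t : ℝ≥0} (hst : s ≤ t) {p : ℝ≥0∞} (hp : p ≠ ∞) :
    MemLp (fun ω => φ.integral B t ω - φ.integral B s ω) p Q := by
  simp_rw [φ.integral_sub_integral B hst]
  refine memLp_finsetSum _ fun i _ => ?_
  exact memLp_bdd_mul (hB.memLp_incr' (clamp s t (φ.time i)) (clamp s t (φ.time (i + 1))) hp)
    (φ.measurable_coeff i) (φ.bdd i)

/-- The Itô isometry for simple processes, localised on an event known at time `s`. -/
theorem setIntegral_simple_mul_simple [IsProbabilityMeasure Q] (hB : IsBrownianMotion 𝓕 Q B)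
    (φ ψ : SimpleProcess 𝓕) {s t : ℝ≥0} (hst : s ≤ t) {A : Set Ω} (hA : MeasurableSet[𝓕 s] A) :
    ∫ ω in A, (φ.integral B t ω - φ.integral B s ω) * (ψ.integral B t ω - ψ.integral B s ω) ∂Q =
      ∫ ω in A, (∫ u in Set.Ioc (s : ℝ) t, φ.toFun u ω * ψ.toFun u ω) ∂Q := by
  have hL2 : ∀ (χ : SimpleProcess 𝓕) (i : ℕ), MemLp (fun ω => χ.coeff i ω *
      (B (clamp s t (χ.time (i + 1))) ω - B (clamp s t (χ.time i)) ω)) 2 (Q.restrict A) := by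
    intro χ i
    exact (memLp_bdd_mul (hB.memLp_incr' (clamp s t (χ.time i)) (clamp s t (χ.time (i + 1)))
      (by simp)) (χ.measurable_coeff i) (χ.bdd i)).restrict A
  have hint : ∀ i j, Integrable (fun ω => (φ.coeff i ω *
      (B (clamp s t (φ.time (i + 1))) ω - B (clamp s t (φ.time i)) ω)) * (ψ.coeff j ω *
      (B (clamp s t (ψ.time (j + 1))) ω - B (clamp s t (ψ.time j)) ω))) (Q.restrict A) :=
    fun i j => (hL2 φ i).integrable_mul (hL2 ψ j)
  have hint2 : ∀ i j, Integrable (fun ω => φ.coeff i ω * ψ.coeff j ω) (Q.restrict A) := by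
    intro i j
    obtain ⟨C, hC⟩ := exists_bdd_mul (φ.bdd i) (ψ.bdd j)
    exact Integrable.of_bound
      ((φ.measurable_coeff i).mul (ψ.measurable_coeff j)).aestronglyMeasurable C
      (Eventually.of_forall hC)
  simp_rw [φ.integral_sub_integral B hst, ψ.integral_sub_integral B hst,
    φ.integral_toFun_mul_toFun ψ s t, Finset.sum_mul_sum]
  rw [integral_finsetSum _ fun i _ => integrable_finsetSum _ fun j _ => hint i j,
    integral_finsetSum _ fun i _ => integrable_finsetSum _ fun j _ =>
      (hint2 i j).mul_const _]
  refine Finset.sum_congr rfl fun i _ => ?_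
  rw [integral_finsetSum _ fun j _ => hint i j,
    integral_finsetSum _ fun j _ => (hint2 i j).mul_const _]
  refine Finset.sum_congr rfl fun j _ => ?_
  rw [setIntegral_simple_block hB φ ψ i j hst hA, integral_mul_const]

end Isometry

/-! ### Passage from simple integrands to Itô integrals. -/

section ItoLimit

lemma eLpNorm_two_eq_ofReal {α : Type*} {_ : MeasurableSpace α} {μ : Measure α} {f : α → ℝ}
    (hf : MemLp f 2 μ) : eLpNorm f 2 μ = ENNReal.ofReal (Real.sqrt (∫ x, f x ^ 2 ∂μ)) := by
  rw [hf.eLpNorm_eq_integral_rpow_norm (by simp) (by simp), Real.sqrt_eq_rpow]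
  simp

lemma integral_sq_eq_eLpNorm {α : Type*} {_ : MeasurableSpace α} {μ : Measure α} {f : α → ℝ}
    (hf : MemLp f 2 μ) : ∫ x, f x ^ 2 ∂μ = (eLpNorm f 2 μ).toReal ^ 2 := by
  have h0 : 0 ≤ ∫ x, f x ^ 2 ∂μ := integral_nonneg fun x => sq_nonneg _
  rw [eLpNorm_two_eq_ofReal hf, ENNReal.toReal_ofReal (Real.sqrt_nonneg _), Real.sq_sqrt h0]

lemma tendsto_integral_sq_of_eLpNorm {α : Type*} {_ : MeasurableSpace α} {μ : Measure α}
    {f : ℕ → α → ℝ} (hf : ∀ k, MemLp (f k) 2 μ)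
    (h : Tendsto (fun k => eLpNorm (f k) 2 μ) atTop (𝓝 0)) :
    Tendsto (fun k => ∫ x, f k x ^ 2 ∂μ) atTop (𝓝 0) := by
  simp_rw [fun k => integral_sq_eq_eLpNorm (hf k)]
  have := ((ENNReal.tendsto_toReal ENNReal.zero_ne_top).comp h).pow 2
  simpa using this

lemma integral_sub_sq {α : Type*} {_ : MeasurableSpace α} {μ : Measure α} {f g : α → ℝ}
    (hf : MemLp f 2 μ) (hg : MemLp g 2 μ) : ∫ x, (f x - g x) ^ 2 ∂μ =
      ∫ x, f x * f x ∂μ - 2 * ∫ x, f x * g x ∂μ + ∫ x, g x * g x ∂μ := by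
  have hff : Integrable (fun x => f x * f x) μ := hf.integrable_mul hf
  have hfg : Integrable (fun x => f x * g x) μ := hf.integrable_mul hg
  have hgg : Integrable (fun x => g x * g x) μ := hg.integrable_mul hg
  rw [← integral_const_mul, ← integral_sub hff (hfg.const_mul 2),
    ← integral_add (by exact hff.sub (hfg.const_mul 2)) hgg]
  congr 1; ext x; ring

variable {Ω : Type*} {m : MeasurableSpace Ω} {Q : Measure Ω} {𝓕 : Filtration ℝ≥0 m}
  {B : ℝ≥0 → Ω → ℝ}

lemma SimpleProcess.toFun_eq (φ : SimpleProcess 𝓕) (p : ℝ × Ω) :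
    φ.toFun p.1 p.2 = ∑ i ∈ Finset.range φ.n,
      (Prod.fst ⁻¹' (Set.Ioc (φ.time i : ℝ) (φ.time (i + 1) : ℝ))).indicator
        (fun p : ℝ × Ω => φ.coeff i p.2) p := rfl

lemma SimpleProcess.stronglyMeasurable_toFun (φ : SimpleProcess 𝓕) :
    StronglyMeasurable (fun p : ℝ × Ω => φ.toFun p.1 p.2) := by
  simp_rw [φ.toFun_eq]
  refine Finset.stronglyMeasurable_fun_sum _ fun i _ => ?_
  exact ((φ.measurable_coeff i).comp_measurable measurable_snd).indicator
    (measurable_fst measurableSet_Ioc)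

lemma SimpleProcess.exists_bound (φ : SimpleProcess 𝓕) :
    ∃ C : ℝ, 0 ≤ C ∧ ∀ u ω, |φ.toFun u ω| ≤ C := by
  choose C hC using φ.bdd
  refine ⟨∑ i ∈ Finset.range φ.n, |C i|, Finset.sum_nonneg fun _ _ => abs_nonneg _,
    fun u ω => ?_⟩
  refine (Finset.abs_sum_le_sum_abs _ _).trans (Finset.sum_le_sum fun i _ => ?_)
  by_cases h : u ∈ Set.Ioc (φ.time i : ℝ) (φ.time (i + 1) : ℝ)
  · rw [Set.indicator_of_mem h]; exact (hC i ω).trans (le_abs_self _)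
  · rw [Set.indicator_of_notMem h]; simp

/-- The measure `du ⊗ Q` on `(s, t] × Ω`. -/
noncomputable def stripMeasure (Q : Measure Ω) (s t : ℝ) : Measure (ℝ × Ω) :=
  (volume.restrict (Set.Ioc s t)).prod Q

instance [IsProbabilityMeasure Q] (s t : ℝ) : IsFiniteMeasure (stripMeasure Q s t) := by
  unfold stripMeasure; infer_instance

lemma stripMeasure_mono [SFinite Q] {s t s' t' : ℝ} (hs : s' ≤ s) (ht : t ≤ t') :
    stripMeasure Q s t ≤ stripMeasure Q s' t' :=
  Measure.prod_mono (Measure.restrict_mono (Set.Ioc_subset_Ioc hs ht) le_rfl) le_rfl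

lemma SimpleProcess.memLp_toFun [IsProbabilityMeasure Q] (φ : SimpleProcess 𝓕) (p : ℝ≥0∞)
    (s t : ℝ) : MemLp (fun p : ℝ × Ω => φ.toFun p.1 p.2) p (stripMeasure Q s t) := by
  obtain ⟨C, -, hC⟩ := φ.exists_bound
  exact MemLp.of_bound φ.stronglyMeasurable_toFun.aestronglyMeasurable C
    (Eventually.of_forall fun p => hC p.1 p.2)

lemma integral_simple_mul_simple [IsProbabilityMeasure Q] (hB : IsBrownianMotion 𝓕 Q B)
    (φ ψ : SimpleProcess 𝓕) {s t : ℝ≥0} (hst : s ≤ t) :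
    ∫ ω, (φ.integral B t ω - φ.integral B s ω) * (ψ.integral B t ω - ψ.integral B s ω) ∂Q =
      ∫ p, φ.toFun p.1 p.2 * ψ.toFun p.1 p.2 ∂(stripMeasure Q s t) := by
  have h := setIntegral_simple_mul_simple hB φ ψ hst MeasurableSet.univ
  rw [Measure.restrict_univ] at h
  rw [h]
  exact (integral_prod_symm (fun p : ℝ × Ω => φ.toFun p.1 p.2 * ψ.toFun p.1 p.2)
    ((φ.memLp_toFun 2 s t).integrable_mul (ψ.memLp_toFun 2 s t))).symm

/-- The Itô isometry for differences of simple processes. -/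
lemma integral_simple_sub_simple_sq [IsProbabilityMeasure Q] (hB : IsBrownianMotion 𝓕 Q B)
    (φ ψ : SimpleProcess 𝓕) {s t : ℝ≥0} (hst : s ≤ t) :
    ∫ ω, ((φ.integral B t ω - φ.integral B s ω) - (ψ.integral B t ω - ψ.integral B s ω)) ^ 2 ∂Q =
      ∫ p, (φ.toFun p.1 p.2 - ψ.toFun p.1 p.2) ^ 2 ∂(stripMeasure Q s t) := by
  rw [integral_sub_sq (φ.memLp_integral_sub hB hst (by simp)) (ψ.memLp_integral_sub hB hst (by simp)),
    integral_simple_mul_simple hB φ φ hst, integral_simple_mul_simple hB φ ψ hst,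
    integral_simple_mul_simple hB ψ ψ hst]
  have := integral_sub_sq (φ.memLp_toFun (Q := Q) 2 s t) (ψ.memLp_toFun 2 s t)
  rw [this]

lemma eLpNorm_simple_sub_simple [IsProbabilityMeasure Q] (hB : IsBrownianMotion 𝓕 Q B)
    (φ ψ : SimpleProcess 𝓕) {s t : ℝ≥0} (hst : s ≤ t) :
    eLpNorm (fun ω => (φ.integral B t ω - φ.integral B s ω) -
      (ψ.integral B t ω - ψ.integral B s ω)) 2 Q =
      eLpNorm (fun p : ℝ × Ω => φ.toFun p.1 p.2 - ψ.toFun p.1 p.2) 2 (stripMeasure Q s t) := by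
  have h1 := eLpNorm_two_eq_ofReal ((φ.memLp_integral_sub hB hst (by simp)).sub
    (ψ.memLp_integral_sub hB hst (by simp)))
  have h2 := eLpNorm_two_eq_ofReal ((φ.memLp_toFun (Q := Q) 2 s t).sub (ψ.memLp_toFun 2 s t))
  simp only [Pi.sub_apply, integral_simple_sub_simple_sq hB φ ψ hst] at h1 h2
  exact h1.trans h2.symm

lemma SimpleProcess.integral_zero (φ : SimpleProcess 𝓕) (ω : Ω) : φ.integral B 0 ω = 0 := by
  simp [SimpleProcess.integral]

lemma SimpleProcess.memLp_integral [IsProbabilityMeasure Q] (hB : IsBrownianMotion 𝓕 Q B)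
    (φ : SimpleProcess 𝓕) (t : ℝ≥0) {p : ℝ≥0∞} (hp : p ≠ ∞) : MemLp (φ.integral B t) p Q := by
  simpa [φ.integral_zero] using φ.memLp_integral_sub hB (zero_le : 0 ≤ t) hp

variable {φ : ℝ → Ω → ℝ}

/-- Any simple processes that approximate the integrand have elementary integrals that converge
to the Itô integral. -/
theorem IsItoIntegral.tendsto [IsProbabilityMeasure Q] (hB : IsBrownianMotion 𝓕 Q B)
    (hφ : Measurable (Function.uncurry φ)) {t : ℝ≥0} {I : Ω → ℝ}
    (hI : IsItoIntegral 𝓕 Q B φ t I) {ψ : ℕ → SimpleProcess 𝓕}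
    (hψ : Tendsto (fun k => eLpNorm (fun p : ℝ × Ω => (ψ k).toFun p.1 p.2 - φ p.1 p.2) 2
      (stripMeasure Q 0 t)) atTop (𝓝 0)) :
    Tendsto (fun k => eLpNorm (fun ω => (ψ k).integral B t ω - I ω) 2 Q) atTop (𝓝 0) := by
  obtain ⟨hI2, φs, h1, h2⟩ := hI
  change Tendsto (fun k => eLpNorm (fun p : ℝ × Ω => (φs k).toFun p.1 p.2 - φ p.1 p.2) 2
      (stripMeasure Q 0 t)) atTop (𝓝 0) at h1
  have hφm : AEStronglyMeasurable (fun p : ℝ × Ω => φ p.1 p.2) (stripMeasure Q 0 t) :=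
    Measurable.aestronglyMeasurable hφ
  have lim := (hψ.add h1).add h2
  simp only [add_zero] at lim
  refine tendsto_of_tendsto_of_tendsto_of_le_of_le tendsto_const_nhds lim
    (fun _ => zero_le) fun k => ?_
  -- The approximations supplied by the definition of the Itô integral serve as a bridge: the
  -- isometry compares the two simple integrals, and the triangle inequality does the rest.
  have e1 : (fun ω => (ψ k).integral B t ω - I ω) =
      (fun ω => ((ψ k).integral B t ω - (ψ k).integral B 0 ω) -
        ((φs k).integral B t ω - (φs k).integral B 0 ω)) +
      (fun ω => (φs k).integral B t ω - I ω) := by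
    ext ω; simp [SimpleProcess.integral_zero]
  have e2 : (fun p : ℝ × Ω => (ψ k).toFun p.1 p.2 - (φs k).toFun p.1 p.2) =
      (fun p : ℝ × Ω => (ψ k).toFun p.1 p.2 - φ p.1 p.2) -
      (fun p : ℝ × Ω => (φs k).toFun p.1 p.2 - φ p.1 p.2) := by
    ext p; simp
  simp only
  rw [e1]
  refine (eLpNorm_add_le ?_ ?_ (by norm_num)).trans ?_
  · exact (((ψ k).memLp_integral_sub hB zero_le (by simp)).sub
      ((φs k).memLp_integral_sub hB zero_le (p := 2) (by simp))).1
  · exact ((φs k).memLp_integral hB t (p := 2) (by simp)).1.sub hI2.1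
  · gcongr
    rw [eLpNorm_simple_sub_simple hB _ _ zero_le, NNReal.coe_zero, e2]
    exact eLpNorm_sub_le ((ψ k).stronglyMeasurable_toFun.aestronglyMeasurable.sub hφm)
      ((φs k).stronglyMeasurable_toFun.aestronglyMeasurable.sub hφm) (by norm_num)

/-- Simple processes are bounded and some approximation lies at L² distance less than 1 from the
integrand. -/
lemma IsItoIntegral.memLp_integrand [IsProbabilityMeasure Q]
    (hφ : Measurable (Function.uncurry φ)) {t : ℝ≥0} {I : Ω → ℝ}
    (hI : IsItoIntegral 𝓕 Q B φ t I) :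
    MemLp (fun p : ℝ × Ω => φ p.1 p.2) 2 (stripMeasure Q 0 t) := by
  obtain ⟨-, φs, h1, -⟩ := hI
  obtain ⟨k, hk⟩ := (h1.eventually_lt_const (u := 1) (by norm_num)).exists
  have hφm : AEStronglyMeasurable (fun p : ℝ × Ω => φ p.1 p.2) (stripMeasure Q 0 t) :=
    Measurable.aestronglyMeasurable hφ
  have h2 : MemLp (fun p : ℝ × Ω => (φs k).toFun p.1 p.2 - φ p.1 p.2) 2 (stripMeasure Q 0 t) :=
    ⟨(φs k).stronglyMeasurable_toFun.aestronglyMeasurable.sub hφm, hk.trans ENNReal.one_lt_top⟩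
  have := ((φs k).memLp_toFun 2 0 t).sub h2
  refine this.congr_norm hφm (Eventually.of_forall fun p => ?_)
  simp

/-- The increments of the Itô integral are approximated by those of a simple process, up to the
`L²` distance of the integrands. -/
theorem IsItoIntegral.eLpNorm_incr_sub_le [IsProbabilityMeasure Q]
    (hB : IsBrownianMotion 𝓕 Q B) (hφ : Measurable (Function.uncurry φ)) {s t : ℝ≥0}
    (hst : s ≤ t) {I J : Ω → ℝ} (hI : IsItoIntegral 𝓕 Q B φ s I)
    (hJ : IsItoIntegral 𝓕 Q B φ t J) (ψ : SimpleProcess 𝓕) :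
    eLpNorm (fun ω => (J ω - I ω) - (ψ.integral B t ω - ψ.integral B s ω)) 2 Q ≤
      eLpNorm (fun p : ℝ × Ω => φ p.1 p.2 - ψ.toFun p.1 p.2) 2 (stripMeasure Q s t) := by
  obtain ⟨hJ2, φs, h1, h2⟩ := id hJ
  have hst' : (s : ℝ) ≤ t := NNReal.coe_le_coe.2 hst
  have hmono : ∀ {u v : ℝ}, 0 ≤ u → v ≤ t →
      Tendsto (fun k => eLpNorm (fun p : ℝ × Ω => (φs k).toFun p.1 p.2 - φ p.1 p.2) 2
        (stripMeasure Q u v)) atTop (𝓝 0) := fun hu hv =>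
    tendsto_of_tendsto_of_tendsto_of_le_of_le tendsto_const_nhds h1
      (fun _ => zero_le) fun k => eLpNorm_mono_measure _ (stripMeasure_mono hu hv)
  have h3 := hI.tendsto hB hφ (hmono le_rfl hst')
  have hφm : AEStronglyMeasurable (fun p : ℝ × Ω => φ p.1 p.2) (stripMeasure Q s t) :=
    Measurable.aestronglyMeasurable hφ
  have lim := ((h2.add h3).add (hmono s.2 le_rfl)).add_const
    (eLpNorm (fun p : ℝ × Ω => φ p.1 p.2 - ψ.toFun p.1 p.2) 2 (stripMeasure Q s t))
  simp only [add_zero, zero_add] at lim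
  -- For each k the isometry gives the bound up to three error terms that tend to zero.
  refine ge_of_tendsto' lim fun k => ?_
  have e1 : (fun ω => (J ω - I ω) - (ψ.integral B t ω - ψ.integral B s ω)) =
      (((fun ω => (φs k).integral B s ω - I ω) - (fun ω => (φs k).integral B t ω - J ω)) +
      (fun ω => ((φs k).integral B t ω - (φs k).integral B s ω) -
        (ψ.integral B t ω - ψ.integral B s ω))) := by
    ext ω; simp only [Pi.add_apply, Pi.sub_apply]; ring
  have e2 : (fun p : ℝ × Ω => (φs k).toFun p.1 p.2 - ψ.toFun p.1 p.2) =
      (fun p : ℝ × Ω => (φs k).toFun p.1 p.2 - φ p.1 p.2) +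
      (fun p : ℝ × Ω => φ p.1 p.2 - ψ.toFun p.1 p.2) := by
    ext p; simp
  have mI : AEStronglyMeasurable (fun ω => (φs k).integral B s ω - I ω) Q :=
    ((φs k).memLp_integral hB s (p := 2) (by simp)).1.sub hI.1.1
  have mJ : AEStronglyMeasurable (fun ω => (φs k).integral B t ω - J ω) Q :=
    ((φs k).memLp_integral hB t (p := 2) (by simp)).1.sub hJ2.1
  rw [e1]
  refine (eLpNorm_add_le (mI.sub mJ) ?_ (by norm_num)).trans ?_
  · exact (((φs k).memLp_integral_sub hB hst (by simp)).sub
      (ψ.memLp_integral_sub hB hst (p := 2) (by simp))).1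
  · rw [add_assoc]
    refine add_le_add ((eLpNorm_sub_le mI mJ (by norm_num)).trans (add_comm _ _).le) ?_
    rw [eLpNorm_simple_sub_simple hB _ _ hst, e2]
    exact eLpNorm_add_le ((φs k).stronglyMeasurable_toFun.aestronglyMeasurable.sub hφm)
      (hφm.sub ψ.stronglyMeasurable_toFun.aestronglyMeasurable) (by norm_num)

end ItoLimit

/-! ### Quadratic variation of simple integrals: martingale differences. -/

section QuadVarSimple

variable {Ω : Type*} {m : MeasurableSpace Ω} {Q : Measure Ω} {𝓕 : Filtration ℝ≥0 m}
  {B : ℝ≥0 → Ω → ℝ}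

lemma integrable_pow_four {f : Ω → ℝ} (hf : MemLp f 4 Q) : Integrable (fun ω => f ω ^ 4) Q := by
  have h := MemLp.integrable_norm_pow (p := 4) (by exact_mod_cast hf) (by norm_num)
  refine h.congr (Eventually.of_forall fun ω => ?_)
  simp only [Real.norm_eq_abs]
  rw [Even.pow_abs (by decide)]

lemma clamp_le {s t : ℝ≥0} (hst : s ≤ t) (b : ℝ≥0) : clamp s t b ≤ t :=
  max_le hst (min_le_right _ _)

lemma SimpleProcess.stronglyMeasurable_integral_sub (hB : IsBrownianMotion 𝓕 Q B)
    (φ : SimpleProcess 𝓕) {s t : ℝ≥0} (hst : s ≤ t) :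
    StronglyMeasurable[𝓕 t] (fun ω => φ.integral B t ω - φ.integral B s ω) := by
  simp_rw [φ.integral_sub_integral B hst]
  refine Finset.stronglyMeasurable_fun_sum _ fun i _ => ?_
  rcases le_total (φ.time i) t with h | h
  · exact ((φ.meas i).mono (𝓕.mono h)).mul ((hB.stronglyMeasurable_le (clamp_le hst _)).sub
      (hB.stronglyMeasurable_le (clamp_le hst _)))
  -- A coefficient that is not yet known at time t multiplies a zero increment.
  · have e : clamp s t (φ.time (i + 1)) = clamp s t (φ.time i) := by
      unfold clamp
      rw [min_eq_right h, min_eq_right (h.trans (φ.mono (Nat.le_succ i)))]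
    simp only [e, sub_self, mul_zero]
    exact stronglyMeasurable_const

lemma SimpleProcess.stronglyMeasurable_integral_toFun_sq (φ : SimpleProcess 𝓕) (s t : ℝ≥0) :
    StronglyMeasurable[𝓕 t] (fun ω => ∫ u in Set.Ioc (s : ℝ) t, φ.toFun u ω * φ.toFun u ω) := by
  simp_rw [φ.integral_toFun_mul_toFun φ s t]
  refine Finset.stronglyMeasurable_fun_sum _ fun i _ =>
    Finset.stronglyMeasurable_fun_sum _ fun j _ => ?_
  have hempty : ∀ k, t ≤ φ.time k → Set.Ioc (φ.time k : ℝ) (φ.time (k + 1)) ∩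
      Set.Ioc (s : ℝ) t = ∅ := by
    intro k hk
    rw [Set.Ioc_inter_Ioc, Set.Ioc_eq_empty]
    rw [not_lt]
    exact (min_le_right _ _).trans ((NNReal.coe_le_coe.2 hk).trans (le_max_left _ _))
  rcases le_total (φ.time i) t with hi | hi
  · rcases le_total (φ.time j) t with hj | hj
    · exact (((φ.meas i).mono (𝓕.mono hi)).mul ((φ.meas j).mono (𝓕.mono hj))).mul
        stronglyMeasurable_const
    · rw [Set.inter_assoc, hempty j hj]
      simp only [Set.inter_empty, measureReal_empty, mul_zero]
      exact stronglyMeasurable_const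
  · rw [Set.inter_inter_distrib_right, hempty i hi]
    simp only [Set.empty_inter, measureReal_empty, mul_zero]
    exact stronglyMeasurable_const

/-- Cauchy–Schwarz applied twice bounds the fourth power of a sum of n terms by n³ times the sum of
fourth powers; each clamped block has length at most t - s. -/
lemma SimpleProcess.exists_integral_pow_four_le [IsProbabilityMeasure Q]
    (hB : IsBrownianMotion 𝓕 Q B) (φ : SimpleProcess 𝓕) :
    ∃ K : ℝ, ∀ s t : ℝ≥0, s ≤ t →
      ∫ ω, (φ.integral B t ω - φ.integral B s ω) ^ 4 ∂Q ≤ K * ((t : ℝ) - s) ^ 2 := by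
  choose C hC using φ.bdd
  set k4 := ∫ x, x ^ 4 ∂(gaussianReal 0 1) with hk4
  have hk40 : 0 ≤ k4 := integral_nonneg fun x => by positivity
  refine ⟨(φ.n : ℝ) ^ 3 * ∑ i ∈ Finset.range φ.n, C i ^ 4 * k4, fun s t hst => ?_⟩
  have hst' : (s : ℝ) ≤ t := NNReal.coe_le_coe.2 hst
  have h4 : ∀ i, Integrable (fun ω => (B (clamp s t (φ.time (i + 1))) ω -
      B (clamp s t (φ.time i)) ω) ^ 4) Q := fun i =>
    integrable_pow_four (hB.memLp_incr' (clamp s t (φ.time i)) (clamp s t (φ.time (i + 1)))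
      (by simp))
  have hpt : ∀ ω, (φ.integral B t ω - φ.integral B s ω) ^ 4 ≤ (φ.n : ℝ) ^ 3 *
      ∑ i ∈ Finset.range φ.n, C i ^ 4 * (B (clamp s t (φ.time (i + 1))) ω -
        B (clamp s t (φ.time i)) ω) ^ 4 := by
    intro ω
    rw [φ.integral_sub_integral B hst]
    have h1 := sq_sum_le_card_mul_sum_sq (s := Finset.range φ.n) (f := fun i => φ.coeff i ω *
      (B (clamp s t (φ.time (i + 1))) ω - B (clamp s t (φ.time i)) ω))
    have h2 := sq_sum_le_card_mul_sum_sq (s := Finset.range φ.n) (f := fun i => (φ.coeff i ω *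
      (B (clamp s t (φ.time (i + 1))) ω - B (clamp s t (φ.time i)) ω)) ^ 2)
    rw [Finset.card_range] at h1 h2
    set a := ∑ i ∈ Finset.range φ.n, φ.coeff i ω *
      (B (clamp s t (φ.time (i + 1))) ω - B (clamp s t (φ.time i)) ω)
    set b := ∑ i ∈ Finset.range φ.n, (φ.coeff i ω *
      (B (clamp s t (φ.time (i + 1))) ω - B (clamp s t (φ.time i)) ω)) ^ 2
    calc a ^ 4 = (a ^ 2) ^ 2 := by ring
      _ ≤ (φ.n * b) ^ 2 := by gcongr
      _ = (φ.n : ℝ) ^ 2 * b ^ 2 := by ring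
      _ ≤ (φ.n : ℝ) ^ 2 * (φ.n * ∑ i ∈ Finset.range φ.n, ((φ.coeff i ω *
      (B (clamp s t (φ.time (i + 1))) ω - B (clamp s t (φ.time i)) ω)) ^ 2) ^ 2) := by gcongr
      _ ≤ (φ.n : ℝ) ^ 2 * (φ.n * ∑ i ∈ Finset.range φ.n, C i ^ 4 *
        (B (clamp s t (φ.time (i + 1))) ω - B (clamp s t (φ.time i)) ω) ^ 4) := by
        gcongr with i _
        rw [← pow_mul, mul_pow]
        refine mul_le_mul_of_nonneg_right ?_ (Even.pow_nonneg (by decide) _)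
        calc φ.coeff i ω ^ 4 = |φ.coeff i ω| ^ 4 := by rw [Even.pow_abs (by decide)]
          _ ≤ C i ^ 4 := by exact pow_le_pow_left₀ (abs_nonneg _) (hC i ω) 4
      _ = _ := by ring
  refine (integral_mono_of_nonneg (Eventually.of_forall fun ω => Even.pow_nonneg (by decide) _)
    ((integrable_finsetSum _ fun i _ => (h4 i).const_mul _).const_mul _)
    (Eventually.of_forall hpt)).trans ?_
  rw [integral_const_mul, integral_finsetSum _ fun i _ => (h4 i).const_mul _, mul_assoc,
    Finset.sum_mul]
  gcongr with i _
  rw [integral_const_mul, hB.integral_incr_pow_four (clamp_mono s t (φ.mono (Nat.le_succ i))),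
    mul_assoc]
  have hl : (s : ℝ) ≤ clamp s t (φ.time i) := NNReal.coe_le_coe.2 (le_clamp _ _ _)
  have hr : (clamp s t (φ.time (i + 1)) : ℝ) ≤ t := NNReal.coe_le_coe.2 (clamp_le hst _)
  have hlr : (clamp s t (φ.time i) : ℝ) ≤ clamp s t (φ.time (i + 1)) :=
    NNReal.coe_le_coe.2 (clamp_mono s t (φ.mono (Nat.le_succ i)))
  have : (0 : ℝ) ≤ (clamp s t (φ.time (i + 1)) : ℝ) - clamp s t (φ.time i) := sub_nonneg.2 hlr
  have hC4 : 0 ≤ C i ^ 4 := by positivity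
  gcongr

/-- The error in the approximation of the quadratic variation of a simple stochastic integral over
one time step. -/
noncomputable def qvError (φ : SimpleProcess 𝓕) (B : ℝ≥0 → Ω → ℝ) (s t : ℝ≥0) (ω : Ω) : ℝ :=
  (φ.integral B t ω - φ.integral B s ω) ^ 2 -
    ∫ u in Set.Ioc (s : ℝ) t, φ.toFun u ω * φ.toFun u ω

lemma stronglyMeasurable_qvError (hB : IsBrownianMotion 𝓕 Q B) (φ : SimpleProcess 𝓕)
    {s t : ℝ≥0} (hst : s ≤ t) : StronglyMeasurable[𝓕 t] (qvError φ B s t) :=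
  ((φ.stronglyMeasurable_integral_sub hB hst).pow 2).sub
    (φ.stronglyMeasurable_integral_toFun_sq s t)

lemma SimpleProcess.abs_integral_toFun_sq_le (φ : SimpleProcess 𝓕) {C : ℝ}
    (hC : ∀ u ω, |φ.toFun u ω| ≤ C) {s t : ℝ≥0} (hst : s ≤ t) (ω : Ω) :
    |∫ u in Set.Ioc (s : ℝ) t, φ.toFun u ω * φ.toFun u ω| ≤ C ^ 2 * ((t : ℝ) - s) := by
  have := norm_setIntegral_le_of_norm_le_const (μ := volume) (s := Set.Ioc (s : ℝ) t)
    (f := fun u => φ.toFun u ω * φ.toFun u ω) (C := C ^ 2) (by simp) (fun u _ => by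
      rw [Real.norm_eq_abs, abs_mul, sq]
      exact mul_le_mul (hC u ω) (hC u ω) (abs_nonneg _) ((abs_nonneg _).trans (hC u ω)))
  rwa [Real.volume_real_Ioc_of_le (NNReal.coe_le_coe.2 hst)] at this

lemma memLp_qvError [IsProbabilityMeasure Q] (hB : IsBrownianMotion 𝓕 Q B)
    (φ : SimpleProcess 𝓕) {s t : ℝ≥0} (hst : s ≤ t) : MemLp (qvError φ B s t) 2 Q := by
  obtain ⟨C, -, hC⟩ := φ.exists_bound
  refine MemLp.sub ?_ (MemLp.of_bound
    ((φ.stronglyMeasurable_integral_toFun_sq s t).mono (𝓕.le t)).aestronglyMeasurable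
    (C ^ 2 * ((t : ℝ) - s)) (Eventually.of_forall (φ.abs_integral_toFun_sq_le hC hst)))
  have h := φ.memLp_integral_sub hB hst (p := 4) (by simp)
  refine (memLp_two_iff_integrable_sq (by exact h.1.pow 2)).2 ?_
  refine (integrable_pow_four h).congr (Eventually.of_forall fun ω => ?_)
  ring

/-- From (a² - b)² ≤ 2a⁴ + 2b²: the fourth moment of the increment and the square of the bounded
compensator are both O((t - s)²). -/
lemma exists_integral_qvError_sq_le [IsProbabilityMeasure Q] (hB : IsBrownianMotion 𝓕 Q B)
    (φ : SimpleProcess 𝓕) :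
    ∃ K : ℝ, 0 ≤ K ∧ ∀ s t : ℝ≥0, s ≤ t →
      ∫ ω, (qvError φ B s t ω) ^ 2 ∂Q ≤ K * ((t : ℝ) - s) ^ 2 := by
  obtain ⟨K, hK⟩ := φ.exists_integral_pow_four_le hB
  obtain ⟨C, hC0, hC⟩ := φ.exists_bound
  refine ⟨2 * |K| + 2 * C ^ 4, by positivity, fun s t hst => ?_⟩
  have h4 : Integrable (fun ω => (φ.integral B t ω - φ.integral B s ω) ^ 4) Q :=
    integrable_pow_four (φ.memLp_integral_sub hB hst (by simp))
  have hpt : ∀ ω, (qvError φ B s t ω) ^ 2 ≤ 2 * (φ.integral B t ω - φ.integral B s ω) ^ 4 +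
      2 * (C ^ 2 * ((t : ℝ) - s)) ^ 2 := by
    intro ω
    have h1 := φ.abs_integral_toFun_sq_le hC hst ω
    have h2 := sq_le_sq' (neg_le_of_abs_le h1) (le_of_abs_le h1)
    unfold qvError
    set a := (φ.integral B t ω - φ.integral B s ω)
    set b := ∫ u in Set.Ioc (s : ℝ) t, φ.toFun u ω * φ.toFun u ω
    nlinarith [sq_nonneg (a ^ 2 + b)]
  refine (integral_mono_of_nonneg (Eventually.of_forall fun ω => by positivity)
    ((h4.const_mul 2).add (integrable_const _)) (Eventually.of_forall hpt)).trans ?_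
  simp only [Pi.add_apply]
  rw [integral_add (h4.const_mul 2) (integrable_const _), integral_const_mul, integral_const]
  simp only [probReal_univ, smul_eq_mul, one_mul]
  have := hK s t hst
  have h3 : K * ((t : ℝ) - s) ^ 2 ≤ |K| * ((t : ℝ) - s) ^ 2 := by
    gcongr; exact le_abs_self K
  nlinarith

/-- The one-step errors are martingale differences. -/
lemma integral_mul_qvError [IsProbabilityMeasure Q] (hB : IsBrownianMotion 𝓕 Q B)
    (φ : SimpleProcess 𝓕) {s t : ℝ≥0} (hst : s ≤ t) {Y : Ω → ℝ}
    (hY : StronglyMeasurable[𝓕 s] Y) (hY2 : MemLp Y 2 Q) :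
    ∫ ω, Y ω * qvError φ B s t ω ∂Q = 0 := by
  have hD2 := memLp_qvError hB φ hst
  have hD : Integrable (qvError φ B s t) Q := hD2.integrable (by norm_num)
  have hYD : Integrable (Y * qvError φ B s t) Q := hY2.integrable_mul hD2
  -- The isometry localised on events of 𝓕 s says precisely that this conditional expectation
  -- vanishes.
  have h0 : Q[qvError φ B s t | 𝓕 s] =ᵐ[Q] 0 := by
    refine (ae_eq_condExp_of_forall_setIntegral_eq (𝓕.le s) hD
      (fun A _ _ => (integrable_zero _ _ _).integrableOn) (fun A hA _ => ?_)
      stronglyMeasurable_zero.aestronglyMeasurable).symm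
    have hI2 : Integrable (fun ω => (φ.integral B t ω - φ.integral B s ω) ^ 2) Q :=
      (φ.memLp_integral_sub hB hst (p := 2) (by simp)).integrable_sq
    have hint : Integrable (fun ω => ∫ u in Set.Ioc (s : ℝ) t, φ.toFun u ω * φ.toFun u ω) Q := by
      have := hI2.sub hD
      refine this.congr (Eventually.of_forall fun ω => ?_)
      simp [qvError]
    have h := setIntegral_simple_mul_simple hB φ φ hst hA
    simp only [Pi.zero_apply, integral_zero]
    unfold qvError
    rw [integral_sub hI2.integrableOn hint.integrableOn, ← h]
    simp [sq]
  have h1 := condExp_mul_of_stronglyMeasurable_left hY hYD hD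
  have h2 : ∫ ω, (Q[Y * qvError φ B s t | 𝓕 s]) ω ∂Q = 0 := by
    rw [integral_congr_ae (g := fun _ => 0)]
    · simp
    · filter_upwards [h1, h0] with ω h1 h0
      simp [h1, h0]
  rw [integral_condExp (𝓕.le s)] at h2
  exact h2

/-- Orthogonality of martingale differences makes second moments additive. Measurability and square
integrability of the partial sums are carried through the induction because the vanishing of the
cross term requires them. -/
lemma integral_sum_qvError_sq_le [IsProbabilityMeasure Q] (hB : IsBrownianMotion 𝓕 Q B)
    (φ : SimpleProcess 𝓕) {K : ℝ} (hK : ∀ s t : ℝ≥0, s ≤ t →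
      ∫ ω, (qvError φ B s t ω) ^ 2 ∂Q ≤ K * ((t : ℝ) - s) ^ 2) {π : ℕ → ℝ≥0} (hπ : Monotone π)
    (n : ℕ) :
    StronglyMeasurable[𝓕 (π n)]
      (fun ω => ∑ i ∈ Finset.range n, qvError φ B (π i) (π (i + 1)) ω) ∧
    MemLp (fun ω => ∑ i ∈ Finset.range n, qvError φ B (π i) (π (i + 1)) ω) 2 Q ∧
    ∫ ω, (∑ i ∈ Finset.range n, qvError φ B (π i) (π (i + 1)) ω) ^ 2 ∂Q ≤
      ∑ i ∈ Finset.range n, K * ((π (i + 1) : ℝ) - π i) ^ 2 := by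
  induction n with
  | zero => simpa using stronglyMeasurable_const
  | succ n ih =>
    obtain ⟨h1, h2, h3⟩ := ih
    have hn := hπ (Nat.le_succ n)
    have hD := memLp_qvError hB φ hn
    simp_rw [Finset.sum_range_succ]
    refine ⟨(h1.mono (𝓕.mono hn)).add (stronglyMeasurable_qvError hB φ hn), h2.add hD, ?_⟩
    have h4 := integral_mul_qvError hB φ hn h1 h2
    have i1 := h2.integrable_sq
    have i2 := hD.integrable_sq
    have i3 : Integrable (fun ω => (∑ i ∈ Finset.range n, qvError φ B (π i) (π (i + 1)) ω) *
      qvError φ B (π n) (π (n + 1)) ω) Q := h2.integrable_mul hD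
    have h5 := hK _ _ hn
    simp_rw [add_sq, mul_assoc]
    rw [integral_add (by exact i1.add (i3.const_mul 2)) (by exact i2),
      integral_add i1 (i3.const_mul 2), integral_const_mul, h4]
    simp only [mul_zero, add_zero]
    exact add_le_add h3 h5

lemma sum_sq_le_of_mesh_le {π : ℕ → ℝ≥0} (hπ : Monotone π) {n : ℕ} {δ : ℝ}
    (hmesh : ∀ i < n, (π (i + 1) : ℝ) - π i ≤ δ) :
    ∑ i ∈ Finset.range n, ((π (i + 1) : ℝ) - π i) ^ 2 ≤ δ * ((π n : ℝ) - π 0) := by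
  rw [← Finset.sum_range_sub (fun i => (π i : ℝ)), Finset.mul_sum]
  refine Finset.sum_le_sum fun i hi => ?_
  rw [sq]
  exact mul_le_mul_of_nonneg_right (hmesh i (Finset.mem_range.1 hi))
    (sub_nonneg.2 (NNReal.coe_le_coe.2 (hπ (Nat.le_succ i))))

end QuadVarSimple

/-! ### Quadratic variation of general Itô integrals, uniformly over partitions. -/

section QuadVarIto

/-- Young's inequality with a free parameter κ: it separates the approximation error (a - b)², paid
with a large constant, from b², paid with a small one. -/
lemma abs_sq_sub_sq_le (a b : ℝ) {κ : ℝ} (hκ : 0 < κ) :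
    |a ^ 2 - b ^ 2| ≤ (1 + 1 / κ) * (a - b) ^ 2 + κ * b ^ 2 := by
  have h1 : 0 ≤ (κ * b - (a - b)) ^ 2 / κ := by positivity
  have h2 : 0 ≤ (κ * b + (a - b)) ^ 2 / κ := by positivity
  have e1 : (κ * b - (a - b)) ^ 2 / κ = κ * b ^ 2 - 2 * b * (a - b) + 1 / κ * (a - b) ^ 2 := by
    field_simp; ring
  have e2 : (κ * b + (a - b)) ^ 2 / κ = κ * b ^ 2 + 2 * b * (a - b) + 1 / κ * (a - b) ^ 2 := by
    field_simp; ring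
  rw [abs_le]
  constructor <;> nlinarith [sq_nonneg (a - b)]

/-- Converts a second-moment bound into a first-moment bound; θ is chosen later to balance the two
terms. -/
lemma abs_le_add_sq_div (x : ℝ) {θ : ℝ} (hθ : 0 < θ) : |x| ≤ θ + x ^ 2 / θ := by
  have h : 0 ≤ (θ - |x|) ^ 2 / θ := by positivity
  have e : (θ - |x|) ^ 2 / θ = θ - 2 * |x| + x ^ 2 / θ := by
    rw [sub_sq, sq_abs]; field_simp
  linarith [abs_nonneg x]

lemma sum_setIntegral_Ioc {g : ℝ → ℝ} {π : ℕ → ℝ≥0} (hπ : Monotone π) {n : ℕ}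
    (hg : IntegrableOn g (Set.Ioc (π 0 : ℝ) (π n))) :
    ∑ i ∈ Finset.range n, ∫ u in Set.Ioc (π i : ℝ) (π (i + 1)), g u =
      ∫ u in Set.Ioc (π 0 : ℝ) (π n), g u := by
  have hπ' : Monotone (fun i => (π i : ℝ)) := fun _ _ h => NNReal.coe_le_coe.2 (hπ h)
  rw [← intervalIntegral.integral_of_le (hπ' (Nat.zero_le n)),
    ← intervalIntegral.sum_integral_adjacent_intervals (a := fun i => (π i : ℝ))]
  · refine Finset.sum_congr rfl fun i _ => ?_
    rw [intervalIntegral.integral_of_le (hπ' (Nat.le_succ i))]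
  · intro i hi
    rw [intervalIntegrable_iff_integrableOn_Ioc_of_le (hπ' (Nat.le_succ i))]
    exact hg.mono_set (Set.Ioc_subset_Ioc (hπ' (Nat.zero_le i)) (hπ' hi))

variable {Ω : Type*} {m : MeasurableSpace Ω} {Q : Measure Ω} {𝓕 : Filtration ℝ≥0 m}
  {B : ℝ≥0 → Ω → ℝ}

lemma sum_integral_strip [SFinite Q] {g : ℝ × Ω → ℝ} {π : ℕ → ℝ≥0} (hπ : Monotone π) {n : ℕ}
    (hg : Integrable g (stripMeasure Q (π 0) (π n))) :
    ∑ i ∈ Finset.range n, ∫ p, g p ∂(stripMeasure Q (π i) (π (i + 1))) =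
      ∫ p, g p ∂(stripMeasure Q (π 0) (π n)) := by
  have hπ' : Monotone (fun i => (π i : ℝ)) := fun _ _ h => NNReal.coe_le_coe.2 (hπ h)
  unfold stripMeasure at hg ⊢
  rw [integral_prod _ hg, ← sum_setIntegral_Ioc hπ hg.integral_prod_left]
  refine Finset.sum_congr rfl fun i hi => ?_
  rw [integral_prod]
  exact hg.mono_measure (stripMeasure_mono (hπ' (Nat.zero_le i))
    (hπ' (Finset.mem_range.1 hi)))

lemma SimpleProcess.integrableOn_toFun_sq (φ : SimpleProcess 𝓕) (ω : Ω) (a b : ℝ) :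
    IntegrableOn (fun u => φ.toFun u ω * φ.toFun u ω) (Set.Ioc a b) := by
  obtain ⟨C, hC0, hC⟩ := φ.exists_bound
  have hm : StronglyMeasurable (fun u => φ.toFun u ω) :=
    φ.stronglyMeasurable_toFun.comp_measurable (measurable_id.prodMk measurable_const)
  refine Integrable.of_bound (hm.mul hm).aestronglyMeasurable (C * C)
    (Eventually.of_forall fun u => ?_)
  rw [Real.norm_eq_abs, abs_mul]
  exact mul_le_mul (hC u ω) (hC u ω) (abs_nonneg _) hC0

variable {φ : ℝ → Ω → ℝ} {M : ℝ≥0 → Ω → ℝ}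

lemma integral_abs_quadVar_simple_le [IsProbabilityMeasure Q] (hB : IsBrownianMotion 𝓕 Q B)
    (ψ : SimpleProcess 𝓕) {K : ℝ} (hK0 : 0 ≤ K) (hK : ∀ s t : ℝ≥0, s ≤ t →
      ∫ ω, (qvError ψ B s t ω) ^ 2 ∂Q ≤ K * ((t : ℝ) - s) ^ 2) {π : ℕ → ℝ≥0} (hπ : Monotone π)
    {n : ℕ} {δ : ℝ} (hmesh : ∀ i < n, (π (i + 1) : ℝ) - π i ≤ δ) {θ : ℝ} (hθ : 0 < θ) :
    Integrable (fun ω => ∑ i ∈ Finset.range n,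
        (ψ.integral B (π (i + 1)) ω - ψ.integral B (π i) ω) ^ 2 -
        ∫ u in Set.Ioc (π 0 : ℝ) (π n), ψ.toFun u ω * ψ.toFun u ω) Q ∧
    ∫ ω, |∑ i ∈ Finset.range n, (ψ.integral B (π (i + 1)) ω - ψ.integral B (π i) ω) ^ 2 -
        ∫ u in Set.Ioc (π 0 : ℝ) (π n), ψ.toFun u ω * ψ.toFun u ω| ∂Q ≤
      θ + K * (δ * ((π n : ℝ) - π 0)) / θ := by
  have e : (fun ω => ∑ i ∈ Finset.range n,
      (ψ.integral B (π (i + 1)) ω - ψ.integral B (π i) ω) ^ 2 -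
        ∫ u in Set.Ioc (π 0 : ℝ) (π n), ψ.toFun u ω * ψ.toFun u ω) =
      fun ω => ∑ i ∈ Finset.range n, qvError ψ B (π i) (π (i + 1)) ω := by
    ext ω
    rw [← sum_setIntegral_Ioc hπ (ψ.integrableOn_toFun_sq ω _ _), ← Finset.sum_sub_distrib]
    rfl
  obtain ⟨-, h2, h3⟩ := integral_sum_qvError_sq_le hB ψ hK hπ n
  rw [e]
  refine ⟨h2.integrable (by norm_num), ?_⟩
  simp_rw [fun ω => congr_fun e ω]
  have hle := sum_sq_le_of_mesh_le hπ hmesh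
  rw [← Finset.mul_sum] at h3
  calc _ ≤ ∫ ω, (θ + (∑ i ∈ Finset.range n, qvError ψ B (π i) (π (i + 1)) ω) ^ 2 / θ) ∂Q :=
        integral_mono_of_nonneg (Eventually.of_forall fun ω => abs_nonneg _)
          ((integrable_const _).add (h2.integrable_sq.div_const _))
          (Eventually.of_forall fun ω => abs_le_add_sq_div _ hθ)
    _ = θ + (∫ ω, (∑ i ∈ Finset.range n, qvError ψ B (π i) (π (i + 1)) ω) ^ 2 ∂Q) / θ := by
        rw [integral_add (integrable_const _) (h2.integrable_sq.div_const _), integral_div]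
        simp
    _ ≤ _ := by gcongr; exact h3.trans (by gcongr)

lemma IsItoIntegral.integral_incr_sub_sq_le [IsProbabilityMeasure Q]
    (hB : IsBrownianMotion 𝓕 Q B) (hφ : Measurable (Function.uncurry φ)) {s t : ℝ≥0}
    (hst : s ≤ t) {I J : Ω → ℝ} (hI : IsItoIntegral 𝓕 Q B φ s I)
    (hJ : IsItoIntegral 𝓕 Q B φ t J) (ψ : SimpleProcess 𝓕) :
    ∫ ω, ((J ω - I ω) - (ψ.integral B t ω - ψ.integral B s ω)) ^ 2 ∂Q ≤
      ∫ p, (φ p.1 p.2 - ψ.toFun p.1 p.2) ^ 2 ∂(stripMeasure Q s t) := by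
  have hφ2 : MemLp (fun p : ℝ × Ω => φ p.1 p.2 - ψ.toFun p.1 p.2) 2 (stripMeasure Q s t) :=
    ((hJ.memLp_integrand hφ).mono_measure (stripMeasure_mono s.2 le_rfl)).sub
      (ψ.memLp_toFun 2 s t)
  rw [integral_sq_eq_eLpNorm hφ2, integral_sq_eq_eLpNorm
    (by exact (hJ.1.sub hI.1).sub (ψ.memLp_integral_sub hB hst (by simp)))]
  gcongr
  · exact hφ2.2.ne
  · exact hI.eLpNorm_incr_sub_le hB hφ hst hJ ψ

/-- On each step the isometry turns expectations into integrals over the strip between two partition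
points. These add up to the whole strip, so the bound is independent of the partition. -/
lemma integral_abs_quadVar_sub_simple_le [IsProbabilityMeasure Q]
    (hB : IsBrownianMotion 𝓕 Q B) (hφ : Measurable (Function.uncurry φ))
    (hM : ∀ u, IsItoIntegral 𝓕 Q B φ u (M u)) (ψ : SimpleProcess 𝓕) {π : ℕ → ℝ≥0}
    (hπ : Monotone π) (n : ℕ) (h0 : π 0 = 0) {κ : ℝ} (hκ : 0 < κ) :
    ∫ ω, |∑ i ∈ Finset.range n, (M (π (i + 1)) ω - M (π i) ω) ^ 2 -
      ∑ i ∈ Finset.range n, (ψ.integral B (π (i + 1)) ω - ψ.integral B (π i) ω) ^ 2| ∂Q ≤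
      (1 + 1 / κ) * ∫ p, (φ p.1 p.2 - ψ.toFun p.1 p.2) ^ 2 ∂(stripMeasure Q 0 (π n)) +
      κ * ∫ p, (ψ.toFun p.1 p.2) ^ 2 ∂(stripMeasure Q 0 (π n)) := by
  have hmono : ∀ i, π i ≤ π (i + 1) := fun i => hπ (Nat.le_succ i)
  have hψ2 : ∀ i, MemLp (fun ω => ψ.integral B (π (i + 1)) ω - ψ.integral B (π i) ω) 2 Q :=
    fun i => ψ.memLp_integral_sub hB (hmono i) (by simp)
  have i1 : ∀ i, Integrable (fun ω => ((M (π (i + 1)) ω - M (π i) ω) -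
      (ψ.integral B (π (i + 1)) ω - ψ.integral B (π i) ω)) ^ 2) Q := fun i =>
    (((hM _).1.sub (hM _).1).sub (hψ2 i)).integrable_sq
  have i2 : ∀ i, Integrable (fun ω =>
      (ψ.integral B (π (i + 1)) ω - ψ.integral B (π i) ω) ^ 2) Q := fun i =>
    (hψ2 i).integrable_sq
  have hφψ : MemLp (fun p : ℝ × Ω => φ p.1 p.2 - ψ.toFun p.1 p.2) 2 (stripMeasure Q 0 (π n)) :=
    ((hM (π n)).memLp_integrand hφ).sub (ψ.memLp_toFun 2 _ _)
  calc _ ≤ ∫ ω, ∑ i ∈ Finset.range n, ((1 + 1 / κ) * ((M (π (i + 1)) ω - M (π i) ω) -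
      (ψ.integral B (π (i + 1)) ω - ψ.integral B (π i) ω)) ^ 2 +
        κ * (ψ.integral B (π (i + 1)) ω - ψ.integral B (π i) ω) ^ 2) ∂Q := by
        refine integral_mono_of_nonneg (Eventually.of_forall fun ω => abs_nonneg _)
          (integrable_finsetSum _ fun i _ => ((i1 i).const_mul _).add ((i2 i).const_mul _))
          (Eventually.of_forall fun ω => ?_)
        simp only
        rw [← Finset.sum_sub_distrib]
        exact (Finset.abs_sum_le_sum_abs _ _).trans
          (Finset.sum_le_sum fun i _ => abs_sq_sub_sq_le _ _ hκ)
    _ = (1 + 1 / κ) * ∑ i ∈ Finset.range n, ∫ ω, ((M (π (i + 1)) ω - M (π i) ω) -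
          (ψ.integral B (π (i + 1)) ω - ψ.integral B (π i) ω)) ^ 2 ∂Q +
        κ * ∑ i ∈ Finset.range n,
          ∫ ω, (ψ.integral B (π (i + 1)) ω - ψ.integral B (π i) ω) ^ 2 ∂Q := by
        rw [integral_finsetSum _ fun i _ => by
          exact ((i1 i).const_mul _).add ((i2 i).const_mul _), Finset.mul_sum, Finset.mul_sum,
          ← Finset.sum_add_distrib]
        refine Finset.sum_congr rfl fun i _ => ?_
        rw [integral_add ((i1 i).const_mul _) ((i2 i).const_mul _), integral_const_mul,
          integral_const_mul]
    _ ≤ (1 + 1 / κ) * ∑ i ∈ Finset.range n,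
          ∫ p, (φ p.1 p.2 - ψ.toFun p.1 p.2) ^ 2 ∂(stripMeasure Q (π i) (π (i + 1))) +
        κ * ∑ i ∈ Finset.range n,
          ∫ p, (ψ.toFun p.1 p.2) ^ 2 ∂(stripMeasure Q (π i) (π (i + 1))) := by
        gcongr with i _ i _
        · exact (hM _).integral_incr_sub_sq_le hB hφ (hmono i) (hM _) ψ
        · have := integral_simple_mul_simple hB ψ ψ (hmono i)
          simp only [← sq] at this
          exact this.le
    _ = _ := by
        rw [sum_integral_strip hπ, sum_integral_strip hπ, h0, NNReal.coe_zero]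
        · exact (ψ.memLp_toFun 2 _ _).integrable_sq
        · rw [h0, NNReal.coe_zero]; exact hφψ.integrable_sq

lemma integral_abs_integral_sq_sub_le [IsProbabilityMeasure Q] {t : ℝ}
    (hφ : MemLp (fun p : ℝ × Ω => φ p.1 p.2) 2 (stripMeasure Q 0 t)) (ψ : SimpleProcess 𝓕)
    {κ : ℝ} (hκ : 0 < κ) :
    ∫ ω, |(∫ u in Set.Ioc (0 : ℝ) t, ψ.toFun u ω * ψ.toFun u ω) -
        ∫ u in Set.Ioc (0 : ℝ) t, φ u ω ^ 2| ∂Q ≤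
      (1 + 1 / κ) * ∫ p, (φ p.1 p.2 - ψ.toFun p.1 p.2) ^ 2 ∂(stripMeasure Q 0 t) +
      κ * ∫ p, (ψ.toFun p.1 p.2) ^ 2 ∂(stripMeasure Q 0 t) := by
  have hψ := ψ.memLp_toFun (Q := Q) 2 0 t
  have i1 : Integrable (fun p : ℝ × Ω => (φ p.1 p.2 - ψ.toFun p.1 p.2) ^ 2)
    (stripMeasure Q 0 t) := (hφ.sub hψ).integrable_sq
  have i2 := hψ.integrable_sq
  have i3 : Integrable (fun p : ℝ × Ω => |φ p.1 p.2 ^ 2 - ψ.toFun p.1 p.2 ^ 2|)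
    (stripMeasure Q 0 t) := (hφ.integrable_sq.sub i2).abs
  calc _ ≤ ∫ ω, (∫ u in Set.Ioc (0 : ℝ) t, |φ u ω ^ 2 - ψ.toFun u ω ^ 2|) ∂Q := by
        refine integral_mono_of_nonneg (Eventually.of_forall fun ω => abs_nonneg _)
          i3.integral_prod_right ?_
        filter_upwards [hφ.integrable_sq.prod_left_ae] with ω hω
        have h2 := ψ.integrableOn_toFun_sq ω 0 t
        rw [← integral_sub h2 hω]
        refine abs_integral_le_integral_abs.trans (le_of_eq ?_)
        congr 1; ext u
        rw [abs_sub_comm]; simp only [sq]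
    _ = ∫ p, |φ p.1 p.2 ^ 2 - ψ.toFun p.1 p.2 ^ 2| ∂(stripMeasure Q 0 t) :=
        (integral_prod_symm _ i3).symm
    _ ≤ ∫ p, ((1 + 1 / κ) * (φ p.1 p.2 - ψ.toFun p.1 p.2) ^ 2 + κ * ψ.toFun p.1 p.2 ^ 2)
          ∂(stripMeasure Q 0 t) :=
        integral_mono i3 ((i1.const_mul _).add (i2.const_mul _))
          fun p => abs_sq_sub_sq_le _ _ hκ
    _ = _ := by
        rw [integral_add (i1.const_mul _) (i2.const_mul _), integral_const_mul,
          integral_const_mul]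

/-- Sums of squared increments of an Itô integral converge in `L¹`, uniformly over partitions of
small mesh. -/
theorem exists_mesh_integral_abs_quadVar_le [IsProbabilityMeasure Q]
    (hB : IsBrownianMotion 𝓕 Q B) (hφ : Measurable (Function.uncurry φ))
    (hM : ∀ u, IsItoIntegral 𝓕 Q B φ u (M u)) (t : ℝ≥0) {η : ℝ} (hη : 0 < η) :
    ∃ δ : ℝ, 0 < δ ∧ ∀ (n : ℕ) (π : ℕ → ℝ≥0), Monotone π → π 0 = 0 → π n = t →
      (∀ i < n, (π (i + 1) : ℝ) - π i ≤ δ) →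
      Integrable (fun ω => ∑ i ∈ Finset.range n, (M (π (i + 1)) ω - M (π i) ω) ^ 2 -
        ∫ u in Set.Ioc (0 : ℝ) t, φ u ω ^ 2) Q ∧
      ∫ ω, |∑ i ∈ Finset.range n, (M (π (i + 1)) ω - M (π i) ω) ^ 2 -
        ∫ u in Set.Ioc (0 : ℝ) t, φ u ω ^ 2| ∂Q ≤ η := by
  have hφ2 := (hM t).memLp_integrand hφ
  obtain ⟨-, φs, h1, -⟩ := id (hM t)
  have h1' : Tendsto (fun k => ∫ p, ((φs k).toFun p.1 p.2 - φ p.1 p.2) ^ 2 ∂(stripMeasure Q 0 t))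
      atTop (𝓝 0) :=
    tendsto_integral_sq_of_eLpNorm (fun k => ((φs k).memLp_toFun 2 0 t).sub hφ2) h1
  set Φ := ∫ p, φ p.1 p.2 ^ 2 ∂(stripMeasure Q 0 t) with hΦ
  have hΦ0 : 0 ≤ Φ := integral_nonneg fun p => sq_nonneg _
  -- Error budget: once e ≤ 1, the simple integrand has squared norm P ≤ 2(Φ + 1), so κP ≤ η/8. The
  -- simple process is then chosen with (1 + 1/κ)e ≤ η/8. Replacing the integrand thus costs η/4 in
  -- the sums and η/4 in the time integral, leaving η/2 for the mesh.
  set κ := η / (16 * (Φ + 1)) with hκdef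
  have hκ : 0 < κ := by positivity
  have hκΦ : κ * (2 * (Φ + 1)) = η / 8 := by rw [hκdef]; field_simp; ring
  have hc : 0 < min 1 (η / 8 / (1 + 1 / κ)) := by positivity
  obtain ⟨k, hk⟩ := (h1'.eventually_lt_const hc).exists
  set ψ := φs k
  have hψ2 := ψ.memLp_toFun (Q := Q) 2 0 t
  set e := ∫ p, (φ p.1 p.2 - ψ.toFun p.1 p.2) ^ 2 ∂(stripMeasure Q 0 t) with he
  have hek : ∫ p, (ψ.toFun p.1 p.2 - φ p.1 p.2) ^ 2 ∂(stripMeasure Q 0 t) = e := by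
    congr 1; ext p; ring
  rw [hek] at hk
  have he1 : e ≤ 1 := hk.le.trans (min_le_left _ _)
  have he2 : (1 + 1 / κ) * e ≤ η / 8 := by
    have := hk.le.trans (min_le_right _ _)
    rwa [le_div_iff₀ (by positivity), mul_comm] at this
  set P := ∫ p, (ψ.toFun p.1 p.2) ^ 2 ∂(stripMeasure Q 0 t) with hP
  have i1 : Integrable (fun p : ℝ × Ω => (φ p.1 p.2 - ψ.toFun p.1 p.2) ^ 2)
    (stripMeasure Q 0 t) := (hφ2.sub hψ2).integrable_sq
  have hPle : P ≤ 2 * Φ + 2 * e := by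
    rw [hP, hΦ, he, ← integral_const_mul, ← integral_const_mul,
      ← integral_add (hφ2.integrable_sq.const_mul 2) (i1.const_mul 2)]
    refine integral_mono hψ2.integrable_sq
      ((hφ2.integrable_sq.const_mul 2).add (i1.const_mul 2)) fun p => ?_
    simp only
    nlinarith [sq_nonneg (2 * φ p.1 p.2 - ψ.toFun p.1 p.2)]
  have hκP : κ * P ≤ η / 8 := by
    rw [← hκΦ]; gcongr; linarith
  obtain ⟨K, hK0, hK⟩ := exists_integral_qvError_sq_le hB ψ
  -- With θ = η/4 this mesh makes the second-moment term Kδt/θ at most η/4; the 1 in the denominator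
  -- covers Kt = 0.
  refine ⟨(η / 4) ^ 2 / (K * t + 1), by positivity, fun n π hπ h0 hn hmesh => ?_⟩
  obtain ⟨j2, b2⟩ := integral_abs_quadVar_simple_le hB ψ hK0 hK hπ hmesh (θ := η / 4)
    (by positivity)
  have b1 := integral_abs_quadVar_sub_simple_le hB hφ hM ψ hπ n h0 hκ
  have b3 := integral_abs_integral_sq_sub_le hφ2 ψ hκ
  rw [h0, hn, NNReal.coe_zero] at b2 j2
  rw [hn] at b1
  have b4 : K * ((η / 4) ^ 2 / (K * t + 1) * ((t : ℝ) - 0)) / (η / 4) ≤ η / 4 := by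
    rw [div_le_iff₀ (by positivity), sub_zero]
    have h2 : K * t / (K * t + 1) ≤ 1 := by
      rw [div_le_one (by positivity)]; linarith
    calc K * ((η / 4) ^ 2 / (K * t + 1) * (t : ℝ)) =
        (η / 4) ^ 2 * (K * t / (K * t + 1)) := by ring
      _ ≤ (η / 4) ^ 2 * 1 := by gcongr
      _ = _ := by ring
  have j1 : Integrable (fun ω => ∑ i ∈ Finset.range n, (M (π (i + 1)) ω - M (π i) ω) ^ 2 -
      ∑ i ∈ Finset.range n, (ψ.integral B (π (i + 1)) ω - ψ.integral B (π i) ω) ^ 2) Q :=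
    (integrable_finsetSum _ fun i _ => ((hM _).1.sub (hM _).1).integrable_sq).sub
      (integrable_finsetSum _ fun i _ =>
        (ψ.memLp_integral_sub hB (hπ (Nat.le_succ i)) (p := 2) (by simp)).integrable_sq)
  have j3 : Integrable (fun ω => (∫ u in Set.Ioc (0 : ℝ) t, ψ.toFun u ω * ψ.toFun u ω) -
        ∫ u in Set.Ioc (0 : ℝ) t, φ u ω ^ 2) Q := by
    have h3 := hψ2.integrable_sq.integral_prod_right
    simp only [sq] at h3
    exact h3.sub hφ2.integrable_sq.integral_prod_right
  refine ⟨((j1.add j2).add j3).congr (Eventually.of_forall fun ω => by simp), ?_⟩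
  refine (integral_mono (g := fun ω => (|∑ i ∈ Finset.range n, (M (π (i + 1)) ω - M (π i) ω) ^ 2 -
      ∑ i ∈ Finset.range n, (ψ.integral B (π (i + 1)) ω - ψ.integral B (π i) ω) ^ 2| +
      |∑ i ∈ Finset.range n, (ψ.integral B (π (i + 1)) ω - ψ.integral B (π i) ω) ^ 2 -
        ∫ u in Set.Ioc (0 : ℝ) t, ψ.toFun u ω * ψ.toFun u ω|) +
      |(∫ u in Set.Ioc (0 : ℝ) t, ψ.toFun u ω * ψ.toFun u ω) -
        ∫ u in Set.Ioc (0 : ℝ) t, φ u ω ^ 2|)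
    (((j1.add j2).add j3).congr (Eventually.of_forall fun ω => by simp)).abs
    ((j1.abs.add j2.abs).add j3.abs) fun ω => ?_).trans ?_
  · refine le_trans (le_of_eq ?_) ((abs_add_le _ _).trans (add_le_add_left (abs_add_le _ _) _))
    congr 1; ring
  · rw [integral_add (by exact j1.abs.add j2.abs) j3.abs, integral_add j1.abs j2.abs]
    linarith

end QuadVarIto

/-! ### Adding the drift; existence and uniqueness of the quadratic variation. -/

section QuadVarProcess

/-- The sum is at most the largest increment times the total variation ∫|g|; the former vanishes by
uniform continuity of the primitive. -/
lemma tendsto_sum_sq_primitive {g : ℝ → ℝ} {t : ℝ≥0}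
    (hg : IntegrableOn g (Set.Ioc (0 : ℝ) t)) {N : ℕ → ℕ} {π : ℕ → ℕ → ℝ≥0}
    (hπ : ∀ k, Monotone (π k)) (h0 : ∀ k, π k 0 = 0) (hN : ∀ k, π k (N k) = t)
    (hmesh : ∀ ε : ℝ, 0 < ε → ∀ᶠ k in atTop, ∀ i < N k, (π k (i + 1) : ℝ) - π k i < ε) :
    Tendsto (fun k => ∑ i ∈ Finset.range (N k),
      ((∫ u in (0 : ℝ)..(π k (i + 1)), g u) - ∫ u in (0 : ℝ)..(π k i), g u) ^ 2)
      atTop (𝓝 0) := by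
  have hcont : ContinuousOn (fun s => ∫ u in (0 : ℝ)..s, g u) (Set.Icc 0 (t : ℝ)) := by
    have := intervalIntegral.continuousOn_primitive_interval (a := 0) (b := (t : ℝ)) (f := g)
      (μ := volume) (by rw [Set.uIcc_of_le t.coe_nonneg, integrableOn_Icc_iff_integrableOn_Ioc]; exact hg)
    rwa [Set.uIcc_of_le t.coe_nonneg] at this
  have huc := isCompact_Icc.uniformContinuousOn_of_continuous hcont
  rw [Metric.uniformContinuousOn_iff] at huc
  set L := ∫ u in Set.Ioc (0 : ℝ) t, |g u| with hL
  have hL0 : 0 ≤ L := integral_nonneg fun u => abs_nonneg _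
  rw [Metric.tendsto_atTop]
  intro ε hε
  obtain ⟨δ, hδ, hδε⟩ := huc (ε / (L + 1)) (by positivity)
  obtain ⟨k₀, hk₀⟩ := eventually_atTop.1 (hmesh δ hδ)
  refine ⟨k₀, fun k hk => ?_⟩
  have hle : ∀ i < N k, π k (i + 1) ≤ t := fun i hi => by
    rw [← hN k]; exact hπ k hi
  have hmono : ∀ i, (π k i : ℝ) ≤ π k (i + 1) := fun i =>
    NNReal.coe_le_coe.2 (hπ k (Nat.le_succ i))
  have key : ∀ i ∈ Finset.range (N k),
      ((∫ u in (0 : ℝ)..(π k (i + 1)), g u) - ∫ u in (0 : ℝ)..(π k i), g u) ^ 2 ≤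
        ε / (L + 1) * ∫ u in Set.Ioc (π k i : ℝ) (π k (i + 1)), |g u| := by
    intro i hi
    rw [Finset.mem_range] at hi
    have h1 : (π k (i + 1) : ℝ) ≤ t := NNReal.coe_le_coe.2 (hle i hi)
    have hs := hδε (π k (i + 1)) ⟨(π k (i + 1)).2, h1⟩ (π k i)
      ⟨(π k i).2, (hmono i).trans h1⟩ (by
        rw [Real.dist_eq, abs_of_nonneg (sub_nonneg.2 (hmono i))]; exact hk₀ k hk i hi)
    rw [Real.dist_eq] at hs
    have hI : ∀ s : ℝ≥0, (s : ℝ) ≤ t → IntervalIntegrable g volume 0 s := fun s hs =>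
      (intervalIntegrable_iff_integrableOn_Ioc_of_le s.2).2
        (hg.mono_set (Set.Ioc_subset_Ioc_right hs))
    have h2 : |(∫ u in (0 : ℝ)..(π k (i + 1)), g u) - ∫ u in (0 : ℝ)..(π k i), g u| ≤
        ∫ u in Set.Ioc (π k i : ℝ) (π k (i + 1)), |g u| := by
      rw [intervalIntegral.integral_interval_sub_left (hI _ h1) (hI _ ((hmono i).trans h1)),
        intervalIntegral.integral_of_le (hmono i)]
      exact abs_integral_le_integral_abs
    rw [← sq_abs, sq]
    exact mul_le_mul hs.le h2 (abs_nonneg _) (by positivity)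
  rw [Real.dist_eq, sub_zero, abs_of_nonneg (Finset.sum_nonneg fun i _ => sq_nonneg _)]
  refine (Finset.sum_le_sum key).trans_lt ?_
  rw [← Finset.mul_sum, sum_setIntegral_Ioc (hπ k), h0 k, hN k, NNReal.coe_zero, ← hL,
    div_mul_eq_mul_div, div_lt_iff₀ (by positivity)]
  · nlinarith
  · rw [h0 k, hN k]; exact hg.abs

/-- Cauchy–Schwarz kills the cross term. -/
lemma tendsto_sum_add_sq {N : ℕ → ℕ} {x d : ℕ → ℕ → ℝ} {A : ℝ}
    (hx : Tendsto (fun k => ∑ i ∈ Finset.range (N k), x k i ^ 2) atTop (𝓝 A))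
    (hd : Tendsto (fun k => ∑ i ∈ Finset.range (N k), d k i ^ 2) atTop (𝓝 0)) :
    Tendsto (fun k => ∑ i ∈ Finset.range (N k), (x k i + d k i) ^ 2) atTop (𝓝 A) := by
  have hc : Tendsto (fun k => ∑ i ∈ Finset.range (N k), x k i * d k i) atTop (𝓝 0) := by
    have hs := (Real.continuous_sqrt.tendsto _).comp (hx.mul hd)
    simp only [mul_zero, Real.sqrt_zero] at hs
    exact squeeze_zero_norm (fun k => Real.abs_le_sqrt (Finset.sum_mul_sq_le_sq_mul_sq _ _ _)) hs
  have := (hx.add (hc.const_mul 2)).add hd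
  simp only [mul_zero, add_zero] at this
  refine this.congr fun k => ?_
  rw [Finset.mul_sum, ← Finset.sum_add_distrib, ← Finset.sum_add_distrib]
  exact Finset.sum_congr rfl fun i _ => by ring

variable {Ω : Type*} {m : MeasurableSpace Ω} {Q : Measure Ω} {𝓕 : Filtration ℝ≥0 m}
  {B : ℝ≥0 → Ω → ℝ} {φ : ℝ → Ω → ℝ}

/-- Properties such as positivity of `ξ₀` are known only at times t ≥ 0, and the strip measure
ignores all times outside (s, t]. -/
lemma ae_strip_of_forall [SFinite Q] {s t : ℝ} {P : ℝ × Ω → Prop}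
    (h : ∀ u ∈ Set.Ioc s t, ∀ ω, P (u, ω)) : ∀ᵐ p ∂(stripMeasure Q s t), P p := by
  have e : stripMeasure Q s t = (volume.prod Q).restrict (Set.Ioc s t ×ˢ Set.univ) := by
    rw [← Measure.prod_restrict, Measure.restrict_univ]; rfl
  rw [e]
  filter_upwards [ae_restrict_mem (measurableSet_Ioc.prod MeasurableSet.univ)] with p hp
  exact h p.1 hp.1 p.2

lemma IsItoIntegral.congr [SFinite Q] {φ' : ℝ → Ω → ℝ} {t : ℝ≥0} {I : Ω → ℝ}
    (hI : IsItoIntegral 𝓕 Q B φ t I) (h : ∀ u ∈ Set.Ioc (0 : ℝ) t, ∀ ω, φ u ω = φ' u ω) :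
    IsItoIntegral 𝓕 Q B φ' t I := by
  obtain ⟨h1, φs, h2, h3⟩ := hI
  refine ⟨h1, φs, h2.congr fun k => eLpNorm_congr_ae ?_, h3⟩
  exact ae_strip_of_forall (P := fun p => (φs k).toFun p.1 p.2 - φ p.1 p.2 =
    (φs k).toFun p.1 p.2 - φ' p.1 p.2) fun u hu ω => by simp only [h u hu ω]

/-- The quadratic variation of an Itô process with absolutely continuous drift. -/
theorem hasQuadVar_of_ito [IsProbabilityMeasure Q] (hB : IsBrownianMotion 𝓕 Q B)
    (hφ : Measurable (Function.uncurry φ)) {M : ℝ≥0 → Ω → ℝ}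
    (hM : ∀ u, IsItoIntegral 𝓕 Q B φ u (M u)) {b : ℝ → Ω → ℝ}
    (hb : ∀ u : ℝ≥0, Integrable (fun p : ℝ × Ω => b p.1 p.2) (stripMeasure Q 0 u))
    {X : ℝ≥0 → Ω → ℝ} (hX : ∀ u, X u =ᵐ[Q] fun ω => (∫ v in (0 : ℝ)..u, b v ω) + M u ω)
    (t : ℝ≥0) : HasQuadVar Q X t (fun ω => ∫ u in Set.Ioc (0 : ℝ) t, φ u ω ^ 2) := by
  intro N π hπ h0 hN hmesh
  have hD : ∀ u : ℝ≥0, AEStronglyMeasurable (fun ω => ∫ v in (0 : ℝ)..u, b v ω) Q := by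
    intro u
    simp_rw [intervalIntegral.integral_of_le u.coe_nonneg]
    exact (hb u).integral_prod_right.1
  have hXm : ∀ u, AEStronglyMeasurable (X u) Q := fun u =>
    ((hD u).add (hM u).1.1).congr (hX u).symm
  have hq : Integrable (fun ω => ∫ u in Set.Ioc (0 : ℝ) t, φ u ω ^ 2) Q :=
    ((hM t).memLp_integrand hφ).integrable_sq.integral_prod_right
  have hSm : ∀ k, AEStronglyMeasurable (fun ω => ∑ i ∈ Finset.range (N k),
      (M (π k (i + 1)) ω - M (π k i) ω) ^ 2) Q := fun k =>
    Finset.aestronglyMeasurable_fun_sum _ fun i _ => ((hM _).1.1.sub (hM _).1.1).pow 2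
  have hL1 : Tendsto (fun k => eLpNorm ((fun ω => ∑ i ∈ Finset.range (N k),
      (M (π k (i + 1)) ω - M (π k i) ω) ^ 2) - fun ω => ∫ u in Set.Ioc (0 : ℝ) t, φ u ω ^ 2) 1 Q)
      atTop (𝓝 0) := by
    rw [ENNReal.tendsto_atTop_zero]
    intro ε hε
    obtain ⟨η, hη, hηε⟩ : ∃ η : ℝ, 0 < η ∧ ENNReal.ofReal η ≤ ε := by
      rcases eq_or_ne ε ∞ with rfl | h
      · exact ⟨1, one_pos, le_top⟩
      · exact ⟨ε.toReal, ENNReal.toReal_pos hε.ne' h, ENNReal.ofReal_toReal_le⟩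
    obtain ⟨δ, hδ, H⟩ := exists_mesh_integral_abs_quadVar_le hB hφ hM t hη
    obtain ⟨k₀, hk₀⟩ := eventually_atTop.1 (hmesh δ hδ)
    refine ⟨k₀, fun k hk => ?_⟩
    obtain ⟨hi, hle⟩ := H (N k) (π k) (hπ k) (h0 k) (hN k) fun i hi => (hk₀ k hk i hi).le
    rw [eLpNorm_one_eq_lintegral_enorm, ← ofReal_integral_norm_eq_lintegral_enorm (by exact hi)]
    exact (ENNReal.ofReal_le_ofReal hle).trans hηε
  have hmeas := tendstoInMeasure_of_tendsto_eLpNorm one_ne_zero hSm hq.1 hL1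
  have hXSm : ∀ k, AEStronglyMeasurable (fun ω => ∑ i ∈ Finset.range (N k),
      (X (π k (i + 1)) ω - X (π k i) ω) ^ 2) Q := fun k =>
    Finset.aestronglyMeasurable_fun_sum _ fun i _ => ((hXm _).sub (hXm _)).pow 2
  -- The drift is controlled path by path while the martingale part converges only in measure; the
  -- criterion of almost surely convergent sub-subsequences joins the two.
  rw [exists_seq_tendstoInMeasure_atTop_iff hXSm]
  rw [exists_seq_tendstoInMeasure_atTop_iff hSm] at hmeas
  intro ns hns
  obtain ⟨ns', hns', hae⟩ := hmeas ns hns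
  refine ⟨ns', hns', ?_⟩
  have hXall : ∀ᵐ ω ∂Q, ∀ k i, X (π k i) ω =
      (∫ v in (0 : ℝ)..(π k i), b v ω) + M (π k i) ω :=
    ae_all_iff.2 fun k => ae_all_iff.2 fun i => hX (π k i)
  filter_upwards [hae, hXall, (hb t).prod_left_ae] with ω h1 h2 h3
  have h4 := (tendsto_sum_sq_primitive h3 hπ h0 hN hmesh).comp
    ((hns.comp hns').tendsto_atTop)
  refine (tendsto_sum_add_sq h1 h4).congr fun k => ?_
  refine Finset.sum_congr rfl fun i _ => ?_
  rw [h2, h2]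
  simp only [Function.comp_apply]
  ring

/-- Without partitions of vanishing mesh the definition of quadratic variation would be vacuous;
their existence yields uniqueness, hence control of the representative picked in `quadVar`. -/
lemma exists_partition (t : ℝ≥0) : ∃ (N : ℕ → ℕ) (π : ℕ → ℕ → ℝ≥0),
    (∀ k, Monotone (π k)) ∧ (∀ k, π k 0 = 0) ∧ (∀ k, π k (N k) = t) ∧
    (∀ ε : ℝ, 0 < ε → ∀ᶠ k in atTop, ∀ i < N k, (π k (i + 1) : ℝ) - π k i < ε) := by
  refine ⟨fun k => k + 1, fun k i => t * (i / (k + 1)), fun k i j hij => ?_, fun k => by simp,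
    fun k => ?_, fun ε hε => ?_⟩
  · simp only
    gcongr
  · simp
  · have hlim : Tendsto (fun k : ℕ => (t : ℝ) * (1 / ((k : ℝ) + 1))) atTop (𝓝 (t * 0)) :=
      tendsto_one_div_add_atTop_nhds_zero_nat.const_mul _
    rw [mul_zero] at hlim
    filter_upwards [hlim.eventually_lt_const hε] with k hk i _
    refine lt_of_eq_of_lt ?_ hk
    push_cast
    ring

lemma HasQuadVar.ae_unique {X : ℝ≥0 → Ω → ℝ} {t : ℝ≥0} {L L' : Ω → ℝ}
    (h : HasQuadVar Q X t L) (h' : HasQuadVar Q X t L') : L =ᵐ[Q] L' := by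
  obtain ⟨N, π, h1, h2, h3, h4⟩ := exists_partition t
  exact tendstoInMeasure_ae_unique (h N π h1 h2 h3 h4) (h' N π h1 h2 h3 h4)

lemma HasQuadVar.quadVar_ae_eq {X : ℝ≥0 → Ω → ℝ} {t : ℝ≥0} {L : Ω → ℝ}
    (h : HasQuadVar Q X t L) : quadVar Q X t =ᵐ[Q] L := by
  have hex : ∃ L : Ω → ℝ, HasQuadVar Q X t L := ⟨L, h⟩
  rw [quadVar, dif_pos hex]
  exact hex.choose_spec.ae_unique h

end QuadVarProcess

/-! ### Wiener integrals and their Gaussian decomposition. -/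

section Wiener

lemma SimpleProcess.toFun_eq_coeff {Ω : Type*} {m : MeasurableSpace Ω} {𝓕 : Filtration ℝ≥0 m}
    (φ : SimpleProcess 𝓕) {i : ℕ} (hi : i < φ.n) {u : ℝ}
    (hu : u ∈ Set.Ioc (φ.time i : ℝ) (φ.time (i + 1))) (ω : Ω) :
    φ.toFun u ω = φ.coeff i ω := by
  unfold SimpleProcess.toFun
  rw [Finset.sum_eq_single_of_mem i (Finset.mem_range.2 hi), Set.indicator_of_mem hu]
  intro j _ hji
  refine Set.indicator_of_notMem (fun hj => ?_) _
  rcases lt_or_gt_of_ne hji with h | h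
  · have := NNReal.coe_le_coe.2 (φ.mono (Nat.succ_le_of_lt h))
    exact absurd (hj.2.trans this) (not_le.2 hu.1)
  · have := NNReal.coe_le_coe.2 (φ.mono (Nat.succ_le_of_lt h))
    exact absurd (hu.2.trans this) (not_le.2 hj.1)

/-- Given `𝒢`, the random variable `Y` is centred Gaussian with variance `v`. -/
def GaussianGiven {Ω : Type*} (𝒢 : MeasurableSpace Ω) {m : MeasurableSpace Ω} (Q : Measure Ω)
    (Y : Ω → ℝ) (v : ℝ≥0) : Prop :=
  ∀ D, MeasurableSet[𝒢] D → (Q.restrict D).map Y = Q D • gaussianReal 0 v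

/-- Comparing D with the full space shows that `Y` is independent of `𝒢`; the integral then factors
and the second factor is the Gaussian moment generating function. -/
lemma GaussianGiven.lintegral_mul_exp {Ω : Type*} {𝒢 m : MeasurableSpace Ω} {Q : Measure Ω}
    [IsProbabilityMeasure Q] (h𝒢 : 𝒢 ≤ m) {Y : Ω → ℝ} {v : ℝ≥0} (h : GaussianGiven 𝒢 Q Y v) (hY : Measurable Y)
    {F : Ω → ℝ≥0∞} (hF : Measurable[𝒢] F) (a : ℝ) :
    ∫⁻ ω, F ω * ENNReal.ofReal (Real.exp (a * Y ω)) ∂Q =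
      (∫⁻ ω, F ω ∂Q) * ENNReal.ofReal (Real.exp (v * a ^ 2 / 2)) := by
  have hlaw : Q.map Y = gaussianReal 0 v := by
    have := h Set.univ MeasurableSet.univ
    simpa using this
  have hind : Indep 𝒢 (MeasurableSpace.comap Y inferInstance) Q := by
    rw [Indep_iff]
    rintro D _ hD ⟨S, hS, rfl⟩
    have h1 : (Q.restrict D).map Y S = (Q D • gaussianReal 0 v) S := by rw [h D hD]
    rw [Measure.map_apply hY hS, Measure.restrict_apply (hY hS), ← hlaw, Measure.smul_apply,
      Measure.map_apply hY hS, smul_eq_mul, Set.inter_comm] at h1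
    exact h1
  have hg : Measurable[MeasurableSpace.comap Y inferInstance]
      (fun ω => ENNReal.ofReal (Real.exp (a * Y ω))) :=
    (show Measurable (fun x : ℝ => ENNReal.ofReal (Real.exp (a * x))) by fun_prop).comp
      (comap_measurable Y)
  rw [lintegral_mul_eq_lintegral_mul_lintegral_of_independent_measurableSpace h𝒢 hY.comap_le
    hind hF hg]
  congr 1
  have hmgf := mgf_gaussianReal hlaw a
  have hint : Integrable (fun ω => Real.exp (a * Y ω)) Q := by
    have := integrable_exp_mul_gaussianReal (μ := 0) (v := v) a
    rw [← hlaw] at this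
    exact this.comp_measurable hY
  rw [← ofReal_integral_eq_lintegral_ofReal hint
    (Eventually.of_forall fun ω => (Real.exp_pos _).le)]
  unfold mgf at hmgf
  rw [hmgf, zero_mul, zero_add]

/-- Finite measures are determined by their characteristic functions, here applied to the law of `Y`
on each event separately. -/
lemma gaussianGiven_of_charFun {Ω : Type*} {𝒢 m : MeasurableSpace Ω} {Q : Measure Ω}
    [IsFiniteMeasure Q]
    {Y : Ω → ℝ} (hY : Measurable Y) {v : ℝ≥0}
    (h : ∀ D, MeasurableSet[𝒢] D → ∀ θ : ℝ, ∫ ω in D, Complex.exp (θ * Y ω * Complex.I) ∂Q =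
      (Q.real D : ℂ) * Complex.exp (-(v * θ ^ 2 / 2))) : GaussianGiven 𝒢 Q Y v := by
  intro D hD
  have : IsFiniteMeasure (Q D • gaussianReal 0 v) := Measure.smul_finite _ (measure_ne_top _ _)
  refine Measure.ext_of_charFun (funext fun θ => ?_)
  have e2 : charFun (Q D • gaussianReal 0 v) θ = (Q.real D : ℂ) * charFun (gaussianReal 0 v) θ := by
    simp only [charFun_apply_real, integral_smul_measure]
    rw [Complex.real_smul]; rfl
  rw [e2, charFun_gaussianReal, charFun_apply_real, integral_map hY.aemeasurable (by fun_prop),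
    h D hD θ]
  congr 2
  simp

variable {Ω : Type*} {m : MeasurableSpace Ω} {Q : Measure Ω} {𝓕 : Filtration ℝ≥0 m}
  {B : ℝ≥0 → Ω → ℝ}

lemma IsBrownianMotion.integral_cexp_incr (hB : IsBrownianMotion 𝓕 Q B) {s t : ℝ≥0}
    (hst : s ≤ t) (a : ℝ) :
    ∫ ω, Complex.exp (a * (B t ω - B s ω : ℝ) * Complex.I) ∂Q =
      Complex.exp (-(((t : ℝ) - s : ℝ) * a ^ 2 / 2)) := by
  have h := hB.hasLaw_incr hst
  have h1 := charFun_gaussianReal (μ := 0) (v := t - s) a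
  rw [← h.map_eq, charFun_apply_real, integral_map h.aemeasurable (by fun_prop)] at h1
  rw [h1]
  congr 1
  rw [show ((t - s : ℝ≥0) : ℂ) = (((t : ℝ) - s : ℝ) : ℂ) by
    rw [← NNReal.coe_sub hst]]
  push_cast
  ring

/-- The characteristic function of a Wiener sum, on an event known at the initial time. -/
lemma setIntegral_cexp_wiener_sum [IsProbabilityMeasure Q] (hB : IsBrownianMotion 𝓕 Q B)
    {τ : ℕ → ℝ≥0} (hτ : Monotone τ) (c : ℕ → ℝ) {A : Set Ω} (hA : MeasurableSet[𝓕 (τ 0)] A)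
    (θ : ℝ) (n : ℕ) :
    ∫ ω in A, Complex.exp (θ * (∑ i ∈ Finset.range n, c i * (B (τ (i + 1)) ω - B (τ i) ω) : ℝ) *
        Complex.I) ∂Q =
      (Q.real A : ℂ) * Complex.exp (-((∑ i ∈ Finset.range n,
        c i ^ 2 * ((τ (i + 1) : ℝ) - τ i) : ℝ) * θ ^ 2 / 2)) := by
  have hA' : MeasurableSet A := 𝓕.le _ _ hA
  induction n with
  | zero => simp
  | succ n ih =>
    have hn := hτ (Nat.le_succ n)
    -- Event and partial sum are both known at τ n, hence jointly independent of the next increment.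
    set Y : Ω → ℂ := A.indicator fun ω => Complex.exp (θ * (∑ i ∈ Finset.range n,
      c i * (B (τ (i + 1)) ω - B (τ i) ω) : ℝ) * Complex.I) with hY
    have hYm : Measurable[𝓕 (τ n)] Y := by
      have hS : Measurable[𝓕 (τ n)] fun ω => ∑ i ∈ Finset.range n,
          c i * (B (τ (i + 1)) ω - B (τ i) ω) := by
        refine Finset.measurable_fun_sum _ fun i hi => ?_
        have h1 : τ (i + 1) ≤ τ n := hτ (Finset.mem_range.1 hi)
        exact (((hB.stronglyMeasurable_le h1).measurable).sub
          (hB.stronglyMeasurable_le ((hτ (Nat.le_succ i)).trans h1)).measurable).const_mul _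
      have hE : Measurable fun x : ℝ => Complex.exp (θ * (x : ℂ) * Complex.I) := by fun_prop
      exact (hE.comp hS).indicator (𝓕.mono (hτ (Nat.zero_le n)) _ hA)
    have hg : Measurable fun x : ℝ => Complex.exp ((θ * c n : ℝ) * (x : ℂ) * Complex.I) := by
      fun_prop
    have hind := (hB.indepFun hn hYm).comp measurable_id hg
    have hprod := hind.integral_mul_eq_mul_integral
      (by exact (hYm.mono (𝓕.le _) le_rfl).aestronglyMeasurable)
      (by exact (hg.comp_aemeasurable (hB.hasLaw_incr hn).aemeasurable).aestronglyMeasurable)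
    simp only [Function.comp_def, id, Pi.mul_apply] at hprod
    rw [hB.integral_cexp_incr hn] at hprod
    have e1 : ∫ ω, Y ω ∂Q = ∫ ω in A, Complex.exp (θ * (∑ i ∈ Finset.range n,
      c i * (B (τ (i + 1)) ω - B (τ i) ω) : ℝ) * Complex.I) ∂Q := integral_indicator hA'
    rw [e1, ih] at hprod
    rw [← integral_indicator hA', Finset.sum_range_succ]
    convert hprod using 1
    · congr 1
      ext ω
      by_cases hω : ω ∈ A
      · simp only [Set.indicator_of_mem hω, hY, ← Complex.exp_add, Finset.sum_range_succ]
        congr 1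
        push_cast
        ring
      · simp [Set.indicator_of_notMem hω, hY]
    · rw [mul_assoc, ← Complex.exp_add]
      congr 2
      push_cast
      ring

/-- The step process with values `f` at the left ends of a uniform partition of `(0, t]`. -/
noncomputable def leftStep (𝓕 : Filtration ℝ≥0 m) (f : ℝ → ℝ) (t : ℝ≥0) (n : ℕ) :
    SimpleProcess 𝓕 where
  n := n + 1
  time i := t * (i / (n + 1))
  mono i j hij := by simp only; gcongr
  coeff i _ := f ((t * (i / (n + 1)) : ℝ≥0) : ℝ)
  meas _ := stronglyMeasurable_const
  bdd i := ⟨_, fun _ => le_rfl⟩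

lemma leftStep_toFun_eq (f : ℝ → ℝ) (t : ℝ≥0) (n : ℕ) (u : ℝ) (ω ω₀ : Ω) :
    (leftStep 𝓕 f t n).toFun u ω = (leftStep 𝓕 f t n).toFun u ω₀ := by
  simp only [SimpleProcess.toFun, leftStep]

lemma leftStep_spec (f : ℝ → ℝ) {t : ℝ≥0} (n : ℕ) {u : ℝ} (hu : u ∈ Set.Ioc (0 : ℝ) t) :
    ∃ r : ℝ, 0 ≤ r ∧ r < u ∧ u - r ≤ t * (1 / ((n : ℝ) + 1)) ∧
      ∀ ω : Ω, (leftStep 𝓕 f t n).toFun u ω = f r := by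
  have ht : (0 : ℝ) < t := hu.1.trans_le hu.2
  have hn : (0 : ℝ) < (n : ℝ) + 1 := by positivity
  set x : ℝ := u * (n + 1) / t with hx
  have hx0 : 0 < x := by have := hu.1; positivity
  have hxn : x ≤ n + 1 := by
    rw [hx, div_le_iff₀ ht, mul_comm]
    exact mul_le_mul_of_nonneg_left hu.2 hn.le
  -- The cells are open on the left, so the cell containing u has index ⌈x⌉ - 1, with x the rescaled
  -- position of u.
  obtain ⟨i, hi⟩ : ∃ i : ℕ, ⌈x⌉₊ = i + 1 := Nat.exists_eq_succ_of_ne_zero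
    (Nat.ceil_pos.2 hx0).ne'
  have hile : i < n + 1 := by
    have : ⌈x⌉₊ ≤ n + 1 := Nat.ceil_le.2 (by exact_mod_cast hxn)
    omega
  have h1 : (i : ℝ) < x := Nat.lt_ceil.1 (by omega)
  have h2 : x ≤ i + 1 := by
    have := Nat.le_ceil x
    rw [hi] at this
    exact_mod_cast this
  have hux : u = t * (x / (n + 1)) := by rw [hx]; field_simp
  have hr : (t : ℝ) * (i / (n + 1)) < u := by rw [hux]; gcongr
  have hmem : u ∈ Set.Ioc (((leftStep 𝓕 f t n).time i : ℝ≥0) : ℝ)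
      ((leftStep 𝓕 f t n).time (i + 1)) := by
    simp only [leftStep]
    push_cast
    refine ⟨hr, ?_⟩
    rw [hux]; gcongr
  refine ⟨(t : ℝ) * (i / (n + 1)), by positivity, hr, ?_, fun ω => ?_⟩
  · have e : u - (t : ℝ) * (i / (n + 1)) = t * ((x - i) / (n + 1)) := by
      conv_lhs => rw [hux]
      ring
    rw [e]
    gcongr
    linarith
  · rw [(leftStep 𝓕 f t n).toFun_eq_coeff hile hmem]
    simp only [leftStep]
    push_cast
    rfl

/-- Nonnegative, nondecreasing and continuous functions on `[0, t)` that are square integrable. -/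
structure IsVolterraKernel (f : ℝ → ℝ) (t : ℝ≥0) : Prop where
  meas : Measurable f
  nonneg : ∀ u ∈ Set.Ico (0 : ℝ) t, 0 ≤ f u
  mono : MonotoneOn f (Set.Ico (0 : ℝ) t)
  cont : ContinuousOn f (Set.Ico (0 : ℝ) t)
  int : IntegrableOn (fun u => f u ^ 2) (Set.Ioc (0 : ℝ) t)

/-- Left-end values of a nondecreasing function never exceed it, so `f` itself dominates its
approximations. The endpoint t, where the kernel is singular, is excluded. -/
lemma IsVolterraKernel.leftStep_le {f : ℝ → ℝ} {t : ℝ≥0} (hf : IsVolterraKernel f t) (n : ℕ)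
    {u : ℝ} (hu : u ∈ Set.Ioo (0 : ℝ) t) (ω : Ω) :
    0 ≤ (leftStep 𝓕 f t n).toFun u ω ∧ (leftStep 𝓕 f t n).toFun u ω ≤ f u := by
  obtain ⟨r, hr0, hru, -, h⟩ := leftStep_spec (𝓕 := 𝓕) f n ⟨hu.1, hu.2.le⟩
  rw [h ω]
  exact ⟨hf.nonneg r ⟨hr0, hru.trans hu.2⟩,
    hf.mono ⟨hr0, hru.trans hu.2⟩ ⟨hu.1.le, hu.2⟩ hru.le⟩

lemma IsVolterraKernel.tendsto_leftStep {f : ℝ → ℝ} {t : ℝ≥0} (hf : IsVolterraKernel f t)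
    {u : ℝ} (hu : u ∈ Set.Ioo (0 : ℝ) t) (ω : Ω) :
    Tendsto (fun n => (leftStep 𝓕 f t n).toFun u ω) atTop (𝓝 (f u)) := by
  choose r hr0 hru hur h using fun n => leftStep_spec (𝓕 := 𝓕) f n
    (⟨hu.1, hu.2.le⟩ : u ∈ Set.Ioc (0 : ℝ) t)
  have hr : Tendsto r atTop (𝓝 u) := by
    have hlim : Tendsto (fun k : ℕ => u - (t : ℝ) * (1 / ((k : ℝ) + 1))) atTop
        (𝓝 (u - t * 0)) :=
      (tendsto_one_div_add_atTop_nhds_zero_nat.const_mul _).const_sub _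
    rw [mul_zero, sub_zero] at hlim
    exact tendsto_of_tendsto_of_tendsto_of_le_of_le hlim tendsto_const_nhds
      (fun n => by linarith [hur n]) (fun n => (hru n).le)
  have hc := hf.cont u ⟨hu.1.le, hu.2⟩
  have h2 : Tendsto r atTop (𝓝[Set.Ico (0 : ℝ) t] u) :=
    tendsto_nhdsWithin_iff.2 ⟨hr, Eventually.of_forall fun n => ⟨hr0 n, (hru n).trans hu.2⟩⟩
  exact (hc.tendsto.comp h2).congr fun n => (h n ω).symm

lemma ae_mem_Ioo {s t : ℝ} : ∀ᵐ u ∂(volume.restrict (Set.Ioc s t)), u ∈ Set.Ioo s t := by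
  rw [← restrict_Ioo_eq_restrict_Ioc]
  exact ae_restrict_mem measurableSet_Ioo

lemma SimpleProcess.measurable_toFun_left (φ : SimpleProcess 𝓕) (ω : Ω) :
    StronglyMeasurable fun u => φ.toFun u ω :=
  φ.stronglyMeasurable_toFun.comp_measurable (measurable_id.prodMk measurable_const)

lemma eLpNorm_comp_fst_strip [IsProbabilityMeasure Q] {g : ℝ → ℝ} {s t : ℝ}
    (hg : AEStronglyMeasurable g (volume.restrict (Set.Ioc s t))) :
    eLpNorm (fun p : ℝ × Ω => g p.1) 2 (stripMeasure Q s t) =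
      eLpNorm g 2 (volume.restrict (Set.Ioc s t)) :=
  eLpNorm_comp_measurePreserving (f := (Prod.fst : ℝ × Ω → ℝ)) hg measurePreserving_fst

lemma IsVolterraKernel.tendsto_eLpNorm_leftStep [IsProbabilityMeasure Q] {f : ℝ → ℝ} {t : ℝ≥0}
    (hf : IsVolterraKernel f t) :
    Tendsto (fun n => eLpNorm (fun p : ℝ × Ω => (leftStep 𝓕 f t n).toFun p.1 p.2 - f p.1) 2
      (stripMeasure Q 0 t)) atTop (𝓝 0) := by
  -- The step process is deterministic: freezing the scenario reduces the norm on the strip to a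
  -- norm in time.
  obtain ⟨ω₀⟩ : Nonempty Ω := nonempty_of_isProbabilityMeasure Q
  have e : ∀ n, eLpNorm (fun p : ℝ × Ω => (leftStep 𝓕 f t n).toFun p.1 p.2 - f p.1) 2
      (stripMeasure Q 0 t) = ENNReal.ofReal (Real.sqrt
        (∫ u in Set.Ioc (0 : ℝ) t, ((leftStep 𝓕 f t n).toFun u ω₀ - f u) ^ 2)) := by
    intro n
    have hm : AEStronglyMeasurable (fun u => (leftStep 𝓕 f t n).toFun u ω₀ - f u)
        (volume.restrict (Set.Ioc (0 : ℝ) t)) :=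
      (((leftStep 𝓕 f t n).measurable_toFun_left ω₀).aestronglyMeasurable).sub
        hf.meas.aestronglyMeasurable
    have h2 : MemLp (fun u => (leftStep 𝓕 f t n).toFun u ω₀ - f u) 2
        (volume.restrict (Set.Ioc (0 : ℝ) t)) := by
      have hf2 : MemLp f 2 (volume.restrict (Set.Ioc (0 : ℝ) t)) :=
        (memLp_two_iff_integrable_sq hf.meas.aestronglyMeasurable).2 hf.int
      refine hf2.mono hm ?_
      filter_upwards [ae_mem_Ioo] with u hu
      have := hf.leftStep_le (𝓕 := 𝓕) n hu ω₀
      rw [Real.norm_eq_abs, Real.norm_eq_abs, abs_sub_comm,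
        abs_of_nonneg (sub_nonneg.2 this.2), abs_of_nonneg (this.1.trans this.2)]
      linarith
    have e1 : (fun p : ℝ × Ω => (leftStep 𝓕 f t n).toFun p.1 p.2 - f p.1) =
        fun p : ℝ × Ω => (leftStep 𝓕 f t n).toFun p.1 ω₀ - f p.1 :=
      funext fun p => by rw [leftStep_toFun_eq f t n p.1 p.2 ω₀]
    rw [e1]
    exact (eLpNorm_comp_fst_strip (Q := Q)
      (g := fun u => (leftStep 𝓕 f t n).toFun u ω₀ - f u) hm).trans (eLpNorm_two_eq_ofReal h2)
  simp_rw [e]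
  have hlim : Tendsto (fun n => ∫ u in Set.Ioc (0 : ℝ) t,
      ((leftStep 𝓕 f t n).toFun u ω₀ - f u) ^ 2) atTop (𝓝 (∫ u in Set.Ioc (0 : ℝ) t, 0)) := by
    refine tendsto_integral_of_dominated_convergence (fun u => f u ^ 2) (fun n => ?_) hf.int
      (fun n => ?_) ?_
    · exact ((((leftStep 𝓕 f t n).measurable_toFun_left ω₀).aestronglyMeasurable).sub
        hf.meas.aestronglyMeasurable).pow 2
    · filter_upwards [ae_mem_Ioo] with u hu
      have := hf.leftStep_le (𝓕 := 𝓕) n hu ω₀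
      rw [Real.norm_eq_abs, abs_of_nonneg (sq_nonneg _)]
      nlinarith [this.1, this.2]
    · filter_upwards [ae_mem_Ioo] with u hu
      have := ((hf.tendsto_leftStep (𝓕 := 𝓕) hu ω₀).sub_const (f u)).pow 2
      simpa using this
  have := ENNReal.tendsto_ofReal ((Real.continuous_sqrt.tendsto _).comp hlim)
  simpa using this

lemma IsVolterraKernel.tendsto_integral_leftStep_sq {f : ℝ → ℝ} {s t : ℝ≥0} {v : ℝ}
    (hf : IsVolterraKernel f t) (hv : v ≤ t) (ω : Ω) :
    Tendsto (fun n => ∫ u in Set.Ioc (s : ℝ) v, (leftStep 𝓕 f t n).toFun u ω ^ 2) atTop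
      (𝓝 (∫ u in Set.Ioc (s : ℝ) v, f u ^ 2)) := by
  have hsub : Set.Ioc (s : ℝ) v ⊆ Set.Ioc 0 t := Set.Ioc_subset_Ioc s.coe_nonneg hv
  have hmem : ∀ᵐ u ∂(volume.restrict (Set.Ioc (s : ℝ) v)), u ∈ Set.Ioo (0 : ℝ) t := by
    filter_upwards [ae_mem_Ioo] with u hu
    exact ⟨s.coe_nonneg.trans_lt hu.1, hu.2.trans_le hv⟩
  refine tendsto_integral_of_dominated_convergence (fun u => f u ^ 2) (fun n => ?_)
    (hf.int.mono_set hsub) (fun n => ?_) ?_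
  · exact (((leftStep 𝓕 f t n).measurable_toFun_left ω).aestronglyMeasurable).pow 2
  · filter_upwards [hmem] with u hu
    have := hf.leftStep_le (𝓕 := 𝓕) n hu ω
    rw [Real.norm_eq_abs, abs_of_nonneg (sq_nonneg _)]
    exact pow_le_pow_left₀ this.1 this.2 2
  · filter_upwards [hmem] with u hu
    exact (hf.tendsto_leftStep (𝓕 := 𝓕) hu ω).pow 2

/-- Clamping the partition to [s, v] turns the increment into a Wiener sum that starts at s, whose
variance is the time integral of the squared step function. -/
lemma setIntegral_cexp_leftStep [IsProbabilityMeasure Q] (hB : IsBrownianMotion 𝓕 Q B)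
    (f : ℝ → ℝ) {s v t : ℝ≥0} (hsv : s ≤ v) (hvt : v ≤ t) (n : ℕ) {A : Set Ω}
    (hA : MeasurableSet[𝓕 s] A) (θ : ℝ) (ω₀ : Ω) :
    ∫ ω in A, Complex.exp (θ * ((leftStep 𝓕 f t n).integral B v ω -
        (leftStep 𝓕 f t n).integral B s ω : ℝ) * Complex.I) ∂Q =
      (Q.real A : ℂ) * Complex.exp (-((∫ u in Set.Ioc (s : ℝ) v,
        (leftStep 𝓕 f t n).toFun u ω₀ ^ 2 : ℝ) * θ ^ 2 / 2)) := by
  set ψ := leftStep 𝓕 f t n with hψ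
  set τ : ℕ → ℝ≥0 := fun i => clamp s v (ψ.time i) with hτ
  have hτm : Monotone τ := fun i j hij => clamp_mono s v (ψ.mono hij)
  have hτ0 : τ 0 = s := by simp [hτ, hψ, leftStep, clamp]
  have hτn : τ ψ.n = v := by
    have : ψ.time ψ.n = t := by
      simp [hψ, leftStep]
    simp only [hτ, this, clamp]
    rw [min_eq_right hvt, max_eq_right hsv]
  have hvar : ∑ i ∈ Finset.range ψ.n, ψ.coeff i ω₀ ^ 2 * ((τ (i + 1) : ℝ) - τ i) =
      ∫ u in Set.Ioc (s : ℝ) v, ψ.toFun u ω₀ ^ 2 := by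
    have h := ψ.integrableOn_toFun_sq ω₀ (τ 0) (τ ψ.n)
    simp only [← sq] at h
    have h1 := sum_setIntegral_Ioc hτm h
    rw [hτ0, hτn] at h1
    rw [← h1]
    refine Finset.sum_congr rfl fun i hi => ?_
    have h2 : ∀ u ∈ Set.Ioc (τ i : ℝ) (τ (i + 1)), ψ.toFun u ω₀ ^ 2 = ψ.coeff i ω₀ ^ 2 := by
      intro u hu
      rw [hτ, ← Ioc_inter_Ioc_eq_clamp hsv] at hu
      rw [ψ.toFun_eq_coeff (Finset.mem_range.1 hi) hu.1]
    rw [setIntegral_congr_fun measurableSet_Ioc h2, setIntegral_const, smul_eq_mul,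
      Real.volume_real_Ioc_of_le (NNReal.coe_le_coe.2 (hτm (Nat.le_succ i))), mul_comm]
  have hA0 : MeasurableSet[𝓕 (τ 0)] A := by rw [hτ0]; exact hA
  have key := setIntegral_cexp_wiener_sum hB hτm (fun i => ψ.coeff i ω₀) hA0 θ ψ.n
  rw [hvar] at key
  rw [← key]
  congr 1
  ext ω
  rw [ψ.integral_sub_integral B hsv]
  rfl

/-- Along an almost surely convergent subsequence, dominated convergence applies since the complex
exponentials have modulus one. -/
lemma setIntegral_cexp_of_tendsto [IsProbabilityMeasure Q] {Y : Ω → ℝ} {Yn : ℕ → Ω → ℝ}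
    (hY : AEStronglyMeasurable Y Q) (hYn : ∀ n, AEStronglyMeasurable (Yn n) Q)
    (hlim : Tendsto (fun n => eLpNorm (Yn n - Y) 2 Q) atTop (𝓝 0)) {vn : ℕ → ℝ} {v : ℝ}
    (hv : Tendsto vn atTop (𝓝 v)) {A : Set Ω} {θ : ℝ}
    (h : ∀ n, ∫ ω in A, Complex.exp (θ * Yn n ω * Complex.I) ∂Q =
      (Q.real A : ℂ) * Complex.exp (-(vn n * θ ^ 2 / 2))) :
    ∫ ω in A, Complex.exp (θ * Y ω * Complex.I) ∂Q =
      (Q.real A : ℂ) * Complex.exp (-(v * θ ^ 2 / 2)) := by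
  have hm := tendstoInMeasure_of_tendsto_eLpNorm (by norm_num) hYn hY hlim
  obtain ⟨ns, hns, hae⟩ := hm.exists_seq_tendsto_ae
  have hc : Continuous fun x : ℝ => Complex.exp (θ * (x : ℂ) * Complex.I) := by fun_prop
  have l1 : Tendsto (fun k => ∫ ω in A, Complex.exp (θ * Yn (ns k) ω * Complex.I) ∂Q) atTop
      (𝓝 (∫ ω in A, Complex.exp (θ * Y ω * Complex.I) ∂Q)) := by
    refine tendsto_integral_of_dominated_convergence (fun _ => 1) (fun k => ?_)
      (integrable_const _) (fun k => Eventually.of_forall fun ω => ?_) ?_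
    · exact (hc.comp_aestronglyMeasurable (hYn (ns k))).restrict
    · rw [← Complex.ofReal_mul, Complex.norm_exp_ofReal_mul_I]
    · filter_upwards [ae_restrict_of_ae hae] with ω hω
      exact (hc.tendsto _).comp hω
  have hc2 : Continuous fun x : ℝ => (Q.real A : ℂ) * Complex.exp (-(x * θ ^ 2 / 2)) := by
    fun_prop
  have l2 := ((hc2.tendsto v).comp hv).comp hns.tendsto_atTop
  refine tendsto_nhds_unique l1 (l2.congr fun k => ?_)
  simp only [Function.comp_apply]
  rw [h]

lemma condExp_leftStep_integral [IsProbabilityMeasure Q] (hB : IsBrownianMotion 𝓕 Q B)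
    (f : ℝ → ℝ) {s t : ℝ≥0} (hst : s ≤ t) (n : ℕ) :
    Q[(leftStep 𝓕 f t n).integral B t | 𝓕 s] =ᵐ[Q] (leftStep 𝓕 f t n).integral B s := by
  set ψ := leftStep 𝓕 f t n with hψ
  have hint : ∀ u, Integrable (ψ.integral B u) Q := fun u =>
    (ψ.memLp_integral hB u (p := 1) (by simp)).integrable le_rfl
  have hsm : StronglyMeasurable[𝓕 s] (ψ.integral B s) := by
    have := ψ.stronglyMeasurable_integral_sub hB (zero_le : 0 ≤ s)
    simpa [ψ.integral_zero] using this
  refine (ae_eq_condExp_of_forall_setIntegral_eq (𝓕.le s) (hint t)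
    (fun A _ _ => (hint s).integrableOn) (fun A hA _ => ?_) hsm.aestronglyMeasurable).symm
  have hA' : MeasurableSet A := 𝓕.le _ _ hA
  rw [eq_comm, ← sub_eq_zero, ← integral_sub (hint t).integrableOn (hint s).integrableOn]
  simp_rw [ψ.integral_sub_integral B hst]
  have hblock : ∀ i, Integrable (fun ω => ψ.coeff i ω *
      (B (clamp s t (ψ.time (i + 1))) ω - B (clamp s t (ψ.time i)) ω)) (Q.restrict A) := fun i =>
    ((memLp_bdd_mul (hB.memLp_incr' (clamp s t (ψ.time i)) (clamp s t (ψ.time (i + 1)))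
      (p := 1) (by simp)) (ψ.measurable_coeff i) (ψ.bdd i)).integrable le_rfl).restrict
  rw [integral_finsetSum _ fun i _ => hblock i]
  refine Finset.sum_eq_zero fun i _ => ?_
  have h1 : StronglyMeasurable[𝓕 (clamp s t (ψ.time i))]
      (A.indicator fun _ => f ((t * (i / (n + 1)) : ℝ≥0) : ℝ)) :=
    stronglyMeasurable_const.indicator (𝓕.mono (le_clamp _ _ _) _ hA)
  rw [← hB.integral_mul_incr (clamp_mono s t (ψ.mono (Nat.le_succ i))) h1,
    ← integral_indicator hA']
  congr 1
  ext ω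
  by_cases hω : ω ∈ A
  · simp only [Set.indicator_of_mem hω]; rfl
  · simp [Set.indicator_of_notMem hω]

/-- A Wiener integral over `(0, t]` splits into a part known at time `s` that is Gaussian given
`𝓕 0`, and a part that is Gaussian given `𝓕 s`. -/
theorem IsItoIntegral.exists_gaussian_decomposition [IsProbabilityMeasure Q]
    (hB : IsBrownianMotion 𝓕 Q B) {f : ℝ → ℝ} {s t : ℝ≥0} (hst : s ≤ t)
    (hf : IsVolterraKernel f t) {I : Ω → ℝ} (hIm : Measurable I)
    (hI : IsItoIntegral 𝓕 Q B (fun u _ => f u) t I) :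
    ∃ A : Ω → ℝ, StronglyMeasurable[𝓕 s] A ∧
      GaussianGiven (𝓕 0) Q A (∫ u in Set.Ioc (0 : ℝ) s, f u ^ 2).toNNReal ∧
      GaussianGiven (𝓕 s) Q (fun ω => I ω - A ω)
        (∫ u in Set.Ioc (s : ℝ) t, f u ^ 2).toNNReal := by
  obtain ⟨ω₀⟩ : Nonempty Ω := nonempty_of_isProbabilityMeasure Q
  have hfm : Measurable (Function.uncurry fun (u : ℝ) (_ : Ω) => f u) :=
    hf.meas.comp measurable_fst
  have hlim := hI.tendsto hB hfm (hf.tendsto_eLpNorm_leftStep (𝓕 := 𝓕) (Q := Q))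
  set ψ := fun n => leftStep 𝓕 f t n with hψ
  -- Conditional expectation contracts L² and sends the step integrals up to t to those up to s, so
  -- the latter converge to `A`. This avoids assuming an integral of this kernel up to time s.
  set A := Q[I | 𝓕 s] with hA
  have hAm : StronglyMeasurable[𝓕 s] A := stronglyMeasurable_condExp
  have hAm' : StronglyMeasurable A := hAm.mono (𝓕.le s)
  have hψ2 : ∀ n u, MemLp ((ψ n).integral B u) 2 Q := fun n u =>
    (ψ n).memLp_integral hB u (by simp)
  have hlimA : Tendsto (fun n => eLpNorm ((ψ n).integral B s - A) 2 Q) atTop (𝓝 0) := by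
    refine tendsto_of_tendsto_of_tendsto_of_le_of_le tendsto_const_nhds hlim
      (fun _ => zero_le) fun n => ?_
    have e : (ψ n).integral B s - A =ᵐ[Q] Q[(ψ n).integral B t - I | 𝓕 s] := by
      have h1 := condExp_sub ((hψ2 n t).integrable (by norm_num))
        (hI.1.integrable (by norm_num)) (𝓕 s)
      filter_upwards [h1, condExp_leftStep_integral hB f hst n] with ω h1 h2
      rw [h1, Pi.sub_apply, Pi.sub_apply, h2]
    simp only
    rw [eLpNorm_congr_ae e]
    exact eLpNorm_condExp_le_eLpNorm _ (by norm_num)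
  have hlimB : Tendsto (fun n => eLpNorm ((fun ω => (ψ n).integral B t ω - (ψ n).integral B s ω) -
      fun ω => I ω - A ω) 2 Q) atTop (𝓝 0) := by
    have hsum := hlim.add hlimA
    rw [add_zero] at hsum
    refine tendsto_of_tendsto_of_tendsto_of_le_of_le tendsto_const_nhds hsum
      (fun _ => zero_le) fun n => ?_
    have e : ((fun ω => (ψ n).integral B t ω - (ψ n).integral B s ω) - fun ω => I ω - A ω) =
        (fun ω => (ψ n).integral B t ω - I ω) - ((ψ n).integral B s - A) := by
      ext ω; simp only [Pi.sub_apply]; ring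
    simp only
    rw [e]
    exact eLpNorm_sub_le ((hψ2 n t).1.sub hI.1.1) ((hψ2 n s).1.sub hAm'.aestronglyMeasurable)
      (by norm_num)
  have hnn : ∀ a b : ℝ, 0 ≤ ∫ u in Set.Ioc a b, f u ^ 2 := fun a b =>
    integral_nonneg fun u => sq_nonneg _
  refine ⟨A, hAm, gaussianGiven_of_charFun hAm'.measurable fun D hD θ => ?_,
    gaussianGiven_of_charFun (by exact hIm.sub hAm'.measurable) fun D hD θ => ?_⟩
  · rw [show (((∫ u in Set.Ioc (0 : ℝ) s, f u ^ 2).toNNReal : ℝ≥0) : ℂ) =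
      ((∫ u in Set.Ioc (0 : ℝ) s, f u ^ 2 : ℝ) : ℂ) by
        exact_mod_cast congrArg Complex.ofReal (Real.coe_toNNReal _ (hnn _ _))]
    refine setIntegral_cexp_of_tendsto hAm'.aestronglyMeasurable (fun n => (hψ2 n s).1) hlimA
      (hf.tendsto_integral_leftStep_sq (𝓕 := 𝓕) (s := 0) (NNReal.coe_le_coe.2 hst) ω₀) fun n => ?_
    have := setIntegral_cexp_leftStep hB f zero_le hst n hD θ ω₀
    simpa only [SimpleProcess.integral_zero, sub_zero] using this
  · rw [show (((∫ u in Set.Ioc (s : ℝ) t, f u ^ 2).toNNReal : ℝ≥0) : ℂ) =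
      ((∫ u in Set.Ioc (s : ℝ) t, f u ^ 2 : ℝ) : ℂ) by
        exact_mod_cast congrArg Complex.ofReal (Real.coe_toNNReal _ (hnn _ _))]
    exact setIntegral_cexp_of_tendsto (hIm.sub hAm'.measurable).aestronglyMeasurable
      (fun n => (hψ2 n t).1.sub (hψ2 n s).1) hlimB
      (hf.tendsto_integral_leftStep_sq (𝓕 := 𝓕) le_rfl ω₀)
      fun n => setIntegral_cexp_leftStep hB f hst le_rfl n hD θ ω₀

end Wiener

/-! ### Jensen's inequality for the square root, in weighted form. -/

section Jensen

/-- The tangent line inequality that encodes concavity of the square root, from (z - h)² ≥ 0. It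
remains true at 0 and ∞ with the conventions of [0, ∞], so later no positivity or finiteness of h is
needed. -/
lemma two_mul_le_sq_mul_inv_add (z h : ℝ≥0∞) : 2 * z ≤ z ^ 2 * h⁻¹ + h := by
  rcases eq_or_ne h ∞ with rfl | hh
  · simp
  rcases eq_or_ne h 0 with rfl | h0
  · rcases eq_or_ne z 0 with rfl | hz
    · simp
    · rw [ENNReal.inv_zero, ENNReal.mul_top (by positivity)]; simp
  rcases eq_or_ne z ∞ with rfl | hz
  · rw [ENNReal.top_pow (by norm_num), ENNReal.top_mul (ENNReal.inv_ne_zero.2 hh)]; simp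
  lift h to ℝ≥0 using hh
  lift z to ℝ≥0 using hz
  have hpos : 0 < h := pos_iff_ne_zero.2 (by exact_mod_cast h0)
  rw [← ENNReal.coe_inv hpos.ne']
  norm_cast
  rw [← NNReal.coe_le_coe]
  push_cast
  have hpos' : (0 : ℝ) < h := hpos
  have e : (z : ℝ) ^ 2 * (h : ℝ)⁻¹ + h - 2 * z = ((z : ℝ) - h) ^ 2 / h := by
    field_simp; ring
  have : 0 ≤ ((z : ℝ) - h) ^ 2 / h := by positivity
  linarith

lemma sq_mul_inv_le (h : ℝ≥0∞) : h ^ 2 * h⁻¹ ≤ h := by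
  rw [sq, mul_assoc]
  exact mul_le_of_le_one_right zero_le (ENNReal.mul_inv_le_one _)

lemma ofReal_sqrt_sq (x : ℝ) : ENNReal.ofReal (Real.sqrt x) ^ 2 = ENNReal.ofReal x := by
  rw [← ENNReal.ofReal_pow (Real.sqrt_nonneg _)]
  rcases le_total 0 x with h | h
  · rw [Real.sq_sqrt h]
  · rw [Real.sqrt_eq_zero_of_nonpos h, ENNReal.ofReal_of_nonpos h]; simp

lemma lintegral_indicator_one_mul {Ω : Type*} {m : MeasurableSpace Ω} {Q : Measure Ω} {A : Set Ω}
    (hA : MeasurableSet A) (f : Ω → ℝ≥0∞) :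
    ∫⁻ ω, A.indicator 1 ω * f ω ∂Q = ∫⁻ ω in A, f ω ∂Q := by
  rw [← lintegral_indicator hA]
  congr 1
  ext ω
  by_cases h : ω ∈ A <;> simp [h]

/-- Two densities with the same integrals over `𝒢`-measurable events have the same integrals
against `𝒢`-measurable weights. -/
lemma lintegral_mul_eq_of_forall_setLIntegral {Ω : Type*} {𝒢 m : MeasurableSpace Ω}
    {Q : Measure Ω} (h𝒢 : 𝒢 ≤ m) {f g : Ω → ℝ≥0∞} (hf : AEMeasurable f Q) (hg : AEMeasurable g Q)
    (h : ∀ A, MeasurableSet[𝒢] A → ∫⁻ ω in A, f ω ∂Q = ∫⁻ ω in A, g ω ∂Q)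
    {F : Ω → ℝ≥0∞} (hF : Measurable[𝒢] F) :
    ∫⁻ ω, F ω * f ω ∂Q = ∫⁻ ω, F ω * g ω ∂Q := by
  -- The two densities define the same measure on `𝒢`, and the weight sees nothing finer.
  have e : (Q.withDensity f).trim h𝒢 = (Q.withDensity g).trim h𝒢 := by
    refine @Measure.ext _ 𝒢 _ _ fun A hA => ?_
    rw [trim_measurableSet_eq h𝒢 hA, trim_measurableSet_eq h𝒢 hA,
      withDensity_apply _ (h𝒢 _ hA), withDensity_apply _ (h𝒢 _ hA), h A hA]
  have key : ∀ {k : Ω → ℝ≥0∞}, AEMeasurable k Q →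
      ∫⁻ ω, F ω * k ω ∂Q = @lintegral Ω 𝒢 ((Q.withDensity k).trim h𝒢) F := by
    intro k hk
    rw [lintegral_trim h𝒢 hF, lintegral_withDensity_eq_lintegral_mul₀ hk
      (hF.mono h𝒢 le_rfl).aemeasurable]
    simp only [Pi.mul_apply, mul_comm]
  rw [key hf, key hg, e]

/-- Jensen's inequality for the square root, applied to an average over time of conditional
expectations. -/
lemma setLIntegral_lintegral_le_of_sqrt {Ω : Type*} {𝒢₀ 𝒢 m : MeasurableSpace Ω}
    {Q : Measure Ω} [SFinite Q] (h₀ : 𝒢₀ ≤ 𝒢) (h𝒢 : 𝒢 ≤ m) {μ : Measure ℝ} [SFinite μ]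
    {V g : ℝ → Ω → ℝ≥0∞} (hV : Measurable (Function.uncurry V))
    (hg : Measurable (Function.uncurry g)) {h : Ω → ℝ≥0∞} (hh : Measurable[𝒢] h)
    (hz : ∀ᵐ t ∂μ, ∃ z : Ω → ℝ≥0∞, Measurable[𝒢] z ∧
      (∀ F, Measurable[𝒢] F → ∫⁻ ω, F ω * V t ω ∂Q = ∫⁻ ω, F ω * z ω ^ 2 ∂Q) ∧
      ∀ A, MeasurableSet[𝒢₀] A → ∫⁻ ω in A, z ω ∂Q = ∫⁻ ω in A, g t ω ∂Q)
    (hVh : ∀ F, Measurable[𝒢] F → ∫⁻ ω, F ω * ∫⁻ t, V t ω ∂μ ∂Q =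
      μ Set.univ * ∫⁻ ω, F ω * h ω ^ 2 ∂Q)
    {A : Set Ω} (hA : MeasurableSet[𝒢₀] A) :
    ∫⁻ ω in A, ∫⁻ t, g t ω ∂μ ∂Q ≤ μ Set.univ * ∫⁻ ω in A, h ω ∂Q := by
  have hA𝒢 : MeasurableSet[𝒢] A := h₀ _ hA
  have hAm : MeasurableSet A := h𝒢 _ hA𝒢
  have hhm : Measurable h := hh.mono h𝒢 le_rfl
  -- The weight 1/h is the one for which the tangent inequality is taken at z = h, so nothing is
  -- lost in averaging over t.
  set F : Ω → ℝ≥0∞ := A.indicator fun ω => (h ω)⁻¹ with hF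
  have hF𝒢 : Measurable[𝒢] F := hh.inv.indicator hA𝒢
  have hFm : Measurable F := hF𝒢.mono h𝒢 le_rfl
  -- `z` is eliminated at each fixed t in favour of `V` and `g`; only these two must be jointly
  -- measurable when t is integrated.
  have hpt : ∀ᵐ t ∂μ, 2 * ∫⁻ ω in A, g t ω ∂Q ≤
      ∫⁻ ω, F ω * V t ω ∂Q + ∫⁻ ω in A, h ω ∂Q := by
    filter_upwards [hz] with t ⟨z, hzm, hz1, hz2⟩
    have hzm' : Measurable z := hzm.mono h𝒢 le_rfl
    rw [← hz2 A hA, hz1 F hF𝒢, ← lintegral_const_mul _ hzm']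
    have e : ∫⁻ ω, F ω * z ω ^ 2 ∂Q = ∫⁻ ω in A, z ω ^ 2 * (h ω)⁻¹ ∂Q := by
      rw [← lintegral_indicator hAm]
      congr 1
      ext ω
      by_cases hω : ω ∈ A <;> simp [hF, hω, mul_comm]
    rw [e, ← lintegral_add_right _ hhm]
    exact lintegral_mono fun ω => two_mul_le_sq_mul_inv_add _ _
  have hint : 2 * ∫⁻ t, ∫⁻ ω in A, g t ω ∂Q ∂μ ≤
      ∫⁻ t, ∫⁻ ω, F ω * V t ω ∂Q ∂μ + μ Set.univ * ∫⁻ ω in A, h ω ∂Q := by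
    rw [← lintegral_const_mul _ (by exact hg.lintegral_prod_right')]
    refine (lintegral_mono_ae hpt).trans (le_of_eq ?_)
    rw [lintegral_add_right _ measurable_const, lintegral_const, mul_comm (μ Set.univ)]
  have hsw : ∫⁻ t, ∫⁻ ω, F ω * V t ω ∂Q ∂μ ≤ μ Set.univ * ∫⁻ ω in A, h ω ∂Q := by
    rw [lintegral_lintegral_swap (by
      exact ((hFm.comp measurable_snd).mul hV).aemeasurable)]
    have : ∀ ω, ∫⁻ t, F ω * V t ω ∂μ = F ω * ∫⁻ t, V t ω ∂μ := fun ω =>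
      lintegral_const_mul _ (hV.comp measurable_prodMk_right)
    simp_rw [this]
    rw [hVh F hF𝒢, ← lintegral_indicator hAm]
    gcongr with ω
    by_cases hω : ω ∈ A
    · simpa [hF, hω, mul_comm] using sq_mul_inv_le (h ω)
    · simp [hF, hω]
  rw [lintegral_lintegral_swap (by exact (hg.comp measurable_swap).aemeasurable)]
  have h2 := hint.trans (add_le_add_left hsw _)
  rw [← two_mul] at h2
  exact (ENNReal.mul_le_mul_iff_right (by norm_num) (by norm_num)).1 h2

/-- Conditional Jensen for the square root: the hypothesis says that h² has conditional expectation
k², and the tangent inequality is integrated with weight 1/k on the event. -/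
lemma setLIntegral_le_of_sq {Ω : Type*} {𝒢₀ m : MeasurableSpace Ω}
    {Q : Measure Ω} (h₀ : 𝒢₀ ≤ m) {h k : Ω → ℝ≥0∞} (hh : Measurable h) (hk : Measurable[𝒢₀] k)
    (hhk : ∀ F, Measurable[𝒢₀] F → ∫⁻ ω, F ω * h ω ^ 2 ∂Q = ∫⁻ ω, F ω * k ω ^ 2 ∂Q)
    {A : Set Ω} (hA : MeasurableSet[𝒢₀] A) :
    ∫⁻ ω in A, h ω ∂Q ≤ ∫⁻ ω in A, k ω ∂Q := by
  have hAm : MeasurableSet A := h₀ _ hA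
  have hkm : Measurable k := hk.mono h₀ le_rfl
  set F : Ω → ℝ≥0∞ := A.indicator fun ω => (k ω)⁻¹ with hF
  have hF₀ : Measurable[𝒢₀] F := hk.inv.indicator hA
  have e : ∀ x : Ω → ℝ≥0∞, ∫⁻ ω, F ω * x ω ^ 2 ∂Q = ∫⁻ ω in A, x ω ^ 2 * (k ω)⁻¹ ∂Q := by
    intro x
    rw [← lintegral_indicator hAm]
    congr 1
    ext ω
    by_cases hω : ω ∈ A <;> simp [hF, hω, mul_comm]
  have h1 : 2 * ∫⁻ ω in A, h ω ∂Q ≤ ∫⁻ ω in A, k ω ∂Q + ∫⁻ ω in A, k ω ∂Q := by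
    rw [← lintegral_const_mul _ hh]
    refine (lintegral_mono fun ω => two_mul_le_sq_mul_inv_add (h ω) (k ω)).trans ?_
    rw [lintegral_add_right _ hkm, ← e, hhk F hF₀, e]
    gcongr with ω
    exact sq_mul_inv_le _
  rw [← two_mul] at h1
  exact (ENNReal.mul_le_mul_iff_right (by norm_num) (by norm_num)).1 h1

lemma setIntegral_le_of_setLIntegral_le {Ω : Type*} {m : MeasurableSpace Ω}
    {Q : Measure Ω} {U W : Ω → ℝ} (hU : AEStronglyMeasurable U Q) (hU0 : 0 ≤ᵐ[Q] U)
    (hW : Integrable W Q) (hW0 : 0 ≤ᵐ[Q] W) {A : Set Ω}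
    (h : ∫⁻ ω in A, ENNReal.ofReal (U ω) ∂Q ≤ ∫⁻ ω in A, ENNReal.ofReal (W ω) ∂Q) :
    ∫ ω in A, U ω ∂Q ≤ ∫ ω in A, W ω ∂Q := by
  rw [integral_eq_lintegral_of_nonneg_ae (ae_restrict_of_ae hU0) hU.restrict,
    integral_eq_lintegral_of_nonneg_ae (ae_restrict_of_ae hW0) hW.1.restrict]
  refine ENNReal.toReal_mono ?_ h
  rw [← ofReal_integral_eq_lintegral_ofReal hW.restrict (ae_restrict_of_ae hW0)]
  exact ENNReal.ofReal_ne_top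

lemma ae_le_of_forall_setIntegral_le_of_stronglyMeasurable {Ω : Type*} {𝒢 m : MeasurableSpace Ω}
    {Q : Measure Ω} [IsFiniteMeasure Q] (h𝒢 : 𝒢 ≤ m) {U W : Ω → ℝ}
    (hU : Integrable U Q) (hW : Integrable W Q) (hUm : StronglyMeasurable[𝒢] U)
    (hWm : StronglyMeasurable[𝒢] W)
    (h : ∀ A, MeasurableSet[𝒢] A → ∫ ω in A, U ω ∂Q ≤ ∫ ω in A, W ω ∂Q) : U ≤ᵐ[Q] W := by
  refine ae_le_of_ae_le_trim (hm := h𝒢) (ae_le_of_forall_setIntegral_le (hU.trim h𝒢 hUm)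
    (hW.trim h𝒢 hWm) fun A hA _ => ?_)
  rw [← setIntegral_trim h𝒢 hUm hA, ← setIntegral_trim h𝒢 hWm hA]
  exact h A hA

lemma le_condExp_of_setLIntegral_le {Ω : Type*} {𝒢 m : MeasurableSpace Ω}
    {Q : Measure Ω} [IsFiniteMeasure Q] (h𝒢 : 𝒢 ≤ m) {U W : Ω → ℝ}
    (hUm : StronglyMeasurable[𝒢] U) (hU0 : 0 ≤ᵐ[Q] U) (hW : Integrable W Q) (hW0 : 0 ≤ᵐ[Q] W)
    (h : ∀ A, MeasurableSet[𝒢] A →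
      ∫⁻ ω in A, ENNReal.ofReal (U ω) ∂Q ≤ ∫⁻ ω in A, ENNReal.ofReal (W ω) ∂Q) :
    U ≤ᵐ[Q] Q[W | 𝒢] := by
  have hUm' := (hUm.mono h𝒢).aestronglyMeasurable (μ := Q)
  -- The comparison on the full space already bounds the integral of `U`.
  have hU : Integrable U Q := by
    refine ⟨hUm', ?_⟩
    rw [hasFiniteIntegral_iff_ofReal hU0]
    have h1 := h Set.univ MeasurableSet.univ
    rw [Measure.restrict_univ] at h1
    exact h1.trans_lt ((hasFiniteIntegral_iff_ofReal hW0).1 hW.2)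
  refine ae_le_of_forall_setIntegral_le_of_stronglyMeasurable h𝒢 hU integrable_condExp hUm
    stronglyMeasurable_condExp fun A hA => ?_
  rw [setIntegral_condExp h𝒢 hW hA]
  exact setIntegral_le_of_setLIntegral_le hUm' hU0 hW hW0 (h A hA)

lemma condExp_le_of_setLIntegral_le {Ω : Type*} {𝒢 m : MeasurableSpace Ω}
    {Q : Measure Ω} [IsFiniteMeasure Q] (h𝒢 : 𝒢 ≤ m) {U W : Ω → ℝ}
    (hUm : StronglyMeasurable[𝒢] U) (hU0 : 0 ≤ᵐ[Q] U) (hU : Integrable U Q)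
    (hW : Integrable W Q) (hW0 : 0 ≤ᵐ[Q] W)
    (h : ∀ A, MeasurableSet[𝒢] A →
      ∫⁻ ω in A, ENNReal.ofReal (W ω) ∂Q ≤ ∫⁻ ω in A, ENNReal.ofReal (U ω) ∂Q) :
    Q[W | 𝒢] ≤ᵐ[Q] U := by
  refine ae_le_of_forall_setIntegral_le_of_stronglyMeasurable h𝒢 integrable_condExp hU
    stronglyMeasurable_condExp hUm fun A hA => ?_
  rw [setIntegral_condExp h𝒢 hW hA]
  exact setIntegral_le_of_setLIntegral_le hW.1 hW0 hU hU0 (h A hA)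

lemma integrable_sqrt {Ω : Type*} {m : MeasurableSpace Ω} {Q : Measure Ω} [IsFiniteMeasure Q]
    {f : Ω → ℝ} (hf : Integrable f Q) : Integrable (fun ω => Real.sqrt (f ω)) Q := by
  refine ((integrable_const 1).add hf.abs).mono'
    (Real.continuous_sqrt.comp_aestronglyMeasurable hf.1) (Eventually.of_forall fun ω => ?_)
  rw [Real.norm_eq_abs, abs_of_nonneg (Real.sqrt_nonneg _)]
  refine (Real.sqrt_le_sqrt (le_abs_self _)).trans ?_
  simp only [Pi.add_apply]
  rw [Real.sqrt_le_left (by positivity)]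
  nlinarith [abs_nonneg (f ω)]

/-- Needs no integrability: if the right-hand side is infinite, the Bochner integral takes its
default value 0. -/
lemma ofReal_integral_le_lintegral {α : Type*} {_ : MeasurableSpace α} {μ : Measure α}
    {f : α → ℝ} (hf : AEStronglyMeasurable f μ) (hf0 : 0 ≤ᵐ[μ] f) :
    ENNReal.ofReal (∫ x, f x ∂μ) ≤ ∫⁻ x, ENNReal.ofReal (f x) ∂μ := by
  rw [integral_eq_lintegral_of_nonneg_ae hf0 hf]
  exact ENNReal.ofReal_toReal_le

end Jensen

/-! ### The power-law kernel. -/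

section Kernel

variable {H : ℝ}

lemma kernel_sq {t u : ℝ} (hut : u ≤ t) : kernel H t u ^ 2 = (t - u) ^ (2 * H - 1) := by
  unfold kernel
  rw [← Real.rpow_natCast, ← Real.rpow_mul (sub_nonneg.2 hut)]
  congr 1
  push_cast
  ring

lemma intervalIntegrable_sub_rpow (hH : 0 < H) (t a b : ℝ) :
    IntervalIntegrable (fun u => (t - u) ^ (2 * H - 1)) volume a b := by
  have := (intervalIntegral.intervalIntegrable_rpow' (a := t - a) (b := t - b)
    (r := 2 * H - 1) (by linarith)).comp_sub_left t
  simpa using this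

lemma setIntegral_kernel_sq (hH : 0 < H) {a b t : ℝ} (hab : a ≤ b) (hbt : b ≤ t) :
    ∫ u in Set.Ioc a b, kernel H t u ^ 2 =
      ((t - a) ^ (2 * H) - (t - b) ^ (2 * H)) / (2 * H) := by
  have e : ∀ u ∈ Set.Ioc a b, kernel H t u ^ 2 = (t - u) ^ (2 * H - 1) :=
    fun u hu => kernel_sq (hu.2.trans hbt)
  rw [setIntegral_congr_fun measurableSet_Ioc e, ← intervalIntegral.integral_of_le hab,
    intervalIntegral.integral_comp_sub_left (fun x => x ^ (2 * H - 1)) t,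
    integral_rpow (Or.inl (by linarith))]
  simp

/-- H < 1/2 makes the exponent negative, so the kernel increases towards its singularity; H > 0
makes the squared exponent 2H - 1 exceed -1, so the square is integrable. -/
lemma isVolterraKernel_kernel (hH : 0 < H) (hH2 : H < 1 / 2) (t : ℝ≥0) :
    IsVolterraKernel (kernel H t) t where
  meas := by unfold kernel; fun_prop
  nonneg u hu := Real.rpow_nonneg (sub_nonneg.2 hu.2.le) _
  mono u hu v hv huv := Real.rpow_le_rpow_of_nonpos (sub_pos.2 hv.2) (by linarith) (by linarith)
  cont u hu := by
    unfold kernel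
    exact ((continuousWithinAt_const.sub continuousWithinAt_id).rpow_const
      (Or.inl (sub_pos.2 hu.2).ne'))
  int := by
    have e : Set.EqOn (fun u => (t - u : ℝ) ^ (2 * H - 1)) (fun u => kernel H t u ^ 2)
        (Set.Ioc (0 : ℝ) t) := fun u hu => (kernel_sq hu.2).symm
    exact ((intervalIntegrable_iff_integrableOn_Ioc_of_le t.coe_nonneg).1
      (intervalIntegrable_sub_rpow hH t 0 t)).congr_fun e measurableSet_Ioc

end Kernel

/-! ### Forward variances and quadratic variation in the rough Bergomi model. -/

section Model

lemma measurable_section {Ω : Type*} {mΩ : MeasurableSpace Ω} {ξ : ℝ → Ω → ℝ}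
    (hξ : Measurable (Function.uncurry ξ)) (t : ℝ) : Measurable (ξ t) :=
  hξ.comp measurable_prodMk_left

lemma stronglyMeasurable_setIntegral_time {Ω : Type*} {mΩ : MeasurableSpace Ω} {ξ : ℝ → Ω → ℝ}
    (hξ : Measurable (Function.uncurry ξ)) (S : Set ℝ) :
    StronglyMeasurable fun ω => ∫ t in S, ξ t ω :=
  StronglyMeasurable.integral_prod_left (μ := volume.restrict S) hξ.stronglyMeasurable

lemma measurable_sqrt_mul {Ω : Type*} {mΩ : MeasurableSpace Ω} {ξ : ℝ → Ω → ℝ}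
    (hξ : Measurable (Function.uncurry ξ)) {f : ℝ → ℝ} (hf : Measurable f) :
    Measurable (Function.uncurry fun t ω => Real.sqrt (ξ t ω) * f t) :=
  (hξ.sqrt).mul (hf.comp measurable_fst)

/-- The instantaneous variance with the compensator of the exponential in closed form. -/
noncomputable def explicitVar {Ω : Type*} (H ν : ℝ) (ξ₀ 𝒱 : ℝ → Ω → ℝ) (t : ℝ) (ω : Ω) : ℝ :=
  ξ₀ t ω * Real.exp (2 * ν * constC H * 𝒱 t ω
    - (2 * ν * constC H) ^ 2 / 2 * (t ^ (2 * H) / (2 * H)))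

lemma instVar_eq_explicitVar {Ω : Type*} {H ν : ℝ} (hH : 0 < H) {ξ₀ 𝒱 : ℝ → Ω → ℝ} {t : ℝ}
    (ht : 0 ≤ t) (ω : Ω) : instVar H ν ξ₀ 𝒱 t ω = explicitVar H ν ξ₀ 𝒱 t ω := by
  unfold instVar explicitVar
  rw [intervalIntegral.integral_of_le ht, setIntegral_kernel_sq hH ht le_rfl, sub_zero, sub_self,
    Real.zero_rpow (by positivity), sub_zero]

variable {Ω : Type*} {m : MeasurableSpace Ω} {Q : Measure Ω} {𝓕 : Filtration ℝ≥0 m}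
  {H ν ρ : ℝ} {ξ₀ : ℝ → Ω → ℝ} {W Z : ℝ≥0 → Ω → ℝ} {𝒱 : ℝ → Ω → ℝ} {X : ℝ≥0 → Ω → ℝ}

lemma IsRoughBergomi.measurable_curve (h : IsRoughBergomi 𝓕 Q H ν ρ ξ₀ W Z 𝒱 X) :
    Measurable (Function.uncurry ξ₀) := by
  have hle : @Prod.instMeasurableSpace ℝ Ω _ (𝓕 0) ≤ @Prod.instMeasurableSpace ℝ Ω _ m :=
    sup_le_sup le_rfl (MeasurableSpace.comap_mono (𝓕.le 0))
  exact h.curve_meas.mono hle le_rfl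

lemma IsRoughBergomi.measurable_explicitVar (h : IsRoughBergomi 𝓕 Q H ν ρ ξ₀ W Z 𝒱 X) :
    Measurable (Function.uncurry (explicitVar H ν ξ₀ 𝒱)) := by
  have h1 := h.measurable_curve
  have h2 := h.volterra_meas
  have h3 : Measurable fun p : ℝ × Ω => (2 * ν * constC H) ^ 2 / 2 * (p.1 ^ (2 * H) / (2 * H)) := by
    fun_prop
  exact h1.mul ((h2.const_mul _).sub h3).exp

lemma IsRoughBergomi.explicitVar_nonneg (h : IsRoughBergomi 𝓕 Q H ν ρ ξ₀ W Z 𝒱 X) {t : ℝ}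
    (ht : 0 ≤ t) (ω : Ω) : 0 ≤ explicitVar H ν ξ₀ 𝒱 t ω :=
  mul_nonneg (h.curve_pos t ω ht).le (Real.exp_pos _).le

lemma toNNReal_setIntegral_kernel_sq (hH : 0 < H) {a b t : ℝ} (hab : a ≤ b) (hbt : b ≤ t) :
    ((∫ u in Set.Ioc a b, kernel H t u ^ 2).toNNReal : ℝ) =
      ((t - a) ^ (2 * H) - (t - b) ^ (2 * H)) / (2 * H) := by
  rw [Real.coe_toNNReal _ (integral_nonneg fun u => sq_nonneg _), setIntegral_kernel_sq hH hab hbt]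

/-- The forward variance `Y` at time `s` of the instantaneous variance at time `t`. -/
theorem IsRoughBergomi.exists_forwardVar [IsProbabilityMeasure Q]
    (h : IsRoughBergomi 𝓕 Q H ν ρ ξ₀ W Z 𝒱 X) {s t : ℝ≥0} (hst : s ≤ t) :
    ∃ Y : Ω → ℝ, Measurable[𝓕 s] Y ∧
      (∀ F, Measurable[𝓕 s] F → ∫⁻ ω, F ω * ENNReal.ofReal (explicitVar H ν ξ₀ 𝒱 t ω) ∂Q =
        ∫⁻ ω, F ω * ENNReal.ofReal (Y ω) ∂Q) ∧
      (∀ G, Measurable[𝓕 0] G → ∫⁻ ω, G ω * ENNReal.ofReal (Real.sqrt (Y ω)) ∂Q =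
        ∫⁻ ω, G ω * ENNReal.ofReal (Real.sqrt (ξ₀ t ω) * Real.exp (ν ^ 2 * constC H ^ 2 / (4 * H) *
            (((t : ℝ) - s) ^ (2 * H) - (t : ℝ) ^ (2 * H)))) ∂Q) ∧
      (∀ G, Measurable[𝓕 0] G → ∫⁻ ω, G ω * ENNReal.ofReal (Y ω) ∂Q =
        ∫⁻ ω, G ω * ENNReal.ofReal (ξ₀ t ω) ∂Q) := by
  have hH := h.hurst.1
  have hst' : (s : ℝ) ≤ t := NNReal.coe_le_coe.2 hst
  have h𝒱 : Measurable (𝒱 t) := measurable_section h.volterra_meas t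
  obtain ⟨A, hA, hA0, hAs⟩ := (h.volterra t).exists_gaussian_decomposition h.brownian_Z hst
    (isVolterraKernel_kernel hH h.hurst.2 t) h𝒱
  have hAm : Measurable A := (hA.mono (𝓕.le s)).measurable
  have hξ0 : Measurable[𝓕 0] (ξ₀ t) := measurable_section h.curve_meas t
  have hξs : Measurable[𝓕 s] (ξ₀ t) := hξ0.mono (𝓕.mono zero_le) le_rfl
  have hξpos : ∀ ω, 0 ≤ ξ₀ t ω := fun ω => (h.curve_pos t ω t.coe_nonneg).le
  set c := 2 * ν * constC H with hc
  have hv1 := toNNReal_setIntegral_kernel_sq hH s.coe_nonneg hst'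
  have hv2 := toNNReal_setIntegral_kernel_sq hH hst' (le_refl (t : ℝ))
  rw [sub_zero] at hv1
  rw [sub_self, Real.zero_rpow (by positivity), sub_zero] at hv2
  set v1 := (∫ u in Set.Ioc (0 : ℝ) s, kernel H t u ^ 2).toNNReal
  set v2 := (∫ u in Set.Ioc (s : ℝ) t, kernel H t u ^ 2).toNNReal
  -- The compensator splits like the Gaussian: v1 belongs to what is known at time s, v2 to the
  -- future.
  have hv : (t : ℝ) ^ (2 * H) / (2 * H) = v1 + v2 := by rw [hv1, hv2]; ring
  have hprod : ∀ {x y : ℝ}, 0 ≤ x → ENNReal.ofReal (x * Real.exp y) =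
      ENNReal.ofReal x * ENNReal.ofReal (Real.exp y) := fun hx => ENNReal.ofReal_mul hx
  have hcancel : ∀ x : ℝ, ENNReal.ofReal (Real.exp x) * ENNReal.ofReal (Real.exp (-x)) = 1 := by
    intro x
    rw [← ENNReal.ofReal_mul (Real.exp_pos _).le, ← Real.exp_add]; simp
  have hAexp : ∀ (G : Ω → ℝ≥0∞), Measurable[𝓕 0] G → ∀ (a b : ℝ),
      ∫⁻ ω, G ω * ENNReal.ofReal (Real.exp (a * A ω - b)) ∂Q =
        ∫⁻ ω, G ω * ENNReal.ofReal (Real.exp (v1 * a ^ 2 / 2 - b)) ∂Q := by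
    intro G hG a b
    have hGm : Measurable G := hG.mono (𝓕.le 0) le_rfl
    have e : ∀ x : ℝ, ENNReal.ofReal (Real.exp (x - b)) =
        ENNReal.ofReal (Real.exp x) * ENNReal.ofReal (Real.exp (-b)) := fun x => by
      rw [sub_eq_add_neg, Real.exp_add, hprod (Real.exp_pos _).le]
    simp_rw [e, ← mul_assoc]
    rw [lintegral_mul_const _ (by fun_prop), hA0.lintegral_mul_exp (𝓕.le 0) hAm hG,
      lintegral_mul_const _ (by fun_prop), lintegral_mul_const _ hGm]
  -- The future factor exp(c(𝒱 - A)) has conditional mean exp(v2 c²/2), which the remaining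
  -- compensator cancels.
  refine ⟨fun ω => ξ₀ t ω * Real.exp (c * A ω - c ^ 2 / 2 * v1), ?_, fun F hF => ?_,
    fun G hG => ?_, fun G hG => ?_⟩
  · exact hξs.mul (((hA.measurable.const_mul c).sub_const _).exp)
  · have e : ∀ ω, F ω * ENNReal.ofReal (explicitVar H ν ξ₀ 𝒱 t ω) =
        F ω * ENNReal.ofReal (ξ₀ t ω * Real.exp (c * A ω - c ^ 2 / 2 * v1)) *
          ENNReal.ofReal (Real.exp (c * (𝒱 t ω - A ω))) *
          ENNReal.ofReal (Real.exp (-(v2 * c ^ 2 / 2))) := by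
      intro ω
      rw [mul_assoc, mul_assoc, ← ENNReal.ofReal_mul (Real.exp_pos _).le, ← Real.exp_add,
        ← ENNReal.ofReal_mul (mul_nonneg (hξpos ω) (Real.exp_pos _).le), mul_assoc, ← Real.exp_add]
      unfold explicitVar
      rw [← hc, hv]
      congr 4
      ring
    simp_rw [e]
    have hFY : Measurable[𝓕 s] fun ω =>
        F ω * ENNReal.ofReal (ξ₀ t ω * Real.exp (c * A ω - c ^ 2 / 2 * v1)) :=
      hF.mul (hξs.mul (((hA.measurable.const_mul c).sub_const _).exp)).ennreal_ofReal
    have hFYm := hFY.mono (𝓕.le s) le_rfl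
    rw [lintegral_mul_const _ (by fun_prop),
      hAs.lintegral_mul_exp (𝓕.le s) (h𝒱.sub hAm) hFY, mul_assoc, hcancel, mul_one]
  · have e : ∀ ω, G ω * ENNReal.ofReal (Real.sqrt (ξ₀ t ω *
        Real.exp (c * A ω - c ^ 2 / 2 * v1))) = G ω * ENNReal.ofReal (Real.sqrt (ξ₀ t ω)) *
        ENNReal.ofReal (Real.exp (c / 2 * A ω - c ^ 2 / 4 * v1)) := by
      intro ω
      rw [Real.sqrt_mul (hξpos ω), ← Real.exp_half, hprod (Real.sqrt_nonneg _), mul_assoc (G ω),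
        show (c * A ω - c ^ 2 / 2 * v1) / 2 = c / 2 * A ω - c ^ 2 / 4 * v1 by ring]
    simp_rw [e]
    rw [hAexp (fun ω => G ω * ENNReal.ofReal (Real.sqrt (ξ₀ t ω)))
      (hG.mul hξ0.sqrt.ennreal_ofReal)]
    congr 1
    ext ω
    rw [hprod (Real.sqrt_nonneg _), mul_assoc (G ω), hv1]
    -- The square root halves c, so the Gaussian contributes v1 c²/8 against a halved compensator v1
    -- c²/4: the net exponent is -v1 c²/8.
    have e2 : (t ^ (2 * H) - (t - s) ^ (2 * H)) / (2 * H) * (c / 2) ^ 2 / 2 -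
        c ^ 2 / 4 * ((t ^ (2 * H) - (t - s) ^ (2 * H)) / (2 * H)) =
        ν ^ 2 * constC H ^ 2 / (4 * H) * (((t : ℝ) - s) ^ (2 * H) - (t : ℝ) ^ (2 * H)) := by
      rw [hc]
      field_simp
      ring
    rw [e2]
  · simp_rw [fun ω => hprod (y := c * A ω - c ^ 2 / 2 * v1) (hξpos ω), ← mul_assoc]
    rw [hAexp (fun ω => G ω * ENNReal.ofReal (ξ₀ t ω)) (hG.mul hξ0.ennreal_ofReal)]
    have : (v1 : ℝ) * c ^ 2 / 2 - c ^ 2 / 2 * v1 = 0 := by ring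
    simp [this]

lemma IsRoughBergomi.lintegral_mul_explicitVar [IsProbabilityMeasure Q]
    (h : IsRoughBergomi 𝓕 Q H ν ρ ξ₀ W Z 𝒱 X) {t : ℝ} (ht : 0 ≤ t) {F : Ω → ℝ≥0∞}
    (hF : Measurable[𝓕 0] F) : ∫⁻ ω, F ω * ENNReal.ofReal (explicitVar H ν ξ₀ 𝒱 t ω) ∂Q =
      ∫⁻ ω, F ω * ENNReal.ofReal (ξ₀ t ω) ∂Q := by
  lift t to ℝ≥0 using ht
  obtain ⟨Y, -, h1, -, h2⟩ := h.exists_forwardVar (zero_le : 0 ≤ t)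
  rw [h1 F hF, h2 F hF]

lemma ae_mem_Ioc {s t : ℝ} : ∀ᵐ u ∂(volume.restrict (Set.Ioc s t)), u ∈ Set.Ioc s t :=
  ae_restrict_mem measurableSet_Ioc

/-- By Tonelli: the stochastic exponential has mean one given 𝓕 0, so the variance and the initial
curve have the same integral over the strip. -/
lemma IsRoughBergomi.integrable_explicitVar [IsProbabilityMeasure Q]
    (h : IsRoughBergomi 𝓕 Q H ν ρ ξ₀ W Z 𝒱 X) {a : ℝ} (ha : 0 ≤ a) (b : ℝ) :
    Integrable (fun p : ℝ × Ω => explicitVar H ν ξ₀ 𝒱 p.1 p.2) (stripMeasure Q a b) := by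
  have hVm := h.measurable_explicitVar
  rcases le_or_gt b 0 with hb | hb
  · have : stripMeasure Q a b = 0 := by
      unfold stripMeasure
      rw [Set.Ioc_eq_empty (not_lt.2 (hb.trans ha)), Measure.restrict_empty, Measure.zero_prod]
    rw [this]
    exact integrable_zero_measure
  refine Integrable.mono_measure ?_ (stripMeasure_mono ha le_rfl)
  have hpos : 0 ≤ᵐ[stripMeasure Q 0 b] fun p : ℝ × Ω => explicitVar H ν ξ₀ 𝒱 p.1 p.2 :=
    ae_strip_of_forall fun u hu ω => h.explicitVar_nonneg hu.1.le ω
  have hpos' : 0 ≤ᵐ[stripMeasure Q 0 b] fun p : ℝ × Ω => ξ₀ p.1 p.2 :=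
    ae_strip_of_forall fun u hu ω => (h.curve_pos u ω hu.1.le).le
  refine ⟨Measurable.aestronglyMeasurable hVm, ?_⟩
  rw [hasFiniteIntegral_iff_ofReal hpos]
  have hξ := (hasFiniteIntegral_iff_ofReal hpos').1 (h.curve_int b hb.le).2
  refine lt_of_eq_of_lt ?_ hξ
  unfold stripMeasure
  rw [lintegral_prod _ (by exact hVm.ennreal_ofReal.aemeasurable),
    lintegral_prod _ (by exact h.measurable_curve.ennreal_ofReal.aemeasurable)]
  refine lintegral_congr_ae ?_
  filter_upwards [ae_mem_Ioc] with t ht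
  have := h.lintegral_mul_explicitVar ht.1.le (F := fun _ => 1) measurable_const
  simpa using this

/-- The quadratic variation of the log-price is the integrated variance. -/
theorem IsRoughBergomi.hasQuadVar [IsProbabilityMeasure Q]
    (h : IsRoughBergomi 𝓕 Q H ν ρ ξ₀ W Z 𝒱 X) (t : ℝ≥0) :
    HasQuadVar Q X t (fun ω => ∫ u in Set.Ioc (0 : ℝ) t, explicitVar H ν ξ₀ 𝒱 u ω) := by
  choose M hM hXM using h.log_price
  have hM' : ∀ u, IsItoIntegral 𝓕 Q W
      (fun u ω => Real.sqrt (explicitVar H ν ξ₀ 𝒱 u ω)) u (M u) := fun u =>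
    (hM u).congr fun v hv ω => by rw [instVar_eq_explicitVar h.hurst.1 hv.1.le]
  have hφ : Measurable (Function.uncurry fun u ω => Real.sqrt (explicitVar H ν ξ₀ 𝒱 u ω)) :=
    h.measurable_explicitVar.sqrt
  have hX : ∀ u : ℝ≥0, X u =ᵐ[Q] fun ω =>
      (∫ v in (0 : ℝ)..u, -(1 / 2) * explicitVar H ν ξ₀ 𝒱 v ω) + M u ω := by
    intro u
    filter_upwards [hXM u] with ω hω
    rw [hω, intervalIntegral.integral_const_mul]
    congr 2
    refine intervalIntegral.integral_congr fun v hv => ?_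
    rw [Set.uIcc_of_le u.coe_nonneg] at hv
    exact instVar_eq_explicitVar h.hurst.1 hv.1 ω
  have key := hasQuadVar_of_ito h.brownian_W hφ hM'
    (fun u => (h.integrable_explicitVar le_rfl u).const_mul _) hX t
  convert key using 1
  ext ω
  refine setIntegral_congr_fun measurableSet_Ioc fun u hu => ?_
  rw [Real.sq_sqrt (h.explicitVar_nonneg hu.1.le ω)]

/-- The average variance over `[T, T + Δ]`. -/
noncomputable def avgVar {Ω : Type*} (H ν : ℝ) (ξ₀ 𝒱 : ℝ → Ω → ℝ) (T Δ : ℝ≥0) (ω : Ω) : ℝ :=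
  1 / (Δ : ℝ) * ∫ t in Set.Ioc (T : ℝ) (T + Δ), explicitVar H ν ξ₀ 𝒱 t ω

lemma IsRoughBergomi.realizedVar_ae_eq [IsProbabilityMeasure Q]
    (h : IsRoughBergomi 𝓕 Q H ν ρ ξ₀ W Z 𝒱 X) (T Δ : ℝ≥0) :
    realizedVar Q X T Δ =ᵐ[Q] avgVar H ν ξ₀ 𝒱 T Δ := by
  filter_upwards [(h.hasQuadVar (T + Δ)).quadVar_ae_eq, (h.hasQuadVar T).quadVar_ae_eq,
    (h.integrable_explicitVar le_rfl (T + Δ)).prod_left_ae] with ω h1 h2 h3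
  unfold realizedVar avgVar
  have hle : (T : ℝ) ≤ T + Δ := le_add_of_nonneg_right Δ.coe_nonneg
  rw [h1, h2, NNReal.coe_add, ← Set.Ioc_union_Ioc_eq_Ioc T.coe_nonneg hle,
    setIntegral_union (Set.Ioc_disjoint_Ioc_of_le le_rfl) measurableSet_Ioc]
  · ring
  · exact IntegrableOn.mono_set h3 (Set.Ioc_subset_Ioc_right hle)
  · exact IntegrableOn.mono_set h3 (Set.Ioc_subset_Ioc_left T.coe_nonneg)

lemma IsRoughBergomi.integrable_avgVar [IsProbabilityMeasure Q]
    (h : IsRoughBergomi 𝓕 Q H ν ρ ξ₀ W Z 𝒱 X) (T Δ : ℝ≥0) :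
    Integrable (avgVar H ν ξ₀ 𝒱 T Δ) Q :=
  (h.integrable_explicitVar T.coe_nonneg (T + Δ)).integral_prod_right.const_mul _

lemma lintegral_eq_ofReal_average {f : ℝ → ℝ} {T Δ : ℝ≥0} (hΔ : 0 < Δ)
    (hf : IntegrableOn f (Set.Ioc (T : ℝ) (T + Δ)))
    (hf0 : ∀ t ∈ Set.Ioc (T : ℝ) (T + Δ), 0 ≤ f t) :
    ∫⁻ t in Set.Ioc (T : ℝ) (T + Δ), ENNReal.ofReal (f t) =
      Δ * ENNReal.ofReal (1 / (Δ : ℝ) * ∫ t in Set.Ioc (T : ℝ) (T + Δ), f t) := by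
  have hΔ' : (0 : ℝ) < Δ := hΔ
  rw [← ofReal_integral_eq_lintegral_ofReal hf (by
      filter_upwards [ae_mem_Ioc] with t ht using hf0 t ht),
    ← ENNReal.ofReal_coe_nnreal, ← ENNReal.ofReal_mul hΔ'.le]
  congr 1
  field_simp

end Model

/-! ### The VIX and the two bounds on its future. -/

section Bounds

/-- The defining property of conditional expectation on events extends to all weights in [0, ∞],
without integrability of the product. -/
lemma lintegral_mul_ofReal_condExp {Ω : Type*} {𝒢 m : MeasurableSpace Ω} {Q : Measure Ω}
    [IsFiniteMeasure Q] (h𝒢 : 𝒢 ≤ m) {R : Ω → ℝ} (hR : Integrable R Q) (hR0 : 0 ≤ᵐ[Q] R)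
    {F : Ω → ℝ≥0∞} (hF : Measurable[𝒢] F) :
    ∫⁻ ω, F ω * ENNReal.ofReal (R ω) ∂Q = ∫⁻ ω, F ω * ENNReal.ofReal ((Q[R | 𝒢]) ω) ∂Q := by
  have hG0 : 0 ≤ᵐ[Q] Q[R | 𝒢] := condExp_nonneg hR0
  refine lintegral_mul_eq_of_forall_setLIntegral h𝒢 hR.1.aemeasurable.ennreal_ofReal
    integrable_condExp.1.aemeasurable.ennreal_ofReal (fun A hA => ?_) hF
  rw [← ofReal_integral_eq_lintegral_ofReal hR.restrict (ae_restrict_of_ae hR0),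
    ← ofReal_integral_eq_lintegral_ofReal integrable_condExp.restrict (ae_restrict_of_ae hG0),
    setIntegral_condExp h𝒢 hR hA]

variable {Ω : Type*} {m : MeasurableSpace Ω} {Q : Measure Ω} {𝓕 : Filtration ℝ≥0 m}
  {H ν ρ : ℝ} {ξ₀ : ℝ → Ω → ℝ} {W Z : ℝ≥0 → Ω → ℝ} {𝒱 : ℝ → Ω → ℝ} {X : ℝ≥0 → Ω → ℝ}

lemma IsRoughBergomi.avgVar_nonneg (h : IsRoughBergomi 𝓕 Q H ν ρ ξ₀ W Z 𝒱 X) (T Δ : ℝ≥0) (ω : Ω) :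
    0 ≤ avgVar H ν ξ₀ 𝒱 T Δ ω :=
  mul_nonneg (by positivity) (setIntegral_nonneg measurableSet_Ioc fun t ht =>
    h.explicitVar_nonneg (T.coe_nonneg.trans ht.1.le) ω)

lemma IsRoughBergomi.integrable_realizedVar [IsProbabilityMeasure Q]
    (h : IsRoughBergomi 𝓕 Q H ν ρ ξ₀ W Z 𝒱 X) (T Δ : ℝ≥0) : Integrable (realizedVar Q X T Δ) Q :=
  (h.integrable_avgVar T Δ).congr (h.realizedVar_ae_eq T Δ).symm

lemma integrable_vix [IsProbabilityMeasure Q] (T Δ : ℝ≥0) : Integrable (vix 𝓕 Q X T Δ) Q :=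
  integrable_sqrt integrable_condExp

lemma measurable_vix (T Δ : ℝ≥0) : Measurable[𝓕 T] (vix 𝓕 Q X T Δ) :=
  (stronglyMeasurable_condExp (m := 𝓕 T)).measurable.sqrt

lemma vix_nonneg (T Δ : ℝ≥0) (ω : Ω) : 0 ≤ vix 𝓕 Q X T Δ ω := Real.sqrt_nonneg _

/-- The squared VIX is the conditional expectation of the average variance. -/
lemma IsRoughBergomi.lintegral_mul_vix_sq [IsProbabilityMeasure Q]
    (h : IsRoughBergomi 𝓕 Q H ν ρ ξ₀ W Z 𝒱 X) (T Δ : ℝ≥0) {F : Ω → ℝ≥0∞} (hF : Measurable[𝓕 T] F) :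
    ∫⁻ ω, F ω * ENNReal.ofReal (vix 𝓕 Q X T Δ ω) ^ 2 ∂Q =
      ∫⁻ ω, F ω * ENNReal.ofReal (avgVar H ν ξ₀ 𝒱 T Δ ω) ∂Q := by
  have hR := h.realizedVar_ae_eq T Δ
  have hR0 : 0 ≤ᵐ[Q] realizedVar Q X T Δ := by
    filter_upwards [hR] with ω hω
    rw [hω]
    exact h.avgVar_nonneg T Δ ω
  unfold vix
  simp_rw [ofReal_sqrt_sq]
  rw [← lintegral_mul_ofReal_condExp (𝓕.le T) (h.integrable_realizedVar T Δ) hR0 hF]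
  refine lintegral_congr_ae ?_
  filter_upwards [hR] with ω hω
  rw [hω]

lemma IsRoughBergomi.lintegral_mul_lintegral_explicitVar [IsProbabilityMeasure Q]
    (h : IsRoughBergomi 𝓕 Q H ν ρ ξ₀ W Z 𝒱 X) (T : ℝ≥0) {Δ : ℝ≥0} (hΔ : 0 < Δ)
    (F : Ω → ℝ≥0∞) :
    ∫⁻ ω, F ω * (∫⁻ t in Set.Ioc (T : ℝ) (T + Δ), ENNReal.ofReal (explicitVar H ν ξ₀ 𝒱 t ω)) ∂Q =
      Δ * ∫⁻ ω, F ω * ENNReal.ofReal (avgVar H ν ξ₀ 𝒱 T Δ ω) ∂Q := by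
  have hV := (h.integrable_explicitVar T.coe_nonneg (T + Δ)).prod_left_ae
  rw [← lintegral_const_mul' _ _ ENNReal.coe_ne_top]
  refine lintegral_congr_ae ?_
  filter_upwards [hV] with ω hω
  rw [lintegral_eq_ofReal_average hΔ hω fun t ht =>
    h.explicitVar_nonneg (T.coe_nonneg.trans ht.1.le) ω, mul_left_comm]
  rfl

lemma IsRoughBergomi.integrable_curve [IsProbabilityMeasure Q]
    (h : IsRoughBergomi 𝓕 Q H ν ρ ξ₀ W Z 𝒱 X) (T Δ : ℝ≥0) :
    Integrable (Function.uncurry ξ₀) (stripMeasure Q T (T + Δ)) :=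
  (h.curve_int (T + Δ) (by positivity)).mono_measure (stripMeasure_mono T.coe_nonneg le_rfl)

/-- The average of the initial forward variance curve over `[T, T + Δ]`. -/
noncomputable def avgCurve (ξ₀ : ℝ → Ω → ℝ) (T Δ : ℝ≥0) (ω : Ω) : ℝ :=
  1 / (Δ : ℝ) * ∫ t in Set.Ioc (T : ℝ) (T + Δ), ξ₀ t ω

lemma IsRoughBergomi.stronglyMeasurable_avgCurve (h : IsRoughBergomi 𝓕 Q H ν ρ ξ₀ W Z 𝒱 X)
    (T Δ : ℝ≥0) : StronglyMeasurable[𝓕 0] (avgCurve ξ₀ T Δ) :=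
  (stronglyMeasurable_setIntegral_time h.curve_meas _).const_mul _

lemma IsRoughBergomi.integrable_avgCurve [IsProbabilityMeasure Q]
    (h : IsRoughBergomi 𝓕 Q H ν ρ ξ₀ W Z 𝒱 X) (T Δ : ℝ≥0) :
    Integrable (avgCurve ξ₀ T Δ) Q :=
  (h.integrable_curve T Δ).integral_prod_right.const_mul _

/-- Tonelli moves the time average outside, where E(V_t | 𝓕_0) = ξ₀(t) applies at each t. -/
lemma IsRoughBergomi.lintegral_mul_avgVar [IsProbabilityMeasure Q]
    (h : IsRoughBergomi 𝓕 Q H ν ρ ξ₀ W Z 𝒱 X) (T : ℝ≥0) {Δ : ℝ≥0} (hΔ : 0 < Δ) {F : Ω → ℝ≥0∞}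
    (hF : Measurable[𝓕 0] F) :
    ∫⁻ ω, F ω * ENNReal.ofReal (avgVar H ν ξ₀ 𝒱 T Δ ω) ∂Q =
      ∫⁻ ω, F ω * ENNReal.ofReal (avgCurve ξ₀ T Δ ω) ∂Q := by
  have hFm : Measurable F := hF.mono (𝓕.le 0) le_rfl
  have hξ := (h.integrable_curve T Δ).prod_left_ae
  have swap : ∀ {f : ℝ → Ω → ℝ}, Measurable (Function.uncurry f) →
      ∫⁻ ω, F ω * (∫⁻ t in Set.Ioc (T : ℝ) (T + Δ), ENNReal.ofReal (f t ω)) ∂Q =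
        ∫⁻ t in Set.Ioc (T : ℝ) (T + Δ), ∫⁻ ω, F ω * ENNReal.ofReal (f t ω) ∂Q := by
    intro f hf
    rw [lintegral_lintegral_swap (by
      exact ((hFm.comp measurable_snd).mul hf.ennreal_ofReal).aemeasurable)]
    refine lintegral_congr fun ω => ?_
    exact (lintegral_const_mul _
      ((hf.comp measurable_prodMk_right).ennreal_ofReal)).symm
  have e : ∫⁻ ω, F ω * (∫⁻ t in Set.Ioc (T : ℝ) (T + Δ), ENNReal.ofReal (ξ₀ t ω)) ∂Q =
      Δ * ∫⁻ ω, F ω * ENNReal.ofReal (avgCurve ξ₀ T Δ ω) ∂Q := by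
    rw [← lintegral_const_mul' _ _ ENNReal.coe_ne_top]
    refine lintegral_congr_ae ?_
    filter_upwards [hξ] with ω hω
    rw [lintegral_eq_ofReal_average (f := fun t => ξ₀ t ω) hΔ hω fun t ht =>
      (h.curve_pos t ω (T.coe_nonneg.trans ht.1.le)).le, mul_left_comm]
    rfl
  have hΔ0 : (Δ : ℝ≥0∞) ≠ 0 := by exact_mod_cast hΔ.ne'
  rw [← ENNReal.mul_right_inj hΔ0 ENNReal.coe_ne_top, ← e,
    ← h.lintegral_mul_lintegral_explicitVar T hΔ F, swap h.measurable_explicitVar,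
    swap h.measurable_curve]
  refine lintegral_congr_ae ?_
  filter_upwards [ae_mem_Ioc] with t ht
  exact h.lintegral_mul_explicitVar (T.coe_nonneg.trans ht.1.le) hF

/-- Conditional Jensen given 𝓕 0: there the squared VIX and the average variance both have
conditional mean `avgCurve`. -/
theorem IsRoughBergomi.vixFuture_le [IsProbabilityMeasure Q]
    (h : IsRoughBergomi 𝓕 Q H ν ρ ξ₀ W Z 𝒱 X) (T : ℝ≥0) {Δ : ℝ≥0} (hΔ : 0 < Δ) :
    vixFuture 𝓕 Q X T Δ ≤ᵐ[Q] fun ω => Real.sqrt (avgCurve ξ₀ T Δ ω) := by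
  have hM := h.stronglyMeasurable_avgCurve T Δ
  refine condExp_le_of_setLIntegral_le (𝓕.le 0)
    (Real.continuous_sqrt.comp_stronglyMeasurable hM)
    (Eventually.of_forall fun ω => Real.sqrt_nonneg _) (integrable_sqrt (h.integrable_avgCurve T Δ))
    (integrable_vix T Δ) (Eventually.of_forall (vix_nonneg T Δ)) fun A hA => ?_
  refine setLIntegral_le_of_sq (𝓕.le 0)
    ((measurable_vix T Δ).mono (𝓕.le T) le_rfl).ennreal_ofReal
    hM.measurable.sqrt.ennreal_ofReal (fun F hF => ?_) hA
  simp_rw [ofReal_sqrt_sq]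
  rw [h.lintegral_mul_vix_sq T Δ (hF.mono (𝓕.mono zero_le) le_rfl), h.lintegral_mul_avgVar T hΔ hF]

/-- Jensen over t, with z the square root of the forward variance at time T, whose conditional mean
given 𝓕 0 is the integrand on the left. -/
theorem IsRoughBergomi.le_vixFuture [IsProbabilityMeasure Q]
    (h : IsRoughBergomi 𝓕 Q H ν ρ ξ₀ W Z 𝒱 X) (T : ℝ≥0) {Δ : ℝ≥0} (hΔ : 0 < Δ) :
    (fun ω => 1 / (Δ : ℝ) * ∫ t in Set.Ioc (T : ℝ) (T + Δ), Real.sqrt (ξ₀ t ω) *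
      Real.exp (ν ^ 2 * constC H ^ 2 / (4 * H) * ((t - T) ^ (2 * H) - t ^ (2 * H))))
      ≤ᵐ[Q] vixFuture 𝓕 Q X T Δ := by
  set f : ℝ → ℝ := fun t =>
    Real.exp (ν ^ 2 * constC H ^ 2 / (4 * H) * ((t - T) ^ (2 * H) - t ^ (2 * H))) with hf
  have hfm : Measurable f := by fun_prop
  have hgm := measurable_sqrt_mul h.curve_meas hfm
  have hgm' := measurable_sqrt_mul h.measurable_curve hfm
  have hg0 : ∀ t ω, 0 ≤ Real.sqrt (ξ₀ t ω) * f t := fun t ω => by positivity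
  have hvol : volume.restrict (Set.Ioc (T : ℝ) (T + Δ)) Set.univ = (Δ : ℝ≥0∞) := by simp
  refine le_condExp_of_setLIntegral_le (𝓕.le 0)
    ((stronglyMeasurable_setIntegral_time hgm _).const_mul _)
    (Eventually.of_forall fun ω => mul_nonneg (by positivity) (integral_nonneg fun t => hg0 t ω))
    (integrable_vix T Δ) (Eventually.of_forall (vix_nonneg T Δ)) fun A hA => ?_
  have key := setLIntegral_lintegral_le_of_sqrt (Q := Q)
    (μ := volume.restrict (Set.Ioc (T : ℝ) (T + Δ)))
    (V := fun t ω => ENNReal.ofReal (explicitVar H ν ξ₀ 𝒱 t ω))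
    (g := fun t ω => ENNReal.ofReal (Real.sqrt (ξ₀ t ω) * f t))
    (h := fun ω => ENNReal.ofReal (vix 𝓕 Q X T Δ ω))
    (𝓕.mono zero_le : 𝓕 0 ≤ 𝓕 T) (𝓕.le T) h.measurable_explicitVar.ennreal_ofReal
    hgm'.ennreal_ofReal (measurable_vix T Δ).ennreal_ofReal ?_ ?_ hA
  · rw [hvol] at key
    have hΔ0 : (Δ : ℝ≥0∞) ≠ 0 := by exact_mod_cast hΔ.ne'
    refine (ENNReal.mul_le_mul_iff_right hΔ0 ENNReal.coe_ne_top).1 (le_trans ?_ key)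
    rw [← lintegral_const_mul' _ _ ENNReal.coe_ne_top]
    refine lintegral_mono fun ω => ?_
    have hΔ' : (0 : ℝ) < Δ := hΔ
    dsimp only
    rw [← ENNReal.ofReal_coe_nnreal, ← ENNReal.ofReal_mul hΔ'.le, ← mul_assoc,
      mul_one_div_cancel hΔ'.ne', one_mul]
    exact ofReal_integral_le_lintegral
      (hgm'.comp measurable_prodMk_right).aestronglyMeasurable
      (Eventually.of_forall fun t => hg0 t ω)
  · filter_upwards [ae_mem_Ioc] with t ht
    have ht0 : 0 ≤ t := T.coe_nonneg.trans ht.1.le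
    lift t to ℝ≥0 using ht0
    obtain ⟨Y, hY, h1, h2, -⟩ := h.exists_forwardVar (NNReal.coe_le_coe.1 ht.1.le)
    refine ⟨fun ω => ENNReal.ofReal (Real.sqrt (Y ω)), hY.sqrt.ennreal_ofReal, fun F hF => ?_,
      fun B hB => ?_⟩
    · simp_rw [ofReal_sqrt_sq]
      exact h1 F hF
    -- An indicator as weight turns the weighted identity into one on the event.
    · have := h2 (B.indicator 1) (Measurable.indicator (@measurable_const _ _ _ (𝓕 0) 1) hB)
      rwa [lintegral_indicator_one_mul (𝓕.le 0 _ hB),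
        lintegral_indicator_one_mul (𝓕.le 0 _ hB)] at this
  · intro F hF
    rw [hvol, h.lintegral_mul_vix_sq T Δ hF,
      h.lintegral_mul_lintegral_explicitVar T hΔ F]

end Bounds

end VIXFutures

theorem theorem3p3 {Ω : Type*} {m : MeasurableSpace Ω} (Q : Measure Ω) [IsProbabilityMeasure Q]
    (𝓕 : Filtration ℝ≥0 m) (H ν ρ : ℝ) (ξ₀ : ℝ → Ω → ℝ) (W Z : ℝ≥0 → Ω → ℝ)
    (𝒱 : ℝ → Ω → ℝ) (X : ℝ≥0 → Ω → ℝ)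
    (hmodel : VIXFutures.IsRoughBergomi 𝓕 Q H ν ρ ξ₀ W Z 𝒱 X) (T Δ : ℝ≥0) (hΔ : 0 < Δ) :
    (∀ t : ℝ≥0, ∃ L : Ω → ℝ, VIXFutures.HasQuadVar Q X t L) ∧
    Integrable (VIXFutures.realizedVar Q X T Δ) Q ∧
    Integrable (VIXFutures.vix 𝓕 Q X T Δ) Q ∧
    ∀ᵐ ω ∂Q,
      IntervalIntegrable (fun t => ξ₀ t ω) volume (T : ℝ) (T + Δ) ∧
      1 / (Δ : ℝ) * (∫ t in (T : ℝ)..(T + Δ), Real.sqrt (ξ₀ t ω) *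
          Real.exp (ν ^ 2 * VIXFutures.constC H ^ 2 / (4 * H) *
            ((t - T) ^ (2 * H) - t ^ (2 * H))))
        ≤ VIXFutures.vixFuture 𝓕 Q X T Δ ω ∧
      VIXFutures.vixFuture 𝓕 Q X T Δ ω
        ≤ Real.sqrt (1 / (Δ : ℝ) * ∫ s in (T : ℝ)..(T + Δ), ξ₀ s ω) := by
  refine ⟨fun t => ⟨_, hmodel.hasQuadVar t⟩, hmodel.integrable_realizedVar T Δ,
    VIXFutures.integrable_vix T Δ, ?_⟩
  have hle : (T : ℝ) ≤ T + Δ := le_add_of_nonneg_right Δ.coe_nonneg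
  filter_upwards [(hmodel.integrable_curve T Δ).prod_left_ae, hmodel.le_vixFuture T hΔ,
    hmodel.vixFuture_le T hΔ] with ω hξ hlow hup
  rw [intervalIntegrable_iff_integrableOn_Ioc_of_le hle, intervalIntegral.integral_of_le hle,
    intervalIntegral.integral_of_le hle]
  exact ⟨hξ, hlow, hup⟩
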